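/- Let $\Sigma$ be a linearly ordered set (a general ordered alphabet: characters can only be compared with one another). For strings $T\in\Sigma^n$ and $P\in\Sigma^3$, an equidistant subsequence occurrence of $P$ in $T$ is a pair of integers $(i,d)$ with $1\le i\le n$ and $1\le d\le\lfloor (n-1)/2\rfloor$ such that $i+2d\le n$ and $P=T[i]\,T[i+d]\,T[i+2d]$. There is a single algorithm that, for every linearly ordered alphabet $\Sigma$, every $n$, every text $T\in\Sigma^n$ and every pattern $P\in\Sigma^3$, given $T$, $n$ and $P$, computes the number of equidistant subsequence occurrences of $P$ in $T$ in $O(n\log^2 n)$ time and $O(n)$ space (as $n\to\infty$, with constants that depend neither on $\Sigma$ nor on $T$ and $P$). The model is the word RAM with word size $\Theta(\log n)$: there is a constant $c\ge 1$ such that, for every word size $w\ge c(\lfloor\log_2 n\rfloor+1)$ (with $\lfloor\log_2 0\rfloor$ read as $0$), the algorithm is correct and obeys the bounds. Arithmetic, bitwise and shift operations on $w$-bit words, random access to the working memory, and a comparison ($<$ or $=$) of two characters of the read-only input take one step each, and space is the number of words of working memory. -/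

import Mathlib

open Asymptotics Filter

/-- The equidistant subsequence occurrences of the pattern `P`, of length `m = |P| ≥ 2`, in the
text `T`, of length `n = |T|`: the pairs `(i, d)` with `1 ≤ i ≤ n` and `1 ≤ d ≤ ⌊(n-1)/(m-1)⌋`
such that `P = T[i] T[i+d] ⋯ T[i+(m-1)d]`. Positions of strings are counted from `1` here, so that
the character `T[q]` is the entry of index `q - 1` of the list `T`, and it does not exist
(value `none`) for `q > n`. -/
def equidistantOccurrences {α : Type*} [DecidableEq α] (T P : List α) : Finset (ℕ × ℕ) :=
  (Finset.Icc 1 T.length ×ˢ Finset.Icc 1 ((T.length - 1) / (P.length - 1))).filter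
    fun x => ∀ j < P.length, T[x.1 + j * x.2 - 1]? = P[j]?

namespace WordRAM

/-- The unit-cost binary operations on machine words. -/
inductive BinOp where
  | add | sub | mul | div | mod | and | or | xor | shl | shr

/-- Value of an operation on words of `w` bits; a word is a natural number below `2 ^ w`, and
arithmetic is modulo `2 ^ w`. (`x / 0 = 0` and `x % 0 = x`.) -/
def BinOp.eval (w : ℕ) : BinOp → ℕ → ℕ → ℕ
  | add, x, y => (x + y) % 2 ^ w
  | sub, x, y => (x + (2 ^ w - y)) % 2 ^ w
  | mul, x, y => (x * y) % 2 ^ w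
  | div, x, y => x / y
  | mod, x, y => x % y
  | and, x, y => x &&& y
  | or, x, y => x ||| y
  | xor, x, y => x ^^^ y
  | shl, x, y => (x <<< y) % 2 ^ w
  | shr, x, y => x >>> y

/-- Instructions. The letters `a`, `b`, `d` are names of registers and `t` is an instruction number.
An instruction names its registers explicitly, so a program uses only a constant number of them. -/
inductive Instr where
  /-- `reg d := k` -/
  | const (d k : ℕ)
  /-- `reg d := reg a op reg b` -/
  | bin (op : BinOp) (d a b : ℕ)
  /-- `reg d := mem (reg a)` -/
  | load (d a : ℕ)
  /-- `mem (reg a) := reg b` -/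
  | store (a b : ℕ)
  /-- go to `t` -/
  | jump (t : ℕ)
  /-- if `reg a < reg b` go to `t` -/
  | jumpLt (a b t : ℕ)
  /-- if `reg a = reg b` go to `t` -/
  | jumpEq (a b t : ℕ)
  /-- if (input character number `reg a`) `<` (input character number `reg b`) go to `t` -/
  | jumpCharLt (a b t : ℕ)
  /-- if (input character number `reg a`) `=` (input character number `reg b`) go to `t` -/
  | jumpCharEq (a b t : ℕ)
  | halt

/-- A program: one finite list of instructions, the same for all inputs and all word sizes. -/
abbrev Program := List Instr

/-- A configuration: instruction counter, registers, and working memory. -/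
structure Config where
  pc : ℕ
  reg : ℕ → ℕ
  mem : ℕ → ℕ

/-- Write the word `v` to register `d` and go on to the next instruction. -/
def Config.setReg (c : Config) (d v : ℕ) : Config :=
  { c with pc := c.pc + 1, reg := Function.update c.reg d v }

/-- Go to `t` if `p`, and to the next instruction otherwise. -/
def Config.branch (c : Config) (p : Bool) (t : ℕ) : Config :=
  { c with pc := if p then t else c.pc + 1 }

/-- One step of the machine with words of `w` bits and a working memory of `S` words, on the
read-only input `inp`, whose characters can only be compared with one another. The value is `none`
if the machine has halted, and also if it fails, because the instruction counter leaves the program,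
or a memory address is not below `S`, or an input position is not below the input length. -/
def step {α : Type*} [LinearOrder α] (prog : Program) (w S : ℕ) (inp : List α) (c : Config) :
    Option Config :=
  match prog[c.pc]? with
  | none => none
  | some .halt => none
  | some (.const d k) => some (c.setReg d (k % 2 ^ w))
  | some (.bin op d a b) => some (c.setReg d (op.eval w (c.reg a) (c.reg b)))
  | some (.load d a) => if c.reg a < S then some (c.setReg d (c.mem (c.reg a))) else none
  | some (.store a b) =>
      if c.reg a < S then
        some { c with pc := c.pc + 1, mem := Function.update c.mem (c.reg a) (c.reg b) }
      else none
  | some (.jump t) => some { c with pc := t }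
  | some (.jumpLt a b t) => some (c.branch (decide (c.reg a < c.reg b)) t)
  | some (.jumpEq a b t) => some (c.branch (decide (c.reg a = c.reg b)) t)
  | some (.jumpCharLt a b t) =>
      match inp[c.reg a]?, inp[c.reg b]? with
      | some x, some y => some (c.branch (decide (x < y)) t)
      | _, _ => none
  | some (.jumpCharEq a b t) =>
      match inp[c.reg a]?, inp[c.reg b]? with
      | some x, some y => some (c.branch (decide (x = y)) t)
      | _, _ => none

/-- The configuration after exactly `k` steps, if all of them can be made. -/
def run {α : Type*} [LinearOrder α] (prog : Program) (w S : ℕ) (inp : List α) :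
    ℕ → Config → Option Config
  | 0, c => some c
  | k + 1, c => (step prog w S inp c).bind (run prog w S inp k)

/-- The initial configuration: register `0` holds the length `n` of the text, register `1` the
length `m` of the pattern; all other registers and all memory words are zero. -/
def init (w n m : ℕ) : Config where
  pc := 0
  reg := fun r => if r = 0 then n % 2 ^ w else if r = 1 then m % 2 ^ w else 0
  mem := fun _ => 0

/-- With words of `w` bits, the program, started on the text `T` and the pattern `P` (the read-only
input consists of the characters of `T` followed by those of `P`), reaches a `halt` instruction
after at most `time` steps, using a working memory of at most `space` words, and register `0` then
holds the value `out`. -/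
def Computes {α : Type*} [LinearOrder α] (prog : Program) (w : ℕ) (T P : List α)
    (time space out : ℕ) : Prop :=
  ∃ k ≤ time, ∃ c : Config,
    run prog w space (T ++ P) k (init w T.length P.length) = some c ∧
      prog[c.pc]? = some Instr.halt ∧ c.reg 0 = out

end WordRAM

set_option linter.constructorNameAsVariable false
set_option linter.unusedSimpArgs false

/-! An occurrence is a triple of positions `a < b < c` in which `b` is the midpoint of `a` and `c`.
The characters enter only through three indicator sequences `fA`, `fB`, `fC`, one per character of
the pattern, padded with zeros to length `K = 2 ^ L`, where `K` is linear in `n`. Every pair `a < c`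
is separated by the two halves of exactly one dyadic block, so the count is a sum of cross terms
over all blocks of all sizes (`card_equidistantOccurrences`, `sum_pairSum_succ`); blocks of size 2
contribute nothing, by parity.

The cross term of a block with halves of length `h` is a constant coefficient. Give `a` the monomial
`z ^ (a + 1)`, `c` the monomial `z ^ (c + 1)`, and the midpoint sequence, reversed, the monomials `z
^ (2 * u)`. The exponent `a + c + 2 * u + 2` is a multiple of `2 * h` exactly when `u` is the
reversed midpoint. Hence the sum of the product of the three polynomials over the `2 * h`-th roots
of unity is `2 * h` times the cross term (`sum_transforms`, `crossSum_triple`). Three forward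
transforms suffice and no inverse is needed. A block costs `O(h log K)`, a level `O(K log K)`, and
there are `L - 1` levels.

The transform splits `X ^ (2 * m) - root j` into `X ^ m - twiddle j` and `X ^ m + twiddle j`. With
the roots in bit-reversed order one table of twiddle factors serves all sizes, and the table doubles
by multiplication with a single number (`twiddle_two_pow_add`), obtained from half-angle formulas
and integer square roots.

Complex numbers are pairs of integers at scale `S = 2 ^ (10 * L + 16)`. Twiddle factors are off by
at most `2 ^ (6 * L + 11)`, transforms by at most `2 ^ (8 * L + 11)`, and the final sum by less than
`h * S`, half of its unit `2 * h * S`, so rounding gives the exact integer (`product_error_lt`,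
`rounded_div`). All intermediate values fit into `24 * L + 45` bits, which is `O(log n)`.

The machine code comes from a small structured language over the integers. `Exec.run_compile` shows
that compilation preserves meaning and step counts; `wp_of_vc` and `wp_loop` reduce statements about
programs to arithmetic. -/

namespace WordRAM

/-! ### Integer expressions and their compilation to machine words. -/

/-- The variables of the counting program. -/
inductive Var where
  | n | K | l | S | Q | cnt | i | k | j | bit | x | rt | it | cs | sn | pw
  | r | h | nb | b | s | t | e | m | q | lg | N | ur | ui | vr | vi | wr | wi | p | acc | ans
  deriving DecidableEq

/-- Variables live in registers of even number; odd registers are temporaries. -/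
def Var.idx : Var → ℕ
  | n => 0 | K => 1 | l => 2 | S => 3 | Q => 4 | cnt => 5 | i => 6 | k => 7 | j => 8 | bit => 9
  | x => 10 | rt => 11 | it => 12 | cs => 13 | sn => 14 | pw => 15 | r => 16 | h => 17 | nb => 18
  | b => 19 | s => 20 | t => 21 | e => 22 | m => 23 | q => 24 | lg => 25 | N => 26 | ur => 27
  | ui => 28 | vr => 29 | vi => 30 | wr => 31 | wi => 32 | p => 33 | acc => 34 | ans => 35

theorem Var.idx_injective : Function.Injective Var.idx := by
  intro a b h
  cases a <;> cases b <;> first | rfl | (exact absurd h (by decide))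

/-- A state of the structured language: variables and memory hold integers. -/
structure St where
  reg : Var → ℤ
  mem : ℤ → ℤ

def St.set (σ : St) (x : Var) (v : ℤ) : St := { σ with reg := Function.update σ.reg x v }

def St.put (σ : St) (a v : ℤ) : St := { σ with mem := Function.update σ.mem a v }

@[simp] theorem St.set_reg (σ : St) (x y : Var) (v : ℤ) :
    (σ.set x v).reg y = if y = x then v else σ.reg y := by
  simp [St.set, Function.update_apply]

@[simp] theorem St.set_mem (σ : St) (x : Var) (v : ℤ) : (σ.set x v).mem = σ.mem := rfl

@[simp] theorem St.put_reg (σ : St) (a v : ℤ) : (σ.put a v).reg = σ.reg := rfl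

@[simp] theorem St.put_mem (σ : St) (a c v : ℤ) :
    (σ.put a v).mem c = if c = a then v else σ.mem c := by
  simp [St.put, Function.update_apply]

inductive Op where
  | add | sub | mul | div

def Op.toBinOp : Op → BinOp
  | add => .add | sub => .sub | mul => .mul | div => .div

def Op.eval : Op → ℤ → ℤ → ℤ
  | add, x, y => x + y
  | sub, x, y => x - y
  | mul, x, y => x * y
  | div, x, y => x / y

/-- The integer operation agrees with the one on words; only division needs its operands to be
words. -/
def Op.Ok (w : ℕ) : Op → ℤ → ℤ → Prop
  | div, x, y => (0 ≤ x ∧ x < 2 ^ w) ∧ (0 ≤ y ∧ y < 2 ^ w)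
  | _, _, _ => True

/-- Reduction modulo `2 ^ w` is a ring homomorphism, so sums, differences and products may overflow
or become negative without harm. Quotients do not commute with reduction, which is why they need
operands in range. -/
theorem Op.eval_word {w : ℕ} (op : Op) {x y : ℕ} {X Y : ℤ} (hx : (x : ℤ) = X % 2 ^ w)
    (hy : (y : ℤ) = Y % 2 ^ w) (hok : op.Ok w X Y) :
    ((op.toBinOp.eval w x y : ℕ) : ℤ) = op.eval X Y % 2 ^ w := by
  have hpos : (0 : ℤ) < 2 ^ w := by positivity
  cases op with
  | add => simp [Op.toBinOp, BinOp.eval, Op.eval, hx, hy, Int.add_emod]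
  | sub =>
    have hle : y ≤ 2 ^ w := by
      have h1 := Int.emod_lt_of_pos Y hpos
      have : (y : ℤ) < 2 ^ w := by rw [hy]; exact h1
      exact_mod_cast this.le
    simp only [Op.toBinOp, BinOp.eval, Op.eval]
    push_cast [Nat.cast_sub hle]
    rw [hx, hy, Int.sub_emod, show X % 2 ^ w + (2 ^ w - Y % 2 ^ w) = (X % 2 ^ w - Y % 2 ^ w) + 2 ^ w
      by ring, Int.add_emod_right]
  | mul => simp [Op.toBinOp, BinOp.eval, Op.eval, hx, hy, Int.mul_emod]
  | div =>
    obtain ⟨⟨h1, h2⟩, h3, h4⟩ := hok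
    rw [Int.emod_eq_of_lt h1 h2] at hx
    rw [Int.emod_eq_of_lt h3 h4] at hy
    simp only [Op.toBinOp, BinOp.eval, Op.eval]
    push_cast
    rw [hx, hy, Int.emod_eq_of_lt (Int.ediv_nonneg h1 h3)]
    exact lt_of_le_of_lt (Int.ediv_le_self _ h1) h2

inductive Ex where
  | var (x : Var)
  | lit (k : ℕ)
  | bin (op : Op) (a b : Ex)
  | ld (a : Ex)

instance : Coe Var Ex := ⟨.var⟩
instance (k : ℕ) : OfNat Ex k := ⟨.lit k⟩
instance : Add Ex := ⟨.bin .add⟩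
instance : Sub Ex := ⟨.bin .sub⟩
instance : Mul Ex := ⟨.bin .mul⟩
instance : Div Ex := ⟨.bin .div⟩

namespace Ex

def eval (σ : St) : Ex → ℤ
  | var x => σ.reg x
  | lit k => k
  | bin op a b => op.eval (a.eval σ) (b.eval σ)
  | ld a => σ.mem (a.eval σ)

def Ok (w M : ℕ) (σ : St) : Ex → Prop
  | var _ => True
  | lit _ => True
  | bin op a b => a.Ok w M σ ∧ b.Ok w M σ ∧ op.Ok w (a.eval σ) (b.eval σ)
  | ld a => a.Ok w M σ ∧ 0 ≤ a.eval σ ∧ a.eval σ < M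

def size : Ex → ℕ
  | var _ => 1
  | lit _ => 1
  | bin _ a b => a.size + b.size + 1
  | ld a => a.size + 1

/-- Code that leaves the value of the expression in the temporary number `d`. -/
def compile : Ex → ℕ → List Instr
  | var x, d => [.bin .or (2 * d + 1) (2 * x.idx) (2 * x.idx)]
  | lit k, d => [.const (2 * d + 1) k]
  | bin op a b, d =>
      a.compile d ++ b.compile (d + 1) ++ [.bin op.toBinOp (2 * d + 1) (2 * d + 1) (2 * (d + 1) + 1)]
  | ld a, d => a.compile d ++ [.load (2 * d + 1) (2 * d + 1)]

theorem length_compile (e : Ex) (d : ℕ) : (e.compile d).length = e.size := by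
  induction e generalizing d with
  | var | lit => rfl
  | bin op a b iha ihb => simp [compile, size, iha, ihb, add_assoc]
  | ld a ih => simp [compile, size, ih]

variable (σ : St) (w M : ℕ) (a b : Ex)
@[simp] theorem eval_var (x : Var) : (var x).eval σ = σ.reg x := rfl
@[simp] theorem eval_lit (k : ℕ) : (no_index (OfNat.ofNat k) : Ex).eval σ = k := rfl
@[simp] theorem eval_add : (a + b).eval σ = a.eval σ + b.eval σ := rfl
@[simp] theorem eval_sub : (a - b).eval σ = a.eval σ - b.eval σ := rfl
@[simp] theorem eval_mul : (a * b).eval σ = a.eval σ * b.eval σ := rfl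
@[simp] theorem eval_div : (a / b).eval σ = a.eval σ / b.eval σ := rfl
@[simp] theorem eval_ld : (ld a).eval σ = σ.mem (a.eval σ) := rfl
@[simp] theorem size_var (x : Var) : (var x).size = 1 := rfl
@[simp] theorem size_lit (k : ℕ) : (no_index (OfNat.ofNat k) : Ex).size = 1 := rfl
@[simp] theorem size_add : (a + b).size = a.size + b.size + 1 := rfl
@[simp] theorem size_sub : (a - b).size = a.size + b.size + 1 := rfl
@[simp] theorem size_mul : (a * b).size = a.size + b.size + 1 := rfl
@[simp] theorem size_div : (a / b).size = a.size + b.size + 1 := rfl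
@[simp] theorem size_ld : (ld a).size = a.size + 1 := rfl
@[simp] theorem ok_var (x : Var) : (var x).Ok w M σ := trivial
@[simp] theorem ok_lit (k : ℕ) : (no_index (OfNat.ofNat k) : Ex).Ok w M σ := trivial
@[simp] theorem ok_add : (a + b).Ok w M σ ↔ a.Ok w M σ ∧ b.Ok w M σ := by
  simp [HAdd.hAdd, Add.add, Ok, Op.Ok]
@[simp] theorem ok_sub : (a - b).Ok w M σ ↔ a.Ok w M σ ∧ b.Ok w M σ := by
  simp [HSub.hSub, Sub.sub, Ok, Op.Ok]
@[simp] theorem ok_mul : (a * b).Ok w M σ ↔ a.Ok w M σ ∧ b.Ok w M σ := by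
  simp [HMul.hMul, Mul.mul, Ok, Op.Ok]
@[simp] theorem ok_div : (a / b).Ok w M σ ↔ a.Ok w M σ ∧ b.Ok w M σ ∧
    (0 ≤ a.eval σ ∧ a.eval σ < 2 ^ w) ∧ (0 ≤ b.eval σ ∧ b.eval σ < 2 ^ w) := Iff.rfl
@[simp] theorem ok_ld : (ld a).Ok w M σ ↔ a.Ok w M σ ∧ 0 ≤ a.eval σ ∧ a.eval σ < M := Iff.rfl

end Ex

section Machine

variable {α : Type*} [LinearOrder α] (prog : Program) (w M : ℕ) (inp : List α)

/-- The registers and the memory of the machine represent the state `σ` modulo `2 ^ w`. -/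
def Rep (σ : St) (reg mem : ℕ → ℕ) : Prop :=
  (∀ x : Var, (reg (2 * x.idx) : ℤ) = σ.reg x % 2 ^ w) ∧ ∀ a : ℕ, (mem a : ℤ) = σ.mem a % 2 ^ w

def CodeAt (off : ℕ) (code : List Instr) : Prop :=
  ∀ i, i < code.length → prog[off + i]? = code[i]?

variable {prog}

theorem codeAt_append {off : ℕ} {c₁ c₂ : List Instr} (h : CodeAt prog off (c₁ ++ c₂)) :
    CodeAt prog off c₁ ∧ CodeAt prog (off + c₁.length) c₂ := by
  constructor
  · intro i hi
    rw [h i (by simp; omega), List.getElem?_append_left hi]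
  · intro i hi
    rw [add_assoc, h (c₁.length + i) (by simp; omega), List.getElem?_append_right (by omega)]
    simp

theorem codeAt_cons {off : ℕ} {ins : Instr} {c : List Instr} (h : CodeAt prog off (ins :: c)) :
    prog[off]? = some ins ∧ CodeAt prog (off + 1) c := by
  have := codeAt_append (c₁ := [ins]) (c₂ := c) h
  exact ⟨by simpa using this.1 0 (by simp), by simpa using this.2⟩

variable {w M inp}

theorem run_add {k₁ k₂ : ℕ} {c c' : Config} (h : run prog w M inp k₁ c = some c') :
    run prog w M inp (k₁ + k₂) c = run prog w M inp k₂ c' := by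
  induction k₁ generalizing c with
  | zero => simp only [run, Option.some.injEq] at h; subst h; simp
  | succ k ih =>
    rw [run, Option.bind_eq_some_iff] at h
    obtain ⟨d, hd, h⟩ := h
    rw [show k + 1 + k₂ = (k + k₂) + 1 by ring, run, hd]
    exact ih h

theorem run_trans {k₁ k₂ : ℕ} {c c' c'' : Config} (h : run prog w M inp k₁ c = some c')
    (h' : run prog w M inp k₂ c' = some c'') : run prog w M inp (k₁ + k₂) c = some c'' := by
  rw [run_add h, h']

theorem run_one (c : Config) : run prog w M inp 1 c = step prog w M inp c := by
  simp [run]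

theorem two_mul_idx_ne (x : Var) (d : ℕ) : 2 * x.idx ≠ 2 * d + 1 := by omega

/-- The temporaries act as a stack: code for depth `d` leaves everything below `d` alone, so the
value of a left operand survives the evaluation of the right one. -/
theorem Ex.run_compile (e : Ex) {σ : St} (hok : e.Ok w M σ) (hM : M ≤ 2 ^ w) :
    ∀ (d off : ℕ) (reg mem : ℕ → ℕ), CodeAt prog off (e.compile d) → Rep w σ reg mem →
      ∃ reg', run prog w M inp e.size ⟨off, reg, mem⟩ = some ⟨off + e.size, reg', mem⟩ ∧
        Rep w σ reg' mem ∧ (reg' (2 * d + 1) : ℤ) = e.eval σ % 2 ^ w ∧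
        ∀ d' < d, reg' (2 * d' + 1) = reg (2 * d' + 1) := by
  -- Temporaries are odd registers and variables even ones, so a write to a temporary cannot disturb
  -- the represented state.
  have key : ∀ (d v : ℕ) (reg mem : ℕ → ℕ), Rep w σ reg mem →
      Rep w σ (Function.update reg (2 * d + 1) v) mem ∧
      ∀ d' < d, Function.update reg (2 * d + 1) v (2 * d' + 1) = reg (2 * d' + 1) := by
    intro d v reg mem h
    refine ⟨⟨fun x => ?_, h.2⟩, fun d' hd' => ?_⟩
    · rw [Function.update_of_ne (two_mul_idx_ne x d)]; exact h.1 x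
    · rw [Function.update_of_ne (by omega)]
  induction e with
  | var x =>
    intro d off reg mem hc hR
    have h0 := (codeAt_cons hc).1
    have h1 := key d (reg (2 * x.idx)) reg mem hR
    refine ⟨_, ?_, h1.1, ?_, h1.2⟩
    · simp [Ex.size, run_one, step, h0, Config.setReg, BinOp.eval]
    · simpa using hR.1 x
  | lit k =>
    intro d off reg mem hc hR
    have h0 := (codeAt_cons hc).1
    have h1 := key d (k % 2 ^ w) reg mem hR
    refine ⟨_, ?_, h1.1, ?_, h1.2⟩
    · simp [Ex.size, run_one, step, h0, Config.setReg]
    · simp [Ex.eval]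
  | bin op a b iha ihb =>
    intro d off reg mem hc hR
    obtain ⟨ha, hb, hop⟩ := hok
    obtain ⟨hc, hc3⟩ := codeAt_append hc
    obtain ⟨hc1, hc2⟩ := codeAt_append hc
    obtain ⟨r1, e1, R1, v1, k1⟩ := iha ha d off reg mem hc1 hR
    rw [Ex.length_compile] at hc2
    obtain ⟨r2, e2, R2, v2, k2⟩ := ihb hb (d + 1) _ r1 mem hc2 R1
    have h0 := (codeAt_cons hc3).1
    simp only [List.length_append, Ex.length_compile, ← add_assoc] at h0
    have h1 := key d (op.toBinOp.eval w (r2 (2 * d + 1)) (r2 (2 * (d + 1) + 1))) r2 mem R2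
    refine ⟨_, ?_, h1.1, ?_, fun d' hd' => ?_⟩
    · refine run_trans (run_trans e1 e2) ?_
      simp only [run_one, step, h0]
      simp [Config.setReg, Ex.size, add_assoc]
    · rw [Function.update_self]
      exact op.eval_word (by rw [k2 d (by omega), v1]) v2 hop
    · rw [h1.2 d' hd', k2 d' (by omega), k1 d' hd']
  | ld a iha =>
    intro d off reg mem hc hR
    obtain ⟨ha, h0, hlt⟩ := hok
    obtain ⟨hc1, hc2⟩ := codeAt_append hc
    obtain ⟨r1, e1, R1, v1, k1⟩ := iha ha d off reg mem hc1 hR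
    have hi := (codeAt_cons hc2).1
    simp only [Ex.length_compile] at hi
    have hMw : (M : ℤ) ≤ 2 ^ w := by exact_mod_cast hM
    rw [Int.emod_eq_of_lt h0 (by omega)] at v1
    have hlt' : r1 (2 * d + 1) < M := by omega
    have h1 := key d (mem (r1 (2 * d + 1))) r1 mem R1
    refine ⟨_, ?_, h1.1, ?_, fun d' hd' => by rw [h1.2 d' hd', k1 d' hd']⟩
    · refine run_trans e1 ?_
      simp only [run_one, step, hi]
      simp [Config.setReg, hlt', Ex.size, add_assoc]
    · rw [Function.update_self, R1.2, v1, Ex.eval]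

end Machine

theorem Rep.set {w : ℕ} {σ : St} {reg mem : ℕ → ℕ} (h : Rep w σ reg mem) (x : Var) {v : ℕ} {V : ℤ}
    (hv : (v : ℤ) = V % 2 ^ w) : Rep w (σ.set x V) (Function.update reg (2 * x.idx) v) mem := by
  refine ⟨fun y => ?_, h.2⟩
  by_cases hy : y = x
  · subst hy; simpa using hv
  · rw [Function.update_of_ne, h.1 y]
    · simp [hy]
    · intro he
      exact hy (Var.idx_injective (by omega))

theorem Rep.put {w : ℕ} {σ : St} {reg mem : ℕ → ℕ} (h : Rep w σ reg mem) (a : ℕ) {v : ℕ} {V : ℤ}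
    (hv : (v : ℤ) = V % 2 ^ w) : Rep w (σ.put a V) reg (Function.update mem a v) := by
  refine ⟨h.1, fun y => ?_⟩
  by_cases hy : y = a
  · subst hy; simpa using hv
  · rw [Function.update_of_ne hy, h.2 y]
    simp [hy]

/-! ### Conditional jumps. -/

/-- Conditions: comparison of words, equality of input characters. -/
inductive Cond where
  | lt (a b : Ex)
  | charEq (a b : Ex)

namespace Cond

def Holds {α : Type*} (inp : List α) (σ : St) : Cond → Prop
  | lt a b => a.eval σ < b.eval σ
  | charEq a b => inp[(a.eval σ).toNat]? = inp[(b.eval σ).toNat]?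

def Ok {α : Type*} (w M : ℕ) (inp : List α) (σ : St) : Cond → Prop
  | lt a b => (a.Ok w M σ ∧ b.Ok w M σ) ∧
      (0 ≤ a.eval σ ∧ a.eval σ < 2 ^ w) ∧ (0 ≤ b.eval σ ∧ b.eval σ < 2 ^ w)
  | charEq a b => (a.Ok w M σ ∧ b.Ok w M σ) ∧
      ((0 ≤ a.eval σ ∧ a.eval σ < 2 ^ w) ∧ (0 ≤ b.eval σ ∧ b.eval σ < 2 ^ w)) ∧
      a.eval σ < inp.length ∧ b.eval σ < inp.length

def fst : Cond → Ex
  | lt a _ => a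
  | charEq a _ => a

def snd : Cond → Ex
  | lt _ b => b
  | charEq _ b => b

def jump : Cond → ℕ → Instr
  | lt _ _, t => .jumpLt 1 3 t
  | charEq _ _, t => .jumpCharEq 1 3 t

def size (c : Cond) : ℕ := c.fst.size + c.snd.size

/-- Code that goes to `t` if the condition holds and to the instruction after it otherwise. -/
def compile (c : Cond) (t : ℕ) : List Instr :=
  c.fst.compile 0 ++ c.snd.compile 1 ++ [c.jump t]

theorem length_compile (c : Cond) (t : ℕ) : (c.compile t).length = c.size + 1 := by
  simp [compile, size, Ex.length_compile, add_assoc]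

/-- Comparison and input access see residues only; the range conditions make the residues equal to
the integers themselves. -/
theorem run_compile {α : Type*} [LinearOrder α] {prog : Program} {w M : ℕ} {inp : List α}
    (c : Cond) {σ : St} (hok : c.Ok w M inp σ) (hM : M ≤ 2 ^ w) {t off : ℕ} {reg mem : ℕ → ℕ}
    (hc : CodeAt prog off (c.compile t)) (hR : Rep w σ reg mem) :
    ∃ reg', Rep w σ reg' mem ∧
      (c.Holds inp σ → run prog w M inp (c.size + 1) ⟨off, reg, mem⟩ = some ⟨t, reg', mem⟩) ∧
      (¬ c.Holds inp σ →
        run prog w M inp (c.size + 1) ⟨off, reg, mem⟩ = some ⟨off + c.size + 1, reg', mem⟩) := by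
  obtain ⟨hc, hc3⟩ := codeAt_append hc
  obtain ⟨hc1, hc2⟩ := codeAt_append hc
  have hok' : c.fst.Ok w M σ ∧ c.snd.Ok w M σ := by cases c <;> exact hok.1
  have hran : (0 ≤ c.fst.eval σ ∧ c.fst.eval σ < 2 ^ w) ∧
      (0 ≤ c.snd.eval σ ∧ c.snd.eval σ < 2 ^ w) := by
    cases c
    · exact hok.2
    · exact hok.2.1
  obtain ⟨r1, e1, R1, v1, k1⟩ := c.fst.run_compile (inp := inp) hok'.1 hM 0 off reg mem hc1 hR
  rw [Ex.length_compile] at hc2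
  obtain ⟨r2, e2, R2, v2, k2⟩ := c.snd.run_compile (inp := inp) hok'.2 hM 1 _ r1 mem hc2 R1
  have h0 := (codeAt_cons hc3).1
  simp only [List.length_append, Ex.length_compile, ← add_assoc] at h0
  have w1 : (r2 1 : ℤ) = c.fst.eval σ := by
    have := k2 0 (by omega)
    simp only [mul_zero, zero_add] at this
    rw [this, ← Int.emod_eq_of_lt hran.1.1 hran.1.2]; exact v1
  have w2 : (r2 3 : ℤ) = c.snd.eval σ := by
    rw [← Int.emod_eq_of_lt hran.2.1 hran.2.2]; exact v2
  have hrun := run_trans e1 e2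
  refine ⟨r2, R2, fun hh => run_trans hrun ?_, fun hh => run_trans hrun ?_⟩
  all_goals
    cases c with
    | lt a b =>
      simp only [Cond.Holds, Cond.fst, Cond.snd] at *
      rw [← w1, ← w2] at hh
      simp only [Nat.cast_lt] at hh
      simp only [Cond.jump] at h0
      simp only [run_one, step, ← add_assoc, h0]
      simp [Config.branch, Cond.size, Cond.fst, Cond.snd, hh,
        add_assoc]
    | charEq a b =>
      simp only [Cond.Holds, Cond.fst, Cond.snd] at *
      obtain ⟨-, -, l1, l2⟩ := hok
      rw [← w1] at l1
      rw [← w2] at l2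
      rw [← w1, ← w2] at hh
      have l1' : r2 1 < inp.length := by exact_mod_cast l1
      have l2' : r2 3 < inp.length := by exact_mod_cast l2
      simp only [Int.toNat_natCast, List.getElem?_eq_getElem l1', List.getElem?_eq_getElem l2',
        Option.some.injEq] at hh
      simp only [Cond.jump] at h0
      simp only [run_one, step, ← add_assoc, h0]
      simp [Config.branch, Cond.size, Cond.fst, Cond.snd, hh,
        List.getElem?_eq_getElem l1', List.getElem?_eq_getElem l2', add_assoc]

end Cond

/-! ### Structured programs, their semantics and their compilation. -/

/-- Structured programs. -/
inductive Com where
  | assign (x : Var) (e : Ex)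
  | store (a e : Ex)
  | seq (c₁ c₂ : Com)
  | ifc (b : Cond) (c : Com)
  | whileDo (b : Cond) (c : Com)

namespace Com

def size : Com → ℕ
  | assign _ e => e.size + 1
  | store a e => a.size + e.size + 1
  | seq c₁ c₂ => c₁.size + c₂.size
  | ifc b c => b.size + 2 + c.size
  | .whileDo b c => b.size + 2 + c.size + 1

def compile : Com → ℕ → List Instr
  | assign x e, _ => e.compile 0 ++ [.bin .or (2 * x.idx) 1 1]
  | store a e, _ => a.compile 0 ++ e.compile 1 ++ [.store 1 3]
  | seq c₁ c₂, off => c₁.compile off ++ c₂.compile (off + c₁.size)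
  | ifc b c, off =>
      b.compile (off + b.size + 2) ++
        ([.jump (off + b.size + 2 + c.size)] ++ c.compile (off + b.size + 2))
  | .whileDo b c, off =>
      b.compile (off + b.size + 2) ++
        ([.jump (off + b.size + 2 + c.size + 1)] ++ (c.compile (off + b.size + 2) ++ [.jump off]))

theorem length_compile (c : Com) (off : ℕ) : (c.compile off).length = c.size := by
  induction c generalizing off with
  | assign x e => simp [compile, size, Ex.length_compile]
  | store a e => simp [compile, size, Ex.length_compile, add_assoc]
  | seq c₁ c₂ h₁ h₂ => simp [compile, size, h₁, h₂]
  | ifc b c ih => simp [compile, size, Cond.length_compile, ih]; ring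
  | whileDo b c ih => simp [compile, size, Cond.length_compile, ih]; ring

/-- A decidable over-approximation of the set of changed variables, so that frame conditions for
concrete programs hold by `rfl`. -/
def writes : Com → Var → Bool
  | assign x _, v => v = x
  | store _ _, _ => false
  | seq c₁ c₂, v => c₁.writes v || c₂.writes v
  | ifc _ c, v => c.writes v
  | .whileDo _ c, v => c.writes v

variable {α : Type*} (w M : ℕ) (inp : List α)

/-- Big-step semantics; the last argument is the number of machine steps. -/
inductive Exec : Com → St → St → ℕ → Prop
  | assign {σ x e} : e.Ok w M σ → Exec (.assign x e) σ (σ.set x (e.eval σ)) (e.size + 1)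
  | store {σ a e} : a.Ok w M σ → e.Ok w M σ → 0 ≤ a.eval σ → a.eval σ < (M : ℤ) →
      Exec (.store a e) σ (σ.put (a.eval σ) (e.eval σ)) (a.size + e.size + 1)
  | seq {σ σ' σ'' c₁ c₂ k₁ k₂} : Exec c₁ σ σ' k₁ → Exec c₂ σ' σ'' k₂ →
      Exec (.seq c₁ c₂) σ σ'' (k₁ + k₂)
  | if_true {σ σ' b c k} : b.Ok w M inp σ → b.Holds inp σ → Exec c σ σ' k →
      Exec (.ifc b c) σ σ' (b.size + 1 + k)
  | if_false {σ b c} : b.Ok w M inp σ → ¬ b.Holds inp σ → Exec (.ifc b c) σ σ (b.size + 1 + 1)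
  | while_true {σ σ' σ'' b c k k'} : b.Ok w M inp σ → b.Holds inp σ → Exec c σ σ' k →
      Exec (.whileDo b c) σ' σ'' k' → Exec (.whileDo b c) σ σ'' (b.size + 1 + (k + (1 + k')))
  | while_false {σ b c} : b.Ok w M inp σ → ¬ b.Holds inp σ →
      Exec (.whileDo b c) σ σ (b.size + 1 + 1)

variable {w M inp}

theorem Exec.reg_eq {c : Com} {σ σ' : St} {k : ℕ} (h : Exec w M inp c σ σ' k) {v : Var}
    (hv : c.writes v = false) : σ'.reg v = σ.reg v := by
  induction h with
  | assign _ => simp only [writes, decide_eq_false_iff_not] at hv; simp [hv]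
  | store => rfl
  | seq _ _ ih₁ ih₂ =>
    simp only [writes, Bool.or_eq_false_iff] at hv
    rw [ih₂ hv.2, ih₁ hv.1]
  | if_true _ _ _ ih => exact ih hv
  | if_false => rfl
  | while_true _ _ _ _ ih₁ ih₂ => rw [ih₂ hv, ih₁ hv]
  | while_false => rfl

/-- The step count of the semantics is exact, so every time bound proved for structured programs
carries over to the machine. `M ≤ 2 ^ w` makes legal addresses words. -/
theorem Exec.run_compile [LinearOrder α] {prog : Program} (hM : M ≤ 2 ^ w) {c : Com} {σ σ' : St}
    {k : ℕ} (h : Exec w M inp c σ σ' k) :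
    ∀ (off : ℕ) (reg mem : ℕ → ℕ), CodeAt prog off (c.compile off) → Rep w σ reg mem →
      ∃ reg' mem', run prog w M inp k ⟨off, reg, mem⟩ = some ⟨off + c.size, reg', mem'⟩ ∧
        Rep w σ' reg' mem' := by
  induction h with
  | @assign σ x e hok =>
    intro off reg mem hc hR
    obtain ⟨hc1, hc2⟩ := codeAt_append hc
    obtain ⟨r1, e1, R1, v1, -⟩ := e.run_compile (inp := inp) hok hM 0 off reg mem hc1 hR
    have h0 := (codeAt_cons hc2).1
    rw [Ex.length_compile] at h0
    refine ⟨_, _, run_trans e1 ?_, R1.set x v1⟩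
    simp only [run_one, step, h0]
    simp [Config.setReg, BinOp.eval, Com.size, add_assoc]
  | @store σ a e ha he h0 hlt =>
    intro off reg mem hc hR
    obtain ⟨hc, hc3⟩ := codeAt_append hc
    obtain ⟨hc1, hc2⟩ := codeAt_append hc
    obtain ⟨r1, e1, R1, v1, k1⟩ := a.run_compile (inp := inp) ha hM 0 off reg mem hc1 hR
    rw [Ex.length_compile] at hc2
    obtain ⟨r2, e2, R2, v2, k2⟩ := e.run_compile (inp := inp) he hM 1 _ r1 mem hc2 R1
    have hi := (codeAt_cons hc3).1
    simp only [List.length_append, Ex.length_compile, ← add_assoc] at hi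
    have hMw : (M : ℤ) ≤ 2 ^ w := by exact_mod_cast hM
    have w1 : (r2 1 : ℤ) = a.eval σ := by
      have := k2 0 (by omega)
      simp only [mul_zero, zero_add] at this
      rw [this, ← Int.emod_eq_of_lt h0 (hlt.trans_le hMw)]; exact v1
    have hlt' : r2 1 < M := by omega
    refine ⟨r2, Function.update mem (r2 1) (r2 3), run_trans (run_trans e1 e2) ?_, ?_⟩
    rotate_left
    · rw [← w1]
      exact R2.put (r2 1) (v := r2 3) v2
    · simp only [run_one, step, hi]
      simp [hlt', Com.size, add_assoc]
  | @seq σ σ' σ'' c₁ c₂ k₁ k₂ _ _ ih₁ ih₂ =>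
    intro off reg mem hc hR
    obtain ⟨hc1, hc2⟩ := codeAt_append hc
    obtain ⟨r1, m1, e1, R1⟩ := ih₁ off reg mem hc1 hR
    rw [length_compile] at hc2
    obtain ⟨r2, m2, e2, R2⟩ := ih₂ _ r1 m1 hc2 R1
    refine ⟨r2, m2, ?_, R2⟩
    rw [Com.size, ← add_assoc]
    exact run_trans e1 e2
  | @if_true σ σ' b c k hok hb _ ih =>
    intro off reg mem hc hR
    obtain ⟨hc1, hc2⟩ := codeAt_append hc
    obtain ⟨-, hc3⟩ := codeAt_append hc2
    obtain ⟨r1, R1, e1, -⟩ := b.run_compile hok hM hc1 hR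
    simp only [Cond.length_compile, List.length_singleton] at hc3
    obtain ⟨r2, m2, e2, R2⟩ := ih (off + b.size + 2) r1 mem hc3 R1
    refine ⟨r2, m2, ?_, R2⟩
    have := run_trans (e1 hb) e2
    simpa [Com.size, add_assoc] using this
  | @if_false σ b c hok hb =>
    intro off reg mem hc hR
    obtain ⟨hc1, hc2⟩ := codeAt_append hc
    obtain ⟨hc2, -⟩ := codeAt_append hc2
    obtain ⟨r1, R1, -, e1⟩ := b.run_compile hok hM hc1 hR
    have h0 := (codeAt_cons hc2).1
    simp only [Cond.length_compile, ← add_assoc] at h0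
    refine ⟨r1, mem, run_trans (e1 hb) ?_, R1⟩
    simp only [run_one, step, ← add_assoc, h0]
    simp [Com.size, add_assoc]
  | @while_true σ σ' σ'' b c k k' hok hb _ _ ih₁ ih₂ =>
    intro off reg mem hc hR
    have hc0 := hc
    obtain ⟨hc1, hc2⟩ := codeAt_append hc
    obtain ⟨-, hc3⟩ := codeAt_append hc2
    obtain ⟨hc3, hc4⟩ := codeAt_append hc3
    obtain ⟨r1, R1, e1, -⟩ := b.run_compile hok hM hc1 hR
    simp only [Cond.length_compile, List.length_singleton] at hc3
    obtain ⟨r2, m2, e2, R2⟩ := ih₁ (off + b.size + 2) r1 mem hc3 R1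
    obtain ⟨r3, m3, e3, R3⟩ := ih₂ off r2 m2 hc0 R2
    have h0 := (codeAt_cons hc4).1
    simp only [Cond.length_compile, List.length_singleton, length_compile, ← add_assoc] at h0
    refine ⟨r3, m3, run_trans (e1 hb) (run_trans e2 (run_trans ?_ e3)), R3⟩
    simp only [run_one, step, h0]
  | @while_false σ b c hok hb =>
    intro off reg mem hc hR
    obtain ⟨hc1, hc2⟩ := codeAt_append hc
    obtain ⟨hc2, -⟩ := codeAt_append hc2
    obtain ⟨r1, R1, -, e1⟩ := b.run_compile hok hM hc1 hR
    have h0 := (codeAt_cons hc2).1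
    simp only [Cond.length_compile, ← add_assoc] at h0
    refine ⟨r1, mem, run_trans (e1 hb) ?_, R1⟩
    simp only [run_one, step, ← add_assoc, h0]
    simp [Com.size, add_assoc]

/-! ### Total correctness with time bounds. -/

variable (w M inp)

/-- From `σ`, the program `c` ends after at most `t` machine steps in a state that satisfies `Q`. -/
def Wp (c : Com) (t : ℕ) (Q : St → Prop) (σ : St) : Prop :=
  ∃ σ' k, k ≤ t ∧ Exec w M inp c σ σ' k ∧ Q σ'

/-- The verification condition of a program without loops. -/
def vc : Com → (St → Prop) → St → Prop
  | assign x e, Q, σ => e.Ok w M σ ∧ Q (σ.set x (e.eval σ))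
  | store a e, Q, σ => (a.Ok w M σ ∧ e.Ok w M σ ∧ 0 ≤ a.eval σ ∧ a.eval σ < (M : ℤ)) ∧
      Q (σ.put (a.eval σ) (e.eval σ))
  | seq c₁ c₂, Q, σ => c₁.vc (c₂.vc Q) σ
  | ifc b c, Q, σ => b.Ok w M inp σ ∧ (b.Holds inp σ → c.vc Q σ) ∧ (¬ b.Holds inp σ → Q σ)
  | .whileDo _ _, _, _ => False

variable {w M inp}

/-- The rule of consequence with the frame rule built in: the new postcondition may use that
unwritten variables keep their values. -/
theorem Wp.mono {c : Com} {t t' : ℕ} {Q Q' : St → Prop} {σ : St} (h : Wp w M inp c t Q σ)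
    (ht : t ≤ t') (hQ : ∀ σ', (∀ v, c.writes v = false → σ'.reg v = σ.reg v) → Q σ' → Q' σ') :
    Wp w M inp c t' Q' σ := by
  obtain ⟨σ', k, hk, he, hq⟩ := h
  exact ⟨σ', k, hk.trans ht, he, hQ σ' (fun v hv => he.reg_eq hv) hq⟩

theorem Wp.seq {c₁ c₂ : Com} {t₁ t₂ : ℕ} {Q : St → Prop} {σ : St}
    (h : Wp w M inp c₁ t₁ (Wp w M inp c₂ t₂ Q) σ) : Wp w M inp (.seq c₁ c₂) (t₁ + t₂) Q σ := by
  obtain ⟨σ', k, hk, he, σ'', k', hk', he', hq⟩ := h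
  exact ⟨σ'', k + k', by omega, .seq he he', hq⟩

/-- Without loops each instruction runs at most once, so the length of the code bounds the time. -/
theorem wp_of_vc {c : Com} {Q : St → Prop} {σ : St} (h : c.vc w M inp Q σ) :
    Wp w M inp c c.size Q σ := by
  induction c generalizing Q σ with
  | assign x e => exact ⟨_, _, le_rfl, .assign h.1, h.2⟩
  | store a e => exact ⟨_, _, le_rfl, .store h.1.1 h.1.2.1 h.1.2.2.1 h.1.2.2.2, h.2⟩
  | seq c₁ c₂ ih₁ ih₂ =>
    obtain ⟨σ', k, hk, he, hq⟩ := ih₁ h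
    obtain ⟨σ'', k', hk', he', hq'⟩ := ih₂ hq
    exact ⟨σ'', k + k', by simp only [size]; omega, .seq he he', hq'⟩
  | ifc b c ih =>
    obtain ⟨hok, h1, h2⟩ := h
    by_cases hb : b.Holds inp σ
    · obtain ⟨σ', k, hk, he, hq⟩ := ih (h1 hb)
      exact ⟨σ', _, by simp only [size]; omega, .if_true hok hb he, hq⟩
    · exact ⟨σ, _, by simp only [size]; omega, .if_false hok hb, h2 hb⟩
  | whileDo b c => exact h.elim

/-- `for i := 0, …, b - 1 do c` -/
def loop (i b : Var) (c : Com) : Com :=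
  .seq (.assign i 0) (.whileDo (.lt i b) (.seq c (.assign i (i + 1))))

/-- Per round, the test costs 3 steps, the increment 4 and the jump back 1; the initial assignment
and the failing test with its exit jump cost 6 together. -/
theorem wp_loop {i b : Var} {c : Com} {t : ℕ} {Q : St → Prop} {σ : St} (B : ℕ)
    (I : ℕ → St → Prop) (hB : σ.reg b = B) (hBw : (B : ℤ) < 2 ^ w) (hib : b ≠ i)
    (hci : c.writes i = false) (hcb : c.writes b = false) (h0 : I 0 (σ.set i 0))
    (hstep : ∀ k < B, ∀ σ', (∀ v, c.writes v = false → v ≠ i → σ'.reg v = σ.reg v) →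
      σ'.reg i = (k : ℤ) → I k σ' → Wp w M inp c t (fun σ'' => I (k + 1) (σ''.set i (k + 1))) σ')
    (hend : ∀ σ', (∀ v, c.writes v = false → v ≠ i → σ'.reg v = σ.reg v) →
      σ'.reg i = (B : ℤ) → I B σ' → Q σ') :
    Wp w M inp (loop i b c) (B * (t + 8) + 6) Q σ := by
  -- Induction on the number `k` of rounds still to come, the counter being `B - k`.
  have main : ∀ k ≤ B, ∀ σ', (∀ v, c.writes v = false → v ≠ i → σ'.reg v = σ.reg v) →
      σ'.reg i = ((B - k : ℕ) : ℤ) → I (B - k) σ' →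
      Wp w M inp (.whileDo (.lt i b) (.seq c (.assign i (i + 1)))) (k * (t + 8) + 4) Q σ' := by
    intro k
    induction k with
    | zero =>
      intro _ σ' hf hi hI
      refine ⟨σ', _, ?_, .while_false ?_ ?_, hend σ' hf (by simpa using hi) (by simpa using hI)⟩
      · simp [Cond.size, Cond.fst, Cond.snd, Ex.size]
      · simp only [Cond.Ok, Ex.ok_var, Ex.eval_var, hi, hf b hcb hib, hB]
        refine ⟨⟨trivial, trivial⟩, ⟨by positivity, by simpa using hBw⟩, by positivity, hBw⟩
      · simp [Cond.Holds, hi, hf b hcb hib, hB]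
    | succ k ih =>
      intro hk σ' hf hi hI
      obtain ⟨σ₁, k₁, hk₁, he, hI'⟩ := hstep (B - (k + 1)) (by omega) σ' hf hi hI
      have hi1 : σ₁.reg i = ((B - (k + 1) : ℕ) : ℤ) := by rw [he.reg_eq hci, hi]
      have hidx : B - (k + 1) + 1 = B - k := by omega
      have hset : σ₁.reg i + 1 = ((B - k : ℕ) : ℤ) := by rw [hi1, ← hidx]; push_cast; ring
      obtain ⟨σ₂, k₂, hk₂, he₂, hQ⟩ := ih (by omega) (σ₁.set i (σ₁.reg i + 1))
        (fun v hv hvi => by simp [hvi, he.reg_eq hv, hf v hv hvi]) (by simp [hset])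
        (by rw [hi1, ← hidx]; exact hI')
      refine ⟨σ₂, _, ?_, .while_true ?_ ?_ (.seq he (.assign ?_)) he₂, hQ⟩
      · have h1 : Ex.size ((i : Ex) + 1) = 3 := rfl
        have h2 : Cond.size (.lt i b) = 2 := rfl
        rw [h1, h2, add_mul, one_mul]
        omega
      · simp only [Cond.Ok, Ex.ok_var, Ex.eval_var, hi, hf b hcb hib, hB]
        refine ⟨⟨trivial, trivial⟩, ⟨by positivity, by omega⟩, by positivity, hBw⟩
      · simp only [Cond.Holds, Ex.eval_var, hi, hf b hcb hib, hB]; omega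
      · exact ⟨trivial, trivial, trivial⟩
  obtain ⟨σ', k, hk, he, hq⟩ := main B le_rfl (σ.set i 0) (fun v _ hv => by simp [hv])
    (by simp) (by simpa using h0)
  refine ⟨σ', _, ?_, .seq (.assign trivial) he, hq⟩
  have : Ex.size (0 : Ex) = 1 := rfl
  omega

end Com

end WordRAM

/-! ### Roots of unity in bit-reversed order. -/

namespace FourierCount

/-- `∑ i < 2 n` split by parity. -/
theorem sum_range_two_mul {β : Type*} [AddCommMonoid β] (g : ℕ → β) (n : ℕ) :
    ∑ i ∈ Finset.range (2 * n), g i = ∑ i ∈ Finset.range n, (g (2 * i) + g (2 * i + 1)) := by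
  induction n with
  | zero => simp
  | succ n ih =>
    rw [show 2 * (n + 1) = 2 * n + 1 + 1 by ring, Finset.sum_range_succ, Finset.sum_range_succ, ih,
      Finset.sum_range_succ, add_assoc]

/-- The van der Corput sequence: the binary digits of `j` mirrored at the binary point. -/
noncomputable def vdc (j : ℕ) : ℝ :=
  if h : j = 0 then 0 else ((j % 2 : ℕ) + vdc (j / 2)) / 2
decreasing_by omega

theorem vdc_two_mul (j : ℕ) : vdc (2 * j) = vdc j / 2 := by
  rcases Nat.eq_zero_or_pos j with rfl | hj
  · simp [vdc]
  · rw [vdc, dif_neg (by omega)]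
    simp

theorem vdc_two_mul_add_one (j : ℕ) : vdc (2 * j + 1) = (1 + vdc j) / 2 := by
  rw [vdc, dif_neg (by omega)]
  rw [show (2 * j + 1) % 2 = 1 by omega, show (2 * j + 1) / 2 = j by omega]
  simp

/-- Mirroring moves the new top digit of `2 ^ k + j` to place `k + 1` after the binary point and
keeps the other digits. -/
theorem vdc_two_pow_add (k j : ℕ) (hj : j < 2 ^ k) :
    vdc (2 ^ k + j) = vdc j + 1 / 2 ^ (k + 1) := by
  induction k generalizing j with
  | zero =>
    obtain rfl : j = 0 := by simpa using hj
    have := vdc_two_mul_add_one 0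
    have h0 : vdc 0 = 0 := by simp [vdc]
    simpa [h0] using this
  | succ k ih =>
    have h2 : j / 2 < 2 ^ k := by rw [pow_succ] at hj; omega
    rcases Nat.even_or_odd' j with ⟨i, rfl | rfl⟩
    · rw [show 2 ^ (k + 1) + 2 * i = 2 * (2 ^ k + i) by ring, vdc_two_mul, vdc_two_mul,
        ih i (by simpa using h2)]
      field_simp
      ring
    · rw [show 2 ^ (k + 1) + (2 * i + 1) = 2 * (2 ^ k + i) + 1 by ring, vdc_two_mul_add_one,
        vdc_two_mul_add_one, ih i (by omega)]
      field_simp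
      ring

open Complex in
/-- The `j`-th root of unity, in the order of bit reversal. -/
noncomputable def root (j : ℕ) : ℂ := exp (((2 * Real.pi * vdc j : ℝ) : ℂ) * I)

/-- The twiddle factor of node `j`, a square root of `root j`. -/
noncomputable def twiddle (j : ℕ) : ℂ := root (2 * j)

theorem norm_root (j : ℕ) : ‖root j‖ = 1 := Complex.norm_exp_ofReal_mul_I _

theorem norm_twiddle (j : ℕ) : ‖twiddle j‖ = 1 := norm_root _

theorem twiddle_sq (j : ℕ) : twiddle j ^ 2 = root j := by
  rw [twiddle, root, root, ← Complex.exp_nat_mul, vdc_two_mul]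
  congr 1
  push_cast
  ring

theorem root_two_mul_add_one (j : ℕ) : root (2 * j + 1) = -twiddle j := by
  rw [twiddle, root, root, vdc_two_mul_add_one, vdc_two_mul,
    show ((2 * Real.pi * ((1 + vdc j) / 2) : ℝ) : ℂ) * Complex.I =
      ((2 * Real.pi * (vdc j / 2) : ℝ) : ℂ) * Complex.I + Real.pi * Complex.I by push_cast; ring,
    Complex.exp_add, Complex.exp_pi_mul_I]
  ring

/-- The twiddle factor of node `2 ^ k`. -/
noncomputable def halfRoot (k : ℕ) : ℂ :=
  ⟨Real.cos (Real.pi / 2 ^ (k + 1)), Real.sin (Real.pi / 2 ^ (k + 1))⟩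

theorem halfRoot_eq (k : ℕ) :
    halfRoot k = Complex.exp (((Real.pi / 2 ^ (k + 1) : ℝ) : ℂ) * Complex.I) := by
  apply Complex.ext
  · rw [Complex.exp_ofReal_mul_I_re]; rfl
  · rw [Complex.exp_ofReal_mul_I_im]; rfl

theorem norm_halfRoot (k : ℕ) : ‖halfRoot k‖ = 1 := by
  rw [halfRoot_eq]; exact Complex.norm_exp_ofReal_mul_I _

theorem twiddle_zero : twiddle 0 = 1 := by
  simp [twiddle, root, vdc]

/-- The upper half of a table of size `2 ^ (k + 1)` is thus the lower half times one fixed number.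
-/
theorem twiddle_two_pow_add (k j : ℕ) (hj : j < 2 ^ k) :
    twiddle (2 ^ k + j) = twiddle j * halfRoot k := by
  rw [halfRoot_eq, twiddle, twiddle, root, root, vdc_two_mul, vdc_two_mul, vdc_two_pow_add k j hj,
    ← Complex.exp_add]
  congr 1
  push_cast
  ring

/-- The roots with indices `2 * j` and `2 * j + 1` are opposite square roots of `root j`: odd powers
cancel, and even powers reduce to half the exponent one level down. -/
theorem sum_root_pow (r e : ℕ) :
    ∑ j ∈ Finset.range (2 ^ r), root j ^ e = if 2 ^ r ∣ e then (2 : ℂ) ^ r else 0 := by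
  induction r generalizing e with
  | zero =>
    have : root 0 = 1 := by simp [root, vdc]
    simp [this]
  | succ r ih =>
    rw [pow_succ', sum_range_two_mul]
    rcases Nat.even_or_odd' e with ⟨i, rfl | rfl⟩
    · rw [Finset.sum_congr rfl (g := fun j => 2 * root j ^ i), ← Finset.mul_sum, ih i]
      · simp only [Nat.mul_dvd_mul_iff_left (show 0 < 2 by norm_num)]
        split_ifs
        · rw [pow_succ']
        · simp
      · intro j _
        rw [root_two_mul_add_one, pow_mul, pow_mul, neg_sq, ← twiddle, twiddle_sq]
        ring
    · rw [if_neg, Finset.sum_eq_zero]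
      · intro j _
        rw [root_two_mul_add_one, ← twiddle, pow_succ, pow_succ, pow_mul, pow_mul, neg_sq]
        ring
      · intro h
        have := (Dvd.intro _ rfl : 2 ∣ 2 * 2 ^ r).trans h
        omega

/-! ### Residues and the butterfly identities. -/

/-- Entry `t` of the residue of the polynomial with coefficients `f` modulo `X ^ M - root j`,
where the number of coefficients is `2 ^ r * M`. -/
noncomputable def residue (f : ℕ → ℂ) (M r j t : ℕ) : ℂ :=
  ∑ i ∈ Finset.range (2 ^ r), f (t + M * i) * root j ^ i

/-- Reduction modulo the factor `X ^ m - twiddle j` of `X ^ (2 * m) - root j` replaces `X ^ m` by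
`twiddle j`. -/
theorem residue_two_mul (f : ℕ → ℂ) (m r j t : ℕ) :
    residue f m (r + 1) (2 * j) t =
      residue f (2 * m) r j t + twiddle j * residue f (2 * m) r j (t + m) := by
  rw [residue, pow_succ', sum_range_two_mul, Finset.sum_add_distrib, residue, residue,
    Finset.mul_sum]
  congr 1 <;> refine Finset.sum_congr rfl fun i _ => ?_
  · rw [pow_mul, ← twiddle, twiddle_sq]; congr 2; ring
  · rw [pow_succ, pow_mul, ← twiddle, twiddle_sq, show t + m * (2 * i + 1) = t + m + 2 * m * i by ring]
    ring

theorem residue_two_mul_add_one (f : ℕ → ℂ) (m r j t : ℕ) :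
    residue f m (r + 1) (2 * j + 1) t =
      residue f (2 * m) r j t - twiddle j * residue f (2 * m) r j (t + m) := by
  rw [residue, pow_succ', sum_range_two_mul, Finset.sum_add_distrib, residue, residue,
    Finset.mul_sum, sub_eq_add_neg, ← Finset.sum_neg_distrib]
  congr 1 <;> refine Finset.sum_congr rfl fun i _ => ?_
  · rw [pow_mul, root_two_mul_add_one, neg_sq, twiddle_sq]; congr 2; ring
  · rw [pow_succ, pow_mul, root_two_mul_add_one, neg_sq, twiddle_sq,
      show t + m * (2 * i + 1) = t + m + 2 * m * i by ring]
    ring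

/-- The growth by at most a factor 2 per round controls both overflow and the effect of inexact
twiddle factors. -/
theorem norm_residue_le {f : ℕ → ℂ} (hf : ∀ i, ‖f i‖ ≤ 1) (M r j t : ℕ) :
    ‖residue f M r j t‖ ≤ 2 ^ r := by
  refine (norm_sum_le _ _).trans ?_
  calc _ ≤ ∑ i ∈ Finset.range (2 ^ r), (1 : ℝ) := by
        refine Finset.sum_le_sum fun i _ => ?_
        rw [norm_mul, norm_pow, norm_root, one_pow, mul_one]
        exact hf _
    _ = 2 ^ r := by simp

/-! ### Midpoint counting as a constant coefficient. -/

/-- The three arrays whose transforms are multiplied: a sequence shifted by one, and a sequence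
spread over the even positions. -/
def shifted (f : ℕ → ℤ) (h i : ℕ) : ℤ := if 1 ≤ i ∧ i ≤ h then f (i - 1) else 0

def spread (f : ℕ → ℤ) (i : ℕ) : ℤ := if i % 2 = 0 then f (i / 2) else 0

theorem sum_shifted (f : ℕ → ℤ) {h : ℕ} (hh : 0 < h) (z : ℂ) :
    ∑ i ∈ Finset.range (2 * h), (shifted f h i : ℂ) * z ^ i =
      ∑ a ∈ Finset.range h, (f a : ℂ) * z ^ (a + 1) := by
  rw [show 2 * h = 1 + (h + (h - 1)) by omega, Finset.sum_range_add, Finset.sum_range_add]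
  have h1 : ∑ x ∈ Finset.range (h - 1), (shifted f h (1 + (h + x)) : ℂ) * z ^ (1 + (h + x)) = 0 :=
    Finset.sum_eq_zero fun x _ => by simp [shifted, show ¬ (1 + (h + x) ≤ h) by omega]
  rw [h1, add_zero]
  simp only [Finset.range_one, Finset.sum_singleton]
  rw [show shifted f h 0 = 0 by simp [shifted]]
  simp only [Int.cast_zero, zero_mul, zero_add]
  refine Finset.sum_congr rfl fun a ha => ?_
  have := Finset.mem_range.1 ha
  rw [shifted, if_pos (by omega), show 1 + a - 1 = a by omega, add_comm 1 a]

theorem sum_spread (f : ℕ → ℤ) (h : ℕ) (z : ℂ) :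
    ∑ i ∈ Finset.range (2 * h), (spread f i : ℂ) * z ^ i =
      ∑ u ∈ Finset.range h, (f u : ℂ) * z ^ (2 * u) := by
  rw [sum_range_two_mul]
  refine Finset.sum_congr rfl fun u _ => ?_
  simp [spread, show (2 * u + 1) % 2 = 1 by omega]

/-- Orthogonality of the roots keeps only the exponents divisible by `2 ^ (r + 1)`. The shifts by
one make the wanted exponent exactly `2 ^ (r + 1)`, so the products are summed without weights. -/
theorem sum_transforms (fA fC fG : ℕ → ℤ) (r : ℕ) :
    ∑ j ∈ Finset.range (2 ^ (r + 1)),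
      (∑ a ∈ Finset.range (2 ^ r), (fA a : ℂ) * root j ^ (a + 1)) *
      (∑ c ∈ Finset.range (2 ^ r), (fC c : ℂ) * root j ^ (c + 1)) *
      (∑ u ∈ Finset.range (2 ^ r), (fG u : ℂ) * root j ^ (2 * u)) =
    2 ^ (r + 1) * ((∑ a ∈ Finset.range (2 ^ r), ∑ c ∈ Finset.range (2 ^ r), fA a * fC c *
      (if (a + c) % 2 = 0 then fG (2 ^ r - 1 - (a + c) / 2) else 0) : ℤ) : ℂ) := by
  have hexp : ∀ A C G : ℕ → ℂ, (∑ a ∈ Finset.range (2 ^ r), A a) *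
      (∑ c ∈ Finset.range (2 ^ r), C c) * (∑ u ∈ Finset.range (2 ^ r), G u) =
      ∑ a ∈ Finset.range (2 ^ r), ∑ c ∈ Finset.range (2 ^ r), ∑ u ∈ Finset.range (2 ^ r),
        A a * C c * G u := by
    intro A C G
    rw [Finset.sum_mul_sum, Finset.sum_mul]
    refine Finset.sum_congr rfl fun a _ => ?_
    rw [Finset.sum_mul]
    exact Finset.sum_congr rfl fun c _ => Finset.mul_sum _ _ _
  simp_rw [hexp]
  rw [Finset.sum_comm]
  push_cast
  rw [Finset.mul_sum]
  refine Finset.sum_congr rfl fun a ha => ?_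
  rw [Finset.sum_comm, Finset.mul_sum]
  refine Finset.sum_congr rfl fun c hc => ?_
  rw [Finset.mem_range] at ha hc
  rw [Finset.sum_comm]
  have key : ∀ u ∈ Finset.range (2 ^ r), ∑ j ∈ Finset.range (2 ^ (r + 1)),
      (fA a : ℂ) * root j ^ (a + 1) * ((fC c : ℂ) * root j ^ (c + 1)) *
        ((fG u : ℂ) * root j ^ (2 * u)) =
      if a + c + 2 * u + 2 = 2 * 2 ^ r then (2 : ℂ) ^ (r + 1) * (fA a * fC c * fG u) else 0 := by
    intro u hu
    rw [Finset.mem_range] at hu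
    rw [Finset.sum_congr rfl (g := fun j => ((fA a : ℂ) * fC c * fG u) *
      root j ^ (a + c + 2 * u + 2)), ← Finset.mul_sum, sum_root_pow]
    -- The exponent lies between 2 and `4 * 2 ^ r - 2`, an interval with a single multiple of `2 * 2
    -- ^ r`.
    · have : 2 ^ (r + 1) ∣ a + c + 2 * u + 2 ↔ a + c + 2 * u + 2 = 2 * 2 ^ r := by
        rw [pow_succ']
        constructor
        · rintro ⟨d, hd⟩
          have h1 : d = 1 := by
            rcases d with _ | _ | d
            · omega
            · rfl
            · exfalso
              have : 2 * 2 ^ r * (d + 1 + 1) ≥ 2 * 2 ^ r * 2 := Nat.mul_le_mul_left _ (by omega)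
              omega
          rw [hd, h1, mul_one]
        · intro h; rw [h]
      simp only [this]
      split_ifs
      · ring
      · simp
    · intro j _
      rw [show a + c + 2 * u + 2 = (a + 1) + (c + 1) + 2 * u by ring, pow_add, pow_add]
      ring
  rw [Finset.sum_congr rfl key]
  split_ifs with hp
  · rw [Finset.sum_eq_single (2 ^ r - 1 - (a + c) / 2)]
    · rw [if_pos (by omega)]
    · intro u _ hu
      rw [if_neg (by omega)]
    · intro hu
      exact absurd (Finset.mem_range.2 (by have := Nat.two_pow_pos r; omega)) hu
  · rw [mul_zero, mul_zero]
    exact Finset.sum_eq_zero fun u _ => if_neg (by omega)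

/-! ### Divide and conquer over dyadic blocks. -/

/-- The sum of `g a c` over the pairs `a < c` of the block `[s, s + M)`. -/
def pairSum (g : ℕ → ℕ → ℤ) (s M : ℕ) : ℤ :=
  ∑ a ∈ Finset.range M, ∑ c ∈ Finset.range M, if a < c then g (s + a) (s + c) else 0

/-- The part of the sum where `a` lies in the left half and `c` in the right half. -/
def crossSum (g : ℕ → ℕ → ℤ) (s h : ℕ) : ℤ :=
  ∑ a ∈ Finset.range h, ∑ c ∈ Finset.range h, g (s + a) (s + h + c)

theorem pairSum_two_mul (g : ℕ → ℕ → ℤ) (s h : ℕ) :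
    pairSum g s (2 * h) = pairSum g s h + pairSum g (s + h) h + crossSum g s h := by
  rw [pairSum, two_mul, Finset.sum_range_add]
  simp_rw [Finset.sum_range_add, Finset.sum_add_distrib]
  have h1 : ∀ a ∈ Finset.range h, ∑ x ∈ Finset.range h,
      (if a < h + x then g (s + a) (s + (h + x)) else 0) =
      ∑ c ∈ Finset.range h, g (s + a) (s + h + c) := by
    intro a ha
    refine Finset.sum_congr rfl fun x _ => ?_
    have := Finset.mem_range.1 ha
    rw [if_pos (by omega), add_assoc]
  have h2 : ∑ a ∈ Finset.range h, ∑ x ∈ Finset.range h,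
      (if h + a < x then g (s + (h + a)) (s + x) else 0) = 0 := by
    refine Finset.sum_eq_zero fun a _ => Finset.sum_eq_zero fun x hx => ?_
    have := Finset.mem_range.1 hx
    rw [if_neg (by omega)]
  rw [Finset.sum_congr rfl h1, h2]
  simp only [pairSum, crossSum, add_lt_add_iff_left, ← add_assoc]
  ring

/-- The blocks of size `2 ^ (r + 1)` in terms of those of size `2 ^ r`. -/
theorem sum_pairSum_succ (g : ℕ → ℕ → ℤ) (r B : ℕ) :
    ∑ i ∈ Finset.range B, pairSum g (i * 2 ^ (r + 1)) (2 ^ (r + 1)) =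
      ∑ i ∈ Finset.range (2 * B), pairSum g (i * 2 ^ r) (2 ^ r) +
      ∑ i ∈ Finset.range B, crossSum g (i * (2 * 2 ^ r)) (2 ^ r) := by
  rw [sum_range_two_mul, ← Finset.sum_add_distrib]
  refine Finset.sum_congr rfl fun i _ => ?_
  rw [pow_succ', pairSum_two_mul]
  congr 3 <;> ring

/-- The number of equidistant triples `(a, (a + c) / 2, c)`, weighted. -/
def triple (fA fB fC : ℕ → ℤ) (a c : ℕ) : ℤ :=
  fA a * fC c * if (a + c) % 2 = 0 then fB ((a + c) / 2) else 0

/-- The only pair consists of neighbours, which have no midpoint. The recursion can therefore start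
at blocks of size 2, and every half used later has even length. -/
theorem pairSum_triple_two (fA fB fC : ℕ → ℤ) (s : ℕ) : pairSum (triple fA fB fC) s 2 = 0 := by
  simp [pairSum, Finset.sum_range_succ, triple, show (s + (s + 1)) % 2 = 1 by omega]

/-- As the half length is even, it does not affect the parity of `a + c`, and the midpoint is `s + 2
^ r + (a + c) / 2`. The double subtraction is the reversed midpoint sequence in the form that
`sum_transforms` produces. -/
theorem crossSum_triple (fA fB fC : ℕ → ℤ) (s r : ℕ) :
    crossSum (triple fA fB fC) s (2 ^ (r + 1)) =
      ∑ a ∈ Finset.range (2 ^ (r + 1)), ∑ c ∈ Finset.range (2 ^ (r + 1)),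
        fA (s + a) * fC (s + 2 ^ (r + 1) + c) * (if (a + c) % 2 = 0 then
          fB (s + 2 ^ r + (2 ^ (r + 1) - 1 - (2 ^ (r + 1) - 1 - (a + c) / 2))) else 0) := by
  refine Finset.sum_congr rfl fun a ha => Finset.sum_congr rfl fun c hc => ?_
  rw [Finset.mem_range] at ha hc
  rw [pow_succ'] at *
  have h1 : (s + a + (s + 2 * 2 ^ r + c)) % 2 = (a + c) % 2 := by omega
  have h2 : (s + a + (s + 2 * 2 ^ r + c)) / 2 = s + 2 ^ r + (a + c) / 2 := by omega
  have h3 : 2 * 2 ^ r - 1 - (2 * 2 ^ r - 1 - (a + c) / 2) = (a + c) / 2 := by omega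
  rw [triple, h1, h2, h3]

/-- The indicator of the positions of the `x`-th character of the pattern. -/
def indicator {α : Type*} [DecidableEq α] (T P : List α) (x q : ℕ) : ℤ :=
  if T[q]? = P[x]? then 1 else 0

/-- A pair `(i, d)` corresponds to the zero-based first and last positions. Padding adds nothing:
beyond the text `T[q]?` is `none`, while the pattern has a character at each index below 3. -/
theorem card_equidistantOccurrences {α : Type*} [DecidableEq α] (T P : List α)
    (hP : P.length = 3) {K : ℕ} (hK : T.length ≤ K) :
    ((equidistantOccurrences T P).card : ℤ) =
      pairSum (triple (indicator T P 0) (indicator T P 1) (indicator T P 2)) 0 K := by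
  have hs : ∀ x < 3, ∃ y, P[x]? = some y := fun x hx =>
    ⟨P[x], List.getElem?_eq_getElem (by omega)⟩
  have hlt : ∀ {x q : ℕ}, x < 3 → T[q]? = P[x]? → q < T.length := by
    intro x q hx h
    obtain ⟨y, hy⟩ := hs x hx
    by_contra hq
    rw [hy, List.getElem?_eq_none (by omega)] at h
    cases h
  have h1 : pairSum (triple (indicator T P 0) (indicator T P 1) (indicator T P 2)) 0 K =
      (((Finset.range K ×ˢ Finset.range K).filter fun y : ℕ × ℕ =>
        y.1 < y.2 ∧ (y.1 + y.2) % 2 = 0 ∧ T[y.1]? = P[0]? ∧ T[(y.1 + y.2) / 2]? = P[1]? ∧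
          T[y.2]? = P[2]?).card : ℤ) := by
    rw [Finset.card_filter, Finset.sum_product, pairSum]
    push_cast
    refine Finset.sum_congr rfl fun a _ => Finset.sum_congr rfl fun c _ => ?_
    simp only [zero_add, triple, indicator]
    split_ifs <;> simp_all
  rw [h1, Nat.cast_inj]
  refine Finset.card_nbij' (fun y => (y.1 - 1, y.1 - 1 + 2 * y.2))
    (fun y => (y.1 + 1, (y.2 - y.1) / 2)) ?_ ?_ ?_ ?_
  · rintro ⟨i, d⟩ hy
    simp only [equidistantOccurrences, hP, Finset.coe_filter, Finset.mem_product, Finset.mem_Icc,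
      Set.mem_ofPred_eq] at hy
    obtain ⟨⟨⟨hi, hi'⟩, hd, hd'⟩, hy⟩ := hy
    have e0 := hy 0 (by norm_num)
    have e1 := hy 1 (by norm_num)
    have e2 := hy 2 (by norm_num)
    have l2 := hlt (by norm_num) e2
    simp only [Finset.coe_filter, Finset.mem_product, Finset.mem_range, Set.mem_ofPred_eq]
    refine ⟨⟨by omega, by omega⟩, by omega, by omega, ?_, ?_, ?_⟩
    · rw [← e0]; congr 1; omega
    · rw [← e1]; congr 1; omega
    · rw [← e2]; congr 1; omega
  · rintro ⟨a, c⟩ hy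
    simp only [Finset.coe_filter, Finset.mem_product, Finset.mem_range, Set.mem_ofPred_eq] at hy
    obtain ⟨-, hac, hpar, e0, e1, e2⟩ := hy
    have l2 := hlt (by norm_num) e2
    simp only [equidistantOccurrences, hP, Finset.coe_filter, Finset.mem_product, Finset.mem_Icc,
      Set.mem_ofPred_eq]
    refine ⟨⟨⟨by omega, by omega⟩, by omega, by omega⟩, fun j hj => ?_⟩
    interval_cases j
    · rw [← e0]; congr 1; omega
    · rw [← e1]; congr 1; omega
    · rw [← e2]; congr 1; omega
  · rintro ⟨i, d⟩ hy
    simp only [equidistantOccurrences, hP, Finset.coe_filter, Finset.mem_product, Finset.mem_Icc,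
      Set.mem_ofPred_eq] at hy
    simp only [Prod.mk.injEq]
    omega
  · rintro ⟨a, c⟩ hy
    simp only [Finset.coe_filter, Finset.mem_product, Finset.mem_range, Set.mem_ofPred_eq] at hy
    simp only [Prod.mk.injEq]
    omega

/-! ### Error propagation in fixed-point arithmetic. -/

/-- The pair of integers `x, y` approximates `S * z` with error at most `E`. -/
def Approx (S : ℤ) (E : ℝ) (x y : ℤ) (z : ℂ) : Prop := ‖(⟨x, y⟩ : ℂ) - (S : ℂ) * z‖ ≤ E

namespace Approx

variable {S : ℤ} {E E' : ℝ} {x y x' y' : ℤ} {z z' : ℂ}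

theorem mono (h : Approx S E x y z) (hE : E ≤ E') : Approx S E' x y z := le_trans h hE

theorem add (h : Approx S E x y z) (h' : Approx S E' x' y' z') :
    Approx S (E + E') (x + x') (y + y') (z + z') := by
  refine le_trans (le_of_eq ?_) ((norm_add_le _ _).trans (add_le_add h h'))
  congr 1
  apply Complex.ext <;> simp <;> ring

theorem sub (h : Approx S E x y z) (h' : Approx S E' x' y' z') :
    Approx S (E + E') (x - x') (y - y') (z - z') := by
  refine le_trans (le_of_eq ?_) ((norm_sub_le _ _).trans (add_le_add h h'))
  congr 1
  apply Complex.ext <;> simp <;> ring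

theorem exact (S c : ℤ) : Approx S 0 (S * c) 0 c := by
  refine le_of_eq ?_
  rw [norm_eq_zero]
  apply Complex.ext <;> simp

theorem norm_le (hS : 0 < S) (h : Approx S E x y z) : ‖(⟨x, y⟩ : ℂ)‖ ≤ S * ‖z‖ + E := by
  have h1 : ‖(S : ℂ) * z‖ = S * ‖z‖ := by
    rw [norm_mul, Complex.norm_intCast, abs_of_pos (by exact_mod_cast hS)]
  have := norm_add_le ((⟨x, y⟩ : ℂ) - S * z) (S * z)
  rw [sub_add_cancel, h1] at this
  have h2 : ‖(⟨x, y⟩ : ℂ) - (S : ℂ) * z‖ ≤ E := h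
  linarith

theorem abs_re_sub_le (h : Approx S E x y z) : |(x : ℝ) - S * z.re| ≤ E := by
  refine le_trans (le_of_eq ?_) ((Complex.abs_re_le_norm _).trans h)
  simp

/-- Besides the product rule for errors there is a rounding error of at most 1 in each coordinate,
whence the summand 2. -/
theorem mul (hS : 0 < S) (h : Approx S E x y z) (h' : Approx S E' x' y' z') :
    Approx S (‖z‖ * E' + ‖z'‖ * E + E * E' / S + 2) ((x * x' - y * y') / S)
      ((x * y' + y * x') / S) (z * z') := by
  have hS' : (0 : ℝ) < S := by exact_mod_cast hS
  have hSc : (S : ℂ) ≠ 0 := by exact_mod_cast hS.ne'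
  set A : ℂ := ⟨x, y⟩
  set B : ℂ := ⟨x', y'⟩
  set C : ℂ := ⟨((x * x' - y * y') / S : ℤ), ((x * y' + y * x') / S : ℤ)⟩
  have hfl : ∀ a : ℤ, |((a / S : ℤ) : ℝ) - a / S| ≤ 1 := by
    intro a
    have h1 : ((a / S : ℤ) : ℝ) * S + (a % S : ℤ) = a := by
      exact_mod_cast Int.ediv_mul_add_emod a S
    have h2 : (0 : ℝ) ≤ (a % S : ℤ) := by exact_mod_cast Int.emod_nonneg a hS.ne'
    have h3 : ((a % S : ℤ) : ℝ) ≤ S := by exact_mod_cast (Int.emod_lt_of_pos a hS).le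
    rw [← h1, add_div, mul_div_cancel_right₀ _ hS'.ne', abs_sub_comm, add_sub_cancel_left,
      abs_of_nonneg (by positivity)]
    exact div_le_one_of_le₀ h3 hS'.le
  have hC : ‖C - A * B / S‖ ≤ 2 := by
    refine (Complex.norm_le_abs_re_add_abs_im _).trans ?_
    have e1 : (A * B / (S : ℂ)).re = ((x * x' - y * y' : ℤ) : ℝ) / S := by
      rw [show (S : ℂ) = ((S : ℝ) : ℂ) by simp, Complex.div_ofReal_re]
      simp [A, B]
    have e2 : (A * B / (S : ℂ)).im = ((x * y' + y * x' : ℤ) : ℝ) / S := by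
      rw [show (S : ℂ) = ((S : ℝ) : ℂ) by simp, Complex.div_ofReal_im]
      simp [A, B]
    rw [Complex.sub_re, Complex.sub_im, e1, e2]
    have := hfl (x * x' - y * y')
    have := hfl (x * y' + y * x')
    simp only [C]
    linarith
  -- With `A = S * z + δ` and `B = S * z' + δ'`, the quotient `A * B / S` expands to `S * z * z' + z
  -- * δ' + z' * δ + δ * δ' / S`.
  have hsplit : C - S * (z * z') = (C - A * B / S) + (z * (B - S * z') + z' * (A - S * z) +
      (A - S * z) * (B - S * z') / S) := by
    field_simp
    ring
  have h1 : ‖A - S * z‖ ≤ E := h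
  have h2 : ‖B - S * z'‖ ≤ E' := h'
  have hE : 0 ≤ E := (norm_nonneg _).trans h1
  show ‖C - S * (z * z')‖ ≤ _
  rw [hsplit]
  have b1 : ‖z * (B - S * z')‖ ≤ ‖z‖ * E' := by
    rw [norm_mul]; exact mul_le_mul_of_nonneg_left h2 (norm_nonneg _)
  have b2 : ‖z' * (A - S * z)‖ ≤ ‖z'‖ * E := by
    rw [norm_mul]; exact mul_le_mul_of_nonneg_left h1 (norm_nonneg _)
  have b3 : ‖(A - S * z) * (B - S * z') / S‖ ≤ E * E' / S := by
    rw [norm_div, norm_mul, Complex.norm_intCast, abs_of_pos hS']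
    gcongr
  have := norm_add_le (C - A * B / S) (z * (B - S * z') + z' * (A - S * z) +
      (A - S * z) * (B - S * z') / S)
  have := norm_add_le (z * (B - S * z') + z' * (A - S * z)) ((A - S * z) * (B - S * z') / S)
  have := norm_add_le (z * (B - S * z')) (z' * (A - S * z))
  linarith

/-- The two products that a complex multiplication divides by `S` are small. -/
theorem abs_mul_le (hS : 0 < S) (h : Approx S E x y z) (h' : Approx S E' x' y' z') {D : ℤ}
    (hD : (S * ‖z‖ + E) * (S * ‖z'‖ + E') ≤ D) :
    |x * x' - y * y'| ≤ D ∧ |x * y' + y * x'| ≤ D := by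
  have h1 := h.norm_le hS
  have h2 := h'.norm_le hS
  have h3 : ‖(⟨x, y⟩ : ℂ) * ⟨x', y'⟩‖ ≤ D := by
    rw [norm_mul]
    exact (mul_le_mul h1 h2 (norm_nonneg _) ((norm_nonneg _).trans h1)).trans hD
  constructor
  · have := (Complex.abs_re_le_norm _).trans h3
    simp only [Complex.mul_re] at this
    exact_mod_cast this
  · have := (Complex.abs_im_le_norm _).trans h3
    simp only [Complex.mul_im] at this
    exact_mod_cast this

end Approx

end FourierCount

/-! ### Word-size budget and the single butterfly. -/

namespace WordRAM

open FourierCount Com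

/-- Address `p` of array number `b`; every array has `K` words. -/
def Ex.cell (b : ℕ) (p : Ex) : Ex := .lit b * .var .K + p

/-- Division by `S` that rounds down, also for negative numbers: `S * Q` is added before and `Q`
subtracted after the division of natural numbers. -/
def fdiv (S Q x : ℤ) : ℤ := (x + S * Q) / S - Q

def FdivOk (w : ℕ) (S Q x : ℤ) : Prop := (0 ≤ x + S * Q ∧ x + S * Q < 2 ^ w) ∧ 0 ≤ S ∧ S < 2 ^ w

def Ex.fdiv (a : Ex) : Ex := (a + Ex.var .S * Ex.var .Q) / Ex.var .S - Ex.var .Q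

/-- Real part of the fixed-point product of the complex numbers `a, b` and `c, d`. -/
def Ex.mulRe (a b c d : Ex) : Ex := Ex.fdiv (a * c - b * d)

def Ex.mulIm (a b c d : Ex) : Ex := Ex.fdiv (a * d + b * c)

@[simp] theorem Ex.eval_fdiv (a : Ex) (σ : St) :
    (Ex.fdiv a).eval σ = WordRAM.fdiv (σ.reg .S) (σ.reg .Q) (a.eval σ) := rfl

@[simp] theorem Ex.size_fdiv (a : Ex) : (Ex.fdiv a).size = a.size + 8 := rfl

@[simp] theorem Ex.ok_fdiv (w M : ℕ) (a : Ex) (σ : St) :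
    (Ex.fdiv a).Ok w M σ ↔ a.Ok w M σ ∧ FdivOk w (σ.reg .S) (σ.reg .Q) (a.eval σ) := by
  simp [Ex.fdiv, FdivOk]

@[simp] theorem Ex.eval_cell (b : ℕ) (p : Ex) (σ : St) :
    (Ex.cell b p).eval σ = b * σ.reg .K + p.eval σ := rfl

@[simp] theorem Ex.size_cell (b : ℕ) (p : Ex) : (Ex.cell b p).size = p.size + 4 := by
  simp only [Ex.cell, Ex.size_add, Ex.size_mul, Ex.size_var, Ex.size]
  ring

@[simp] theorem Ex.ok_cell (w M b : ℕ) (p : Ex) (σ : St) :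
    (Ex.cell b p).Ok w M σ ↔ p.Ok w M σ := by
  simp [Ex.cell, Ex.Ok, HAdd.hAdd, Add.add, HMul.hMul, Mul.mul, Op.Ok]

/-- The variables that hold the size of the arrays, the scale and the offset of divisions. -/
structure Scaled (L : ℕ) (σ : St) : Prop where
  K : σ.reg .K = 2 ^ L
  S : σ.reg .S = 2 ^ (10 * L + 16)
  Q : σ.reg .Q = 4 * 2 ^ (10 * L + 16) * (2 ^ L) ^ 3

theorem Scaled.congr {L : ℕ} {σ σ' : St} (h : Scaled L σ) (hK : σ'.reg .K = σ.reg .K)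
    (hS : σ'.reg .S = σ.reg .S) (hQ : σ'.reg .Q = σ.reg .Q) : Scaled L σ' :=
  ⟨hK.trans h.K, hS.trans h.S, hQ.trans h.Q⟩

/-- The largest product of two fixed-point numbers. -/
def maxProd (L : ℕ) : ℤ := 2 ^ (23 * L + 34)

theorem maxProd_eq (L : ℕ) :
    (2 : ℤ) ^ (10 * L + 16) * (4 * 2 ^ (10 * L + 16) * (2 ^ L) ^ 3) = maxProd L := by
  rw [maxProd, show 23 * L + 34 = (10 * L + 16) + (2 + (10 * L + 16) + L * 3) by ring, pow_add 2 (10 * L + 16),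
    pow_add 2 (2 + (10 * L + 16)), pow_add 2 2, pow_mul 2 L 3]
  norm_num

/-- The factor 2 leaves room for the offset `S * Q`, equal to the largest product, which makes
dividends nonnegative. -/
theorem two_mul_maxProd_lt {w L : ℕ} (hw : 24 * L + 45 ≤ w) : 2 * maxProd L < 2 ^ w := by
  rw [maxProd, ← pow_succ']
  exact pow_lt_pow_right₀ (by norm_num) (by omega)

theorem scale_lt {w L : ℕ} (hw : 24 * L + 45 ≤ w) : (2 : ℤ) ^ (10 * L + 16) < 2 ^ w :=
  pow_lt_pow_right₀ (by norm_num) (by omega)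

theorem size_lt {w L : ℕ} (hw : 24 * L + 45 ≤ w) : (2 : ℤ) ^ L < 2 ^ w :=
  pow_lt_pow_right₀ (by norm_num) (by omega)

@[simp] theorem fdiv_eq (L : ℕ) (x : ℤ) :
    fdiv (2 ^ (10 * L + 16)) (4 * 2 ^ (10 * L + 16) * (2 ^ L) ^ 3) x = x / 2 ^ (10 * L + 16) := by
  rw [fdiv, Int.add_mul_ediv_left _ _ (by positivity), add_sub_cancel_right]

theorem fdivOk {w L : ℕ} (hw : 24 * L + 45 ≤ w) {x : ℤ} (h : |x| ≤ maxProd L) :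
    FdivOk w (2 ^ (10 * L + 16)) (4 * 2 ^ (10 * L + 16) * (2 ^ L) ^ 3) x := by
  have h1 := two_mul_maxProd_lt hw
  have h3 := abs_le.1 h
  rw [FdivOk, maxProd_eq]
  exact ⟨⟨by linarith, by linarith⟩, by positivity, scale_lt hw⟩

section

variable {w M L : ℕ} {σ : St}

/-- Eleven arrays of `K` words are all the memory: 0 to 2 for the indicators, 3 and 4 for the table,
5 to 10 for three complex transforms. -/
theorem cell_mem (hM : 11 * 2 ^ L ≤ M) {b : ℕ} (hb : b ≤ 10) {p : ℤ} (h0 : 0 ≤ p)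
    (hp : p < 2 ^ L) : 0 ≤ (b : ℤ) * 2 ^ L + p ∧ (b : ℤ) * 2 ^ L + p < M := by
  have hM' : (11 : ℤ) * 2 ^ L ≤ M := by exact_mod_cast hM
  have hb' : (b : ℤ) ≤ 10 := by exact_mod_cast hb
  have : (0 : ℤ) < 2 ^ L := by positivity
  constructor
  · positivity
  · nlinarith

end

open Var in
/-- One butterfly of the transform of the arrays `A` (real parts) and `A + 1`. -/
def butterfly (A : ℕ) : Com :=
  .seq (.assign j (q / m)) <|
  .seq (.assign p (q + j * m)) <|
  .seq (.assign wr (.ld (.cell 3 j))) <|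
  .seq (.assign wi (.ld (.cell 4 j))) <|
  .seq (.assign ur (.ld (.cell A p))) <|
  .seq (.assign ui (.ld (.cell (A + 1) p))) <|
  .seq (.assign x (.ld (.cell A (p + m)))) <|
  .seq (.assign it (.ld (.cell (A + 1) (p + m)))) <|
  .seq (.assign vr (.mulRe wr wi x it)) <|
  .seq (.assign vi (.mulIm wr wi x it)) <|
  .seq (.store (.cell A p) (ur + vr)) <|
  .seq (.store (.cell (A + 1) p) (ui + vi)) <|
  .seq (.store (.cell A (p + m)) (ur - vr)) <|
  .store (.cell (A + 1) (p + m)) (ui - vi)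

section

variable {α : Type*} {w M L : ℕ} {inp : List α} {σ : St}

/-- The counter `q = j * m + t` determines `j = q / m`, and the two operands sit at `q + j * m` and
`m` places further. The update is in place. -/
theorem butterfly_spec (hw : 24 * L + 45 ≤ w) (hM : 11 * 2 ^ L ≤ M) (hσ : Scaled L σ) {b : ℕ}
    (hb : b + 1 ≤ 10) {m j t : ℕ} (ht : t < m) (hp : (2 * j + 1) * m + t < 2 ^ L)
    (hm : σ.reg .m = m) (hq : σ.reg .q = (j * m + t : ℕ)) {D E E' : ℝ} {zu zv : ℂ}
    (hR : Approx (2 ^ (10 * L + 16)) D (σ.mem (3 * 2 ^ L + j)) (σ.mem (4 * 2 ^ L + j)) (twiddle j))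
    (hu : Approx (2 ^ (10 * L + 16)) E (σ.mem (b * 2 ^ L + (2 * j * m + t : ℕ)))
      (σ.mem ((b + 1) * 2 ^ L + (2 * j * m + t : ℕ))) zu)
    (hv : Approx (2 ^ (10 * L + 16)) E (σ.mem (b * 2 ^ L + ((2 * j + 1) * m + t : ℕ)))
      (σ.mem ((b + 1) * 2 ^ L + ((2 * j + 1) * m + t : ℕ))) zv)
    (hprod : (2 ^ (10 * L + 16) + D) * (2 ^ (10 * L + 16) * ‖zv‖ + E) ≤ maxProd L)
    (hE : E + (E + ‖zv‖ * D + D * E / 2 ^ (10 * L + 16) + 2) ≤ E') :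
    Wp w M inp (butterfly b) (butterfly b).size (fun σ' =>
      (∀ a : ℤ, a ≠ b * 2 ^ L + (2 * j * m + t : ℕ) → a ≠ (b + 1) * 2 ^ L + (2 * j * m + t : ℕ) →
        a ≠ b * 2 ^ L + ((2 * j + 1) * m + t : ℕ) →
        a ≠ (b + 1) * 2 ^ L + ((2 * j + 1) * m + t : ℕ) → σ'.mem a = σ.mem a) ∧
      Approx (2 ^ (10 * L + 16)) E' (σ'.mem (b * 2 ^ L + (2 * j * m + t : ℕ)))
        (σ'.mem ((b + 1) * 2 ^ L + (2 * j * m + t : ℕ))) (zu + twiddle j * zv) ∧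
      Approx (2 ^ (10 * L + 16)) E' (σ'.mem (b * 2 ^ L + ((2 * j + 1) * m + t : ℕ)))
        (σ'.mem ((b + 1) * 2 ^ L + ((2 * j + 1) * m + t : ℕ))) (zu - twiddle j * zv)) σ := by
  have hm0 : 0 < m := by omega
  have hjm : j ≤ j * m := Nat.le_mul_of_pos_right _ hm0
  have hml : m ≤ (2 * j + 1) * m := Nat.le_mul_of_pos_left _ (by omega)
  have e1 : (2 * j + 1) * m = j * m + j * m + m := by ring
  have e2 : 2 * j * m = j * m + j * m := by ring
  have hKw := size_lt hw
  have hcast : ((2 * j + 1) * m + t : ℕ) < (2 : ℤ) ^ L := by exact_mod_cast hp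
  have hj : (((j * m + t : ℕ) : ℤ)) / (m : ℤ) = j := by
    rw [← Int.natCast_ediv, Nat.mul_comm j m, Nat.mul_add_div hm0, Nat.div_eq_of_lt ht, add_zero]
  have a3 := cell_mem (M := M) hM (b := 3) (by norm_num) (p := j) (by positivity) (by omega)
  have a4 := cell_mem (M := M) hM (b := 4) (by norm_num) (p := j) (by positivity) (by omega)
  have c1 := cell_mem (M := M) hM (b := b) (by omega) (p := (2 * j * m + t : ℕ)) (by positivity)
    (by omega)
  have c2 := cell_mem (M := M) hM (b := b + 1) hb (p := (2 * j * m + t : ℕ)) (by positivity)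
    (by omega)
  have c3 := cell_mem (M := M) hM (b := b) (by omega) (p := ((2 * j + 1) * m + t : ℕ))
    (by positivity) hcast
  have c4 := cell_mem (M := M) hM (b := b + 1) hb (p := ((2 * j + 1) * m + t : ℕ))
    (by positivity) hcast
  have hpe : ((j * m + t : ℕ) : ℤ) + j * m = (2 * j * m + t : ℕ) := by push_cast; ring
  have hpm : ((2 * j * m + t : ℕ) : ℤ) + m = ((2 * j + 1) * m + t : ℕ) := by push_cast; ring
  have hSpos : (0 : ℤ) < 2 ^ (10 * L + 16) := by positivity
  have hmul := hR.mul hSpos hv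
  have hbd := hR.abs_mul_le hSpos hv (D := maxProd L) (by
    rw [norm_twiddle]; push_cast; rw [mul_one]; exact hprod)
  rw [norm_twiddle, one_mul] at hmul
  have hplus := (hu.add hmul).mono (E' := E') (by push_cast; exact hE)
  have hminus := (hu.sub hmul).mono (E' := E') (by push_cast; exact hE)
  have hqP : j * m + t ≤ 2 * j * m + t := by omega
  have hmP : m ≤ (2 * j + 1) * m + t := by omega
  -- From here on only the order of the addresses matters, so the nonlinear index expressions can be
  -- replaced by variables.
  have hPP : 2 * j * m + t < (2 * j + 1) * m + t := by omega
  generalize (2 * j * m + t : ℕ) = P at *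
  generalize ((2 * j + 1) * m + t : ℕ) = P' at *
  have hqK : ((j * m + t : ℕ) : ℤ) ≤ P := by exact_mod_cast hqP
  have hmK : (m : ℤ) ≤ P' := by exact_mod_cast hmP
  generalize (j * m + t : ℕ) = q at *
  have hPK : (P : ℤ) < P' := by exact_mod_cast hPP
  have hP0 : (0 : ℤ) ≤ P := by positivity
  have q_lt : (q : ℤ) < 2 ^ w := by linarith
  have m_lt : (m : ℤ) < 2 ^ w := by linarith
  have n1 : (b : ℤ) * 2 ^ L + P ≠ b * 2 ^ L + P' := by intro h; linarith
  have n2 : (b : ℤ) * 2 ^ L + P ≠ (b + 1) * 2 ^ L + P := by intro h; linarith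
  have n3 : (b : ℤ) * 2 ^ L + P ≠ (b + 1) * 2 ^ L + P' := by intro h; linarith
  have n4 : (b + 1 : ℤ) * 2 ^ L + P ≠ (b + 1) * 2 ^ L + P' := by intro h; linarith
  have n5 : (b + 1 : ℤ) * 2 ^ L + P ≠ b * 2 ^ L + P' := by intro h; linarith
  have n6 : (b : ℤ) * 2 ^ L + P' ≠ (b + 1) * 2 ^ L + P' := by intro h; linarith
  simp only [Nat.cast_add, Nat.cast_one, Nat.cast_ofNat] at a3 a4 c2 c4
  apply wp_of_vc
  simp only [butterfly, Com.vc, Ex.mulRe, Ex.mulIm, Ex.ok_div, Ex.ok_add, Ex.ok_mul, Ex.ok_sub,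
    Ex.ok_var, Ex.ok_ld, Ex.ok_cell, Ex.ok_fdiv, Ex.eval_cell, Ex.eval_var, Ex.eval_div,
    Ex.eval_add, Ex.eval_mul, Ex.eval_sub, Ex.eval_ld, Ex.eval_fdiv, St.set_reg, St.set_mem,
    St.put_reg, reduceCtorEq, if_true, if_false, true_and, hσ.K, hσ.S, hσ.Q, fdiv_eq,
    hm, hq, hj, hpe, hpm, Nat.cast_add, Nat.cast_one, Nat.cast_ofNat, a3, a4, c1, c2, c3, c4,
    fdivOk hw hbd.1, fdivOk hw hbd.2, and_self, St.put_mem]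
  refine ⟨⟨⟨Int.natCast_nonneg _, q_lt⟩, Int.natCast_nonneg _, m_lt⟩, ?_, ?_, ?_⟩
  · intro a h1 h2 h3 h4
    rw [if_neg h4, if_neg h3, if_neg h2, if_neg h1]
  · rw [if_neg n3, if_neg n1, if_neg n2, if_neg n4, if_neg n5]
    exact hplus
  · rw [if_neg n6]
    exact hminus

end

end WordRAM

/-! ### The fast Fourier transform. -/

namespace WordRAM

open FourierCount Com

open Var in
/-- The Fourier transform of the complex array `A, A + 1` of length `2 * h = 2 ^ lg`. -/
def transform (A : ℕ) : Com :=
  .seq (.assign m h) <|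
  loop e lg <|
  .seq (loop q h (butterfly A)) (.assign m (m / 2))

theorem size_butterfly (A : ℕ) : (butterfly A).size = 128 := by
  simp [butterfly, Com.size, Ex.mulRe, Ex.mulIm]

/-- Error of the table of the twiddle factors. -/
noncomputable def tableError (L : ℕ) : ℝ := 2 ^ (6 * L + 11)

theorem two_le_tableError (L : ℕ) : 2 ≤ tableError L := by
  rw [tableError]
  calc (2 : ℝ) = 2 ^ 1 := by norm_num
    _ ≤ _ := pow_le_pow_right₀ (by norm_num) (by omega)

theorem pow_mul_tableError_le {L e : ℕ} (he : e ≤ L) :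
    4 ^ e * tableError L ≤ 2 ^ (10 * L + 16) := by
  rw [tableError, show (4 : ℝ) = 2 ^ 2 by norm_num, ← pow_mul, ← pow_add]
  exact pow_le_pow_right₀ (by norm_num) (by omega)

theorem maxProd_real (L : ℕ) :
    ((maxProd L : ℤ) : ℝ) = 4 * 2 ^ (10 * L + 16) ^ 1 * 2 ^ (10 * L + 16) * (2 ^ L) ^ 3 := by
  rw [← maxProd_eq]
  push_cast
  ring

theorem one_le_two_pow_real (L : ℕ) : (1 : ℝ) ≤ 2 ^ L := one_le_pow₀ (by norm_num)

section

variable {α : Type*} {w M L : ℕ} {inp : List α} {σ : St}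

theorem mul_add_inj {m j j' t t' : ℕ} (ht : t < m) (ht' : t' < m)
    (h : j * m + t = j' * m + t') : j = j' ∧ t = t' := by
  have h1 := congrArg (· / m) h
  have h2 := congrArg (· % m) h
  simp only [Nat.mul_comm _ m, Nat.mul_add_div (show 0 < m by omega), Nat.div_eq_of_lt ht,
    Nat.div_eq_of_lt ht', Nat.mul_add_mod, Nat.mod_eq_of_lt ht, Nat.mod_eq_of_lt ht'] at h1 h2
  omega

/-- One round of butterflies turns the residues modulo `X ^ (2 m) - root j` into those modulo
`X ^ m - root (2 j)` and `X ^ m - root (2 j + 1)`. -/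
theorem butterflies_spec (hw : 24 * L + 45 ≤ w) (hM : 11 * 2 ^ L ≤ M) (hσ : Scaled L σ) {A : ℕ}
    (hA : 5 ≤ A) (hA' : A ≤ 9) {e k : ℕ} (hL : e + k + 1 ≤ L) (hh : σ.reg .h = (2 ^ (e + k) : ℕ))
    (hm : σ.reg .m = (2 ^ k : ℕ)) {f : ℕ → ℂ} (hf : ∀ i, ‖f i‖ ≤ 1)
    (htab : ∀ j < 2 ^ e, Approx (2 ^ (10 * L + 16)) (tableError L) (σ.mem (3 * 2 ^ L + (j : ℕ)))
      (σ.mem (4 * 2 ^ L + (j : ℕ))) (twiddle j))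
    (harr : ∀ j < 2 ^ e, ∀ t < 2 ^ (k + 1), Approx (2 ^ (10 * L + 16)) ((4 ^ e - 1) * tableError L)
      (σ.mem (A * 2 ^ L + (j * 2 ^ (k + 1) + t : ℕ)))
      (σ.mem ((A + 1) * 2 ^ L + (j * 2 ^ (k + 1) + t : ℕ))) (residue f (2 ^ (k + 1)) e j t)) :
    Wp w M inp (loop .q .h (butterfly A)) (2 ^ (e + k) * 136 + 6) (fun σ' =>
      (∀ a : ℤ, a < A * 2 ^ L ∨ (A + 2) * 2 ^ L ≤ a → σ'.mem a = σ.mem a) ∧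
      ∀ j < 2 ^ (e + 1), ∀ t < 2 ^ k,
        Approx (2 ^ (10 * L + 16)) ((4 ^ (e + 1) - 1) * tableError L)
          (σ'.mem (A * 2 ^ L + (j * 2 ^ k + t : ℕ)))
          (σ'.mem ((A + 1) * 2 ^ L + (j * 2 ^ k + t : ℕ))) (residue f (2 ^ k) (e + 1) j t)) σ := by
  set m := 2 ^ k with hmdef
  have hm2 : 2 ^ (k + 1) = 2 * m := by rw [pow_succ']
  rw [hm2] at harr
  have hm0 : 0 < m := Nat.two_pow_pos k
  have hek : 2 ^ (e + k) = 2 ^ e * m := pow_add _ _ _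
  have hKe : 2 ^ (e + k) * 2 ≤ 2 ^ L := by
    rw [← pow_succ]; exact Nat.pow_le_pow_right (by norm_num) hL
  have hidx : ∀ {j t : ℕ}, j < 2 ^ e → t < m → j * m + t < 2 ^ (e + k) := by
    intro j t hj ht
    rw [hek]
    calc j * m + t < j * m + m := by omega
      _ = (j + 1) * m := by ring
      _ ≤ 2 ^ e * m := Nat.mul_le_mul_right _ hj
  have hD2 := two_le_tableError L
  have hDS : tableError L ≤ 2 ^ (10 * L + 16) := by
    simpa using pow_mul_tableError_le (Nat.zero_le L)
  have hES := pow_mul_tableError_le (L := L) (e := e) (by omega)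
  have hX1 := one_le_two_pow_real e
  have hXK : (2 : ℝ) ^ e ≤ 2 ^ L := pow_le_pow_right₀ (by norm_num) (by omega)
  have hX4 : (4 : ℝ) ^ e = 2 ^ e * 2 ^ e := by rw [← mul_pow]; norm_num
  have hS0 : (0 : ℝ) < 2 ^ (10 * L + 16) := by positivity
  -- Butterflies with number below `q` have been carried out; the operands of all others still hold
  -- the residues of the previous round.
  refine (wp_loop (t := 128) (2 ^ (e + k)) (fun q σ' =>
    (∀ a : ℤ, a < A * 2 ^ L ∨ (A + 2) * 2 ^ L ≤ a → σ'.mem a = σ.mem a) ∧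
    ∀ j < 2 ^ e, ∀ t < m,
      (j * m + t < q →
        Approx (2 ^ (10 * L + 16)) ((4 ^ (e + 1) - 1) * tableError L)
          (σ'.mem (A * 2 ^ L + (2 * j * m + t : ℕ)))
          (σ'.mem ((A + 1) * 2 ^ L + (2 * j * m + t : ℕ))) (residue f m (e + 1) (2 * j) t) ∧
        Approx (2 ^ (10 * L + 16)) ((4 ^ (e + 1) - 1) * tableError L)
          (σ'.mem (A * 2 ^ L + ((2 * j + 1) * m + t : ℕ)))
          (σ'.mem ((A + 1) * 2 ^ L + ((2 * j + 1) * m + t : ℕ)))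
          (residue f m (e + 1) (2 * j + 1) t)) ∧
      (q ≤ j * m + t →
        Approx (2 ^ (10 * L + 16)) ((4 ^ e - 1) * tableError L)
          (σ'.mem (A * 2 ^ L + (2 * j * m + t : ℕ)))
          (σ'.mem ((A + 1) * 2 ^ L + (2 * j * m + t : ℕ))) (residue f (2 * m) e j t) ∧
        Approx (2 ^ (10 * L + 16)) ((4 ^ e - 1) * tableError L)
          (σ'.mem (A * 2 ^ L + ((2 * j + 1) * m + t : ℕ)))
          (σ'.mem ((A + 1) * 2 ^ L + ((2 * j + 1) * m + t : ℕ)))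
          (residue f (2 * m) e j (t + m))))
    hh ?_ (by decide) rfl rfl ?_ ?_ ?_)
  · have := size_lt hw
    have h1 : ((2 ^ (e + k) : ℕ) : ℤ) * 2 ≤ 2 ^ L := by exact_mod_cast hKe
    have : (0 : ℤ) ≤ ((2 ^ (e + k) : ℕ) : ℤ) := Int.natCast_nonneg _
    linarith
  · refine ⟨fun _ _ => rfl, fun j hj t ht => ⟨fun h => absurd h (by omega), fun _ => ⟨?_, ?_⟩⟩⟩
    · have := harr j hj t (by omega)
      rwa [show j * (2 * m) + t = 2 * j * m + t by ring] at this
    · have := harr j hj (t + m) (by omega)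
      rwa [show j * (2 * m) + (t + m) = (2 * j + 1) * m + t by ring] at this
  · rintro q hq σ' hfr hqr ⟨hmem, hI⟩
    have hj : q / m < 2 ^ e := by rw [Nat.div_lt_iff_lt_mul hm0, ← hek]; exact hq
    have ht : q % m < m := Nat.mod_lt _ hm0
    have hqe : q / m * m + q % m = q := Nat.div_add_mod' q m
    generalize q / m = j at *
    generalize q % m = t at *
    subst hqe
    obtain ⟨hu, hv⟩ := (hI j hj t ht).2 le_rfl
    have hp : (2 * j + 1) * m + t < 2 ^ L := by
      have := hidx hj ht
      have e1 : 2 ^ (e + k) * 2 = 2 ^ e * m * 2 := by rw [hek]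
      have e2 : (j + 1) * m ≤ 2 ^ e * m := Nat.mul_le_mul_right _ hj
      have e3 : (2 * j + 1) * m + m = (j + 1) * m * 2 := by ring
      omega
    have hz : ‖residue f (2 * m) e j (t + m)‖ ≤ 2 ^ e := norm_residue_le hf _ _ _ _
    have htab' : Approx (2 ^ (10 * L + 16)) (tableError L) (σ'.mem (3 * 2 ^ L + (j : ℕ)))
        (σ'.mem (4 * 2 ^ L + (j : ℕ))) (twiddle j) := by
      have h1 : ((j : ℕ) : ℤ) < 2 ^ L := by
        have : j ≤ (2 * j + 1) * m := by
          calc j ≤ 2 * j + 1 := by omega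
            _ ≤ _ := Nat.le_mul_of_pos_right _ hm0
        exact_mod_cast (by omega : j < 2 ^ L)
      have h5 : (5 : ℤ) ≤ A := by exact_mod_cast hA
      have h6 : (5 : ℤ) * 2 ^ L ≤ A * 2 ^ L := mul_le_mul_of_nonneg_right h5 (by positivity)
      rw [hmem _ (Or.inl (by linarith)), hmem _ (Or.inl (by linarith))]
      exact htab j hj
    refine ((butterfly_spec (E' := (4 ^ (e + 1) - 1) * tableError L) hw hM
      (hσ.congr (hfr .K rfl (by decide)) (hfr .S rfl (by decide)) (hfr .Q rfl (by decide)))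
      (b := A) (by omega) ht hp ((hfr .m rfl (by decide)).trans hm) hqr htab' hu hv
      ?_ ?_)).mono (size_butterfly A).le ?_
    -- Both errors are at most `S` and the residue has norm at most `K`, so the product is at most
    -- `4 * S ^ 2 * K`.
    · rw [maxProd_real, pow_one]
      have hE : (4 ^ e - 1) * tableError L ≤ 2 ^ (10 * L + 16) := by nlinarith
      have hS1 : (2 : ℝ) ^ (10 * L + 16) * ‖residue f (2 * m) e j (t + m)‖ ≤
          2 ^ (10 * L + 16) * 2 ^ L := mul_le_mul_of_nonneg_left (hz.trans hXK) hS0.le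
      have hK1 := one_le_two_pow_real L
      have hK3 : (2 : ℝ) ^ L ≤ (2 ^ L) ^ 3 := le_self_pow₀ hK1 (by norm_num)
      have hE0 : 0 ≤ (4 ^ e - 1) * tableError L :=
        mul_nonneg (by nlinarith) (by linarith)
      calc _ ≤ ((2 : ℝ) ^ (10 * L + 16) + 2 ^ (10 * L + 16)) *
            (2 ^ (10 * L + 16) * 2 ^ L + 2 ^ (10 * L + 16) * 2 ^ L) := by
            refine mul_le_mul (by linarith) (add_le_add hS1 (hE.trans ?_)) (by positivity)
              (by positivity)
            exact le_mul_of_one_le_right hS0.le hK1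
        _ = 4 * 2 ^ (10 * L + 16) * 2 ^ (10 * L + 16) * 2 ^ L := by ring
        _ ≤ _ := mul_le_mul_of_nonneg_left hK3 (by positivity)
    -- With `D = tableError L` and `E = (4 ^ e - 1) * D`, the new error is at most `3 * E + 2 ^ e *
    -- D + 2`; as `2 ≤ D` and `2 ^ e ≤ 4 ^ e`, this is at most `(4 ^ (e + 1) - 1) * D`.
    · have hE0 : 0 ≤ (4 ^ e - 1) * tableError L :=
        mul_nonneg (by nlinarith) (by linarith)
      have h1 : tableError L * ((4 ^ e - 1) * tableError L) / 2 ^ (10 * L + 16) ≤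
          (4 ^ e - 1) * tableError L := by
        rw [div_le_iff₀ hS0, mul_comm]
        exact mul_le_mul_of_nonneg_left hDS hE0
      have h2 : ‖residue f (2 * m) e j (t + m)‖ * tableError L ≤ 2 ^ e * tableError L :=
        mul_le_mul_of_nonneg_right hz (by linarith)
      have h3 : (0 : ℝ) ≤ (2 ^ e * 2 ^ e - 2 ^ e) * tableError L :=
        mul_nonneg (by nlinarith) (by linarith)
      have h4 : (4 : ℝ) ^ (e + 1) = 2 ^ e * 2 ^ e * 4 := by rw [pow_succ, hX4]
      rw [hX4] at h1 ⊢
      rw [h4]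
      linarith
    · rintro σ'' - ⟨hm'', hn1, hn2⟩
      have hAK : ∀ a : ℤ, a < A * 2 ^ L ∨ (A + 2) * 2 ^ L ≤ a → σ''.mem a = σ'.mem a := by
        intro a ha
        have hp' : (((2 * j + 1) * m + t : ℕ) : ℤ) < 2 ^ L := by exact_mod_cast hp
        have hp'' : ((2 * j * m + t : ℕ) : ℤ) < 2 ^ L := by
          refine lt_of_le_of_lt ?_ hp'
          exact_mod_cast (by nlinarith : 2 * j * m + t ≤ (2 * j + 1) * m + t)
        have g1 : (0 : ℤ) ≤ ((2 * j * m + t : ℕ) : ℤ) := Int.natCast_nonneg _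
        have g2 : (0 : ℤ) ≤ (((2 * j + 1) * m + t : ℕ) : ℤ) := Int.natCast_nonneg _
        have g3 : (0 : ℤ) < 2 ^ L := by positivity
        refine hm'' a ?_ ?_ ?_ ?_ <;> rintro rfl <;> rcases ha with ha | ha <;> linarith
      refine ⟨fun a ha => (hAK a ha).trans (hmem a ha), fun j' hj' t' ht' => ?_⟩
      simp only [St.set_mem]
      by_cases heq : j' * m + t' = j * m + t
      · obtain ⟨rfl, rfl⟩ := mul_add_inj ht' ht heq
        refine ⟨fun _ => ?_, fun h => absurd h (by omega)⟩
        rw [residue_two_mul, residue_two_mul_add_one]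
        exact ⟨hn1, hn2⟩
      · have hne : ∀ {c d : ℕ}, c / 2 = j → d / 2 = j' → d * m + t' ≠ c * m + t := by
          intro c d hc hd h
          obtain ⟨rfl, rfl⟩ := mul_add_inj ht' ht h
          exact heq (by rw [← hc, ← hd])
        have hp2 : ∀ {d : ℕ}, d / 2 = j' → d * m + t' < 2 ^ L := by
          intro d hd
          have e2 : (d + 1) * m ≤ (2 * 2 ^ e) * m := Nat.mul_le_mul_right _ (by omega)
          have e3 : (2 * 2 ^ e) * m = 2 ^ (e + k) * 2 := by rw [hek]; ring
          have e4 : (d + 1) * m = d * m + m := by ring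
          omega
        have hsame : ∀ {d : ℕ}, d / 2 = j' →
            σ''.mem (A * 2 ^ L + (d * m + t' : ℕ)) = σ'.mem (A * 2 ^ L + (d * m + t' : ℕ)) ∧
            σ''.mem ((A + 1) * 2 ^ L + (d * m + t' : ℕ)) =
              σ'.mem ((A + 1) * 2 ^ L + (d * m + t' : ℕ)) := by
          intro d hd
          have g0 : ((d * m + t' : ℕ) : ℤ) < 2 ^ L := by exact_mod_cast hp2 hd
          have g1 : ((2 * j * m + t : ℕ) : ℤ) < 2 ^ L := by
            exact_mod_cast (by nlinarith : 2 * j * m + t < 2 ^ L)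
          have g2 : (((2 * j + 1) * m + t : ℕ) : ℤ) < 2 ^ L := by exact_mod_cast hp
          have n1 : ((d * m + t' : ℕ) : ℤ) ≠ ((2 * j * m + t : ℕ) : ℤ) := by
            exact_mod_cast hne (by omega) hd
          have n2 : ((d * m + t' : ℕ) : ℤ) ≠ (((2 * j + 1) * m + t : ℕ) : ℤ) := by
            exact_mod_cast hne (by omega) hd
          have f0 : (0 : ℤ) ≤ ((d * m + t' : ℕ) : ℤ) := Int.natCast_nonneg _
          have f1 : (0 : ℤ) ≤ ((2 * j * m + t : ℕ) : ℤ) := Int.natCast_nonneg _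
          have f2 : (0 : ℤ) ≤ (((2 * j + 1) * m + t : ℕ) : ℤ) := Int.natCast_nonneg _
          constructor
          · refine hm'' _ (fun h => n1 ?_) (fun h => ?_) (fun h => n2 ?_) (fun h => ?_) <;> linarith
          · refine hm'' _ (fun h => ?_) (fun h => n1 ?_) (fun h => ?_) (fun h => n2 ?_) <;> linarith
        have s1 := hsame (d := 2 * j') (by omega)
        have s2 := hsame (d := 2 * j' + 1) (by omega)
        rw [s1.1, s1.2, s2.1, s2.2]
        exact ⟨fun h => (hI j' hj' t' ht').1 (by omega), fun h => (hI j' hj' t' ht').2 (by omega)⟩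
  · rintro σ' - - ⟨hmem, hI⟩
    refine ⟨hmem, fun j hj t ht => ?_⟩
    have hj2 : j / 2 < 2 ^ e := by rw [pow_succ] at hj; omega
    have := (hI (j / 2) hj2 t ht).1 (hidx hj2 ht)
    rcases Nat.even_or_odd' j with ⟨i, rfl | rfl⟩
    · rw [show 2 * i / 2 = i by omega] at this
      exact this.1
    · rw [show (2 * i + 1) / 2 = i by omega] at this
      exact this.2

/-- The input is exact, so the error starts at 0. After the last round the moduli are linear and the
residues are the values at the roots. -/
theorem transform_spec (hw : 24 * L + 45 ≤ w) (hM : 11 * 2 ^ L ≤ M) (hσ : Scaled L σ) {A : ℕ}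
    (hA : 5 ≤ A) (hA' : A ≤ 9) {r : ℕ} (hL : r + 1 ≤ L) (hh : σ.reg .h = 2 ^ r)
    (hlg : σ.reg .lg = r + 1) {f : ℕ → ℤ} (hf : ∀ i, |f i| ≤ 1)
    (htab : ∀ j < 2 ^ r, Approx (2 ^ (10 * L + 16)) (tableError L) (σ.mem (3 * 2 ^ L + (j : ℕ)))
      (σ.mem (4 * 2 ^ L + (j : ℕ))) (twiddle j))
    (harr : ∀ i < 2 ^ (r + 1), σ.mem (A * 2 ^ L + (i : ℕ)) = 2 ^ (10 * L + 16) * f i ∧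
      σ.mem ((A + 1) * 2 ^ L + (i : ℕ)) = 0) :
    Wp w M inp (transform A) ((r + 1) * (2 ^ r * 136 + 18) + 8) (fun σ' =>
      (∀ a : ℤ, a < A * 2 ^ L ∨ (A + 2) * 2 ^ L ≤ a → σ'.mem a = σ.mem a) ∧
      ∀ j < 2 ^ (r + 1), Approx (2 ^ (10 * L + 16)) (4 ^ L * tableError L)
          (σ'.mem (A * 2 ^ L + (j : ℕ))) (σ'.mem ((A + 1) * 2 ^ L + (j : ℕ)))
          (∑ i ∈ Finset.range (2 ^ (r + 1)), (f i : ℂ) * root j ^ i)) σ := by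
  have hfc : ∀ i, ‖(f i : ℂ)‖ ≤ 1 := by
    intro i
    rw [Complex.norm_intCast]
    exact_mod_cast hf i
  have hrL : 2 ^ (r + 1) ≤ 2 ^ L := Nat.pow_le_pow_right (by norm_num) hL
  have hrw : (2 : ℤ) ^ (r + 1) < 2 ^ w := pow_lt_pow_right₀ (by norm_num) (by omega)
  have hD2 := two_le_tableError L
  refine Wp.mono (Wp.seq (t₂ := (r + 1) * ((2 ^ r * 136 + 6 + 4) + 8) + 6)
    (wp_of_vc ?_)) (t := 2 + ((r + 1) * ((2 ^ r * 136 + 6 + 4) + 8) + 6)) (by ring_nf; rfl)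
    (fun σ' _ h => h)
  simp only [Com.vc, Ex.ok_var, Ex.eval_var, true_and]
  set σ₁ := σ.set .m (σ.reg .h) with hσ₁
  -- The value of `m` is written as a truncated quotient because it becomes `1 / 2 = 0` after the
  -- last round.
  refine wp_loop (r + 1) (fun e σ' =>
    (σ'.reg .m = ((2 ^ (r + 1 - e) / 2 : ℕ) : ℤ)) ∧
    (∀ a : ℤ, a < A * 2 ^ L ∨ (A + 2) * 2 ^ L ≤ a → σ'.mem a = σ.mem a) ∧
    ∀ j < 2 ^ e, ∀ t < 2 ^ (r + 1 - e), Approx (2 ^ (10 * L + 16)) ((4 ^ e - 1) * tableError L)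
      (σ'.mem (A * 2 ^ L + (j * 2 ^ (r + 1 - e) + t : ℕ)))
      (σ'.mem ((A + 1) * 2 ^ L + (j * 2 ^ (r + 1 - e) + t : ℕ)))
      (residue (fun i => (f i : ℂ)) (2 ^ (r + 1 - e)) e j t)) ?_ ?_ (by decide) rfl rfl ?_ ?_ ?_
  · simp [σ₁, hlg]
  · have h1 : r + 1 < 2 ^ w := lt_of_lt_of_le (by omega : r + 1 < w) (Nat.lt_two_pow_self).le
    exact_mod_cast h1
  · refine ⟨?_, fun _ _ => rfl, ?_⟩
    · simp [σ₁, hh, pow_succ]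
    · intro j hj t ht
      obtain rfl : j = 0 := by simpa using hj
      simp only [Nat.sub_zero] at ht
      obtain ⟨e1, e2⟩ := harr t ht
      simp only [zero_mul, zero_add, St.set_mem, σ₁, e1, e2, pow_zero, sub_self]
      simpa [residue] using Approx.exact (2 ^ (10 * L + 16)) (f t)
  · rintro e he σ' hfr her ⟨hm, hmem, hI⟩
    obtain ⟨k, rfl⟩ : ∃ k, r = e + k := ⟨r - e, by omega⟩
    rw [show e + k + 1 - e = k + 1 by omega] at hm hI
    have hm' : σ'.reg .m = ((2 ^ k : ℕ) : ℤ) := by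
      rw [hm, pow_succ, Nat.mul_div_cancel _ (by norm_num)]
    have hsc : Scaled L σ' := hσ.congr
      ((hfr .K rfl (by decide)).trans (by simp [σ₁]))
      ((hfr .S rfl (by decide)).trans (by simp [σ₁]))
      ((hfr .Q rfl (by decide)).trans (by simp [σ₁]))
    have h5 : (5 : ℤ) ≤ A := by exact_mod_cast hA
    have h6 : (5 : ℤ) * 2 ^ L ≤ A * 2 ^ L := mul_le_mul_of_nonneg_right h5 (by positivity)
    refine Wp.mono (Wp.seq (t₁ := 2 ^ (e + k) * 136 + 6) (t₂ := 4)
      (Wp.mono (butterflies_spec hw hM hsc hA hA' hL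
      (by rw [hfr .h rfl (by decide)]; simp [σ₁, hh]) hm' hfc ?_ hI) le_rfl ?_)) le_rfl
      (fun σ' _ h => h)
    · intro j hj
      have hj' : j < 2 ^ L := lt_of_lt_of_le hj (Nat.pow_le_pow_right (by norm_num) (by omega))
      have h1 : ((j : ℕ) : ℤ) < 2 ^ L := by exact_mod_cast hj'
      rw [hmem _ (Or.inl (by linarith)), hmem _ (Or.inl (by linarith))]
      exact htab j (lt_of_lt_of_le hj (Nat.pow_le_pow_right (by norm_num) (by omega)))
    · rintro σ'' hfr' ⟨hmem', hI'⟩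
      refine wp_of_vc (c := .assign .m (.var .m / 2)) ?_
      have hm'' : σ''.reg .m = ((2 ^ k : ℕ) : ℤ) := (hfr' .m rfl).trans hm'
      have hk : ((2 ^ k : ℕ) : ℤ) < 2 ^ w := by
        push_cast
        exact pow_lt_pow_right₀ (by norm_num) (by omega)
      have h2w : (2 : ℤ) < 2 ^ w := by
        calc (2 : ℤ) = 2 ^ 1 := by norm_num
          _ < _ := pow_lt_pow_right₀ (by norm_num) (by omega)
      simp only [Com.vc, Ex.ok_div, Ex.ok_var, Ex.ok_lit, Ex.eval_var, Ex.eval_lit, Ex.eval_div,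
        hm'', true_and, St.set_mem, St.set_reg, reduceCtorEq, if_false, if_true,
        show e + k + 1 - (e + 1) = k by omega]
      refine ⟨⟨⟨Int.natCast_nonneg _, hk⟩, by norm_num, h2w⟩, ?_, ?_, hI'⟩
      · push_cast; rfl
      · exact fun a ha => (hmem' a ha).trans (hmem a ha)
  · rintro σ' - - ⟨-, hmem, hI⟩
    refine ⟨hmem, fun j hj => ?_⟩
    have h1 := hI j hj 0 (by simp)
    simp only [Nat.sub_self, pow_zero, mul_one, add_zero, residue, one_mul, zero_add] at h1
    refine h1.mono ?_
    have : (4 : ℝ) ^ (r + 1) ≤ 4 ^ L := pow_le_pow_right₀ (by norm_num) hL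
    nlinarith

end

end WordRAM

/-! ### Integer square roots and the table of twiddle factors. -/

namespace WordRAM

open FourierCount Com

open Var in
/-- Integer square root of `x` by bisection. -/
def isqrt : Com :=
  .seq (.assign rt 0) <|
  .seq (.assign bit (S + S)) <|
  loop it cnt <|
  .seq (.assign bit (bit / 2)) <|
  .ifc (.lt ((rt + bit) * (rt + bit)) (x + 1)) (.assign rt (rt + bit))

open Var in
/-- Entry `pw + j` of the table of twiddle factors from entry `j`. -/
def tableEntry : Com :=
  .seq (.assign wr (.ld (.cell 3 j))) <|
  .seq (.assign wi (.ld (.cell 4 j))) <|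
  .seq (.store (.cell 3 (pw + j)) (.mulRe wr wi cs sn)) <|
  .store (.cell 4 (pw + j)) (.mulIm wr wi cs sn)

open Var in
/-- The second half of the table of size `2 * pw`, and the next cosine. -/
def tableRound : Com :=
  .seq (.assign x (S * S - cs * cs)) <|
  .seq isqrt <|
  .seq (.assign sn rt) <|
  .seq (loop j pw tableEntry) <|
  .seq (.assign pw (pw * 2)) <|
  .seq (.assign x (S * (S + cs) / 2)) <|
  .seq isqrt <|
  .assign cs rt

open Var in
/-- The table of the twiddle factors in the arrays `3` and `4`. -/
def table : Com :=
  .seq (.store (.cell 3 0) S) <|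
  .seq (.store (.cell 4 0) 0) <|
  .seq (.assign pw 1) <|
  .seq (.assign cs 0) <|
  loop k l tableRound

section

variable {α : Type*} {w M L : ℕ} {inp : List α} {σ : St}

theorem isqrt_spec (hw : 24 * L + 45 ≤ w) (hσ : Scaled L σ) (hcnt : σ.reg .cnt = 10 * L + 17)
    {X : ℤ} (hx : σ.reg .x = X) (hX0 : 0 ≤ X) (hX : X ≤ 2 ^ (10 * L + 16) * 2 ^ (10 * L + 16)) :
    Wp w M inp isqrt ((10 * L + 17) * 28 + 12) (fun σ' => σ'.mem = σ.mem ∧ 0 ≤ σ'.reg .rt ∧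
      σ'.reg .rt * σ'.reg .rt ≤ X ∧ X < (σ'.reg .rt + 1) * (σ'.reg .rt + 1)) σ := by
  have hbig : (9 : ℤ) * (2 ^ (10 * L + 16) * 2 ^ (10 * L + 16)) < 2 ^ w := by
    calc (9 : ℤ) * (2 ^ (10 * L + 16) * 2 ^ (10 * L + 16))
        ≤ 2 ^ 4 * (2 ^ (10 * L + 16) * 2 ^ (10 * L + 16)) :=
          mul_le_mul_of_nonneg_right (by norm_num) (by positivity)
      _ = 2 ^ (4 + (10 * L + 16 + (10 * L + 16))) := by
          rw [pow_add 2 4, pow_add 2 (10 * L + 16)]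
      _ < 2 ^ w := pow_lt_pow_right₀ (by norm_num) (by omega)
  have hS2 : (2 : ℤ) ^ (10 * L + 17) = 2 * 2 ^ (10 * L + 16) := by rw [pow_succ']
  have hSpos : (1 : ℤ) ≤ 2 ^ (10 * L + 16) := one_le_pow₀ (by norm_num)
  have hSw : (2 : ℤ) * 2 ^ (10 * L + 16) < 2 ^ w := by nlinarith
  refine Wp.mono (Wp.seq (wp_of_vc (c := .assign .rt 0) ?_)
    (t₂ := 4 + ((10 * L + 17) * 28 + 6))) (t := 2 + (4 + ((10 * L + 17) * 28 + 6))) (by omega)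
    (fun σ' _ h => h)
  simp only [Com.vc, Ex.ok_lit, true_and]
  refine Wp.seq (wp_of_vc (c := .assign .bit (.var .S + .var .S)) ?_)
  simp only [Com.vc, Ex.ok_add, Ex.ok_var, true_and, Ex.eval_lit, Ex.eval_add, Ex.eval_var,
    St.set_reg, reduceCtorEq, if_false, hσ.S]
  -- `bit` starts at `2 * S`, whose square exceeds `X`, and is 1 after `10 * L + 17` halvings; then
  -- the two inequalities pin down the root.
  refine (wp_loop (t := 20) (10 * L + 17) (fun i σ' => σ'.mem = σ.mem ∧
    σ'.reg .bit = 2 ^ (10 * L + 17 - i) ∧ 0 ≤ σ'.reg .rt ∧ σ'.reg .rt * σ'.reg .rt ≤ X ∧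
    X < (σ'.reg .rt + σ'.reg .bit) * (σ'.reg .rt + σ'.reg .bit)) ?_ ?_ (by decide) rfl rfl ?_ ?_ ?_)
  · simp [hcnt]
  · have : 10 * L + 17 < 2 ^ w := lt_of_lt_of_le (by omega : 10 * L + 17 < w)
      (Nat.lt_two_pow_self).le
    exact_mod_cast this
  · simp only [St.set_mem, St.set_reg, reduceCtorEq, if_false, if_true, Nat.sub_zero, hS2]
    refine ⟨trivial, by ring, by norm_num, by simpa using hX0, ?_⟩
    push_cast
    nlinarith
  · rintro i hi σ' hfr hir ⟨hmem, hbit, hr0, hr1, hr2⟩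
    have hxr : σ'.reg .x = X := (hfr .x rfl (by decide)).trans (by simp [hx])
    have hpow : (2 : ℤ) ^ (10 * L + 17 - i) = 2 * 2 ^ (10 * L + 17 - (i + 1)) := by
      rw [← pow_succ']; congr 1; omega
    have hble : (2 : ℤ) ^ (10 * L + 17 - (i + 1)) ≤ 2 ^ (10 * L + 16) :=
      pow_le_pow_right₀ (by norm_num) (by omega)
    have hb0 : (0 : ℤ) < 2 ^ (10 * L + 17 - (i + 1)) := by positivity
    have hdiv : (2 : ℤ) * 2 ^ (10 * L + 17 - (i + 1)) / 2 = 2 ^ (10 * L + 17 - (i + 1)) :=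
      Int.mul_ediv_cancel_left _ (by norm_num)
    have hrS : σ'.reg .rt ≤ 2 ^ (10 * L + 16) := by
      by_contra hlt
      have := mul_self_lt_mul_self (by positivity) (not_le.1 hlt)
      linarith
    have h2w : (2 : ℤ) < 2 ^ w := by linarith
    have hsq : (σ'.reg .rt + 2 ^ (10 * L + 17 - (i + 1))) *
        (σ'.reg .rt + 2 ^ (10 * L + 17 - (i + 1))) ≤
        (2 * 2 ^ (10 * L + 16)) * (2 * 2 ^ (10 * L + 16)) :=
      mul_self_le_mul_self (by linarith) (by linarith)
    have hSS : (1 : ℤ) ≤ 2 ^ (10 * L + 16) * 2 ^ (10 * L + 16) :=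
      one_le_mul_of_one_le_of_one_le hSpos hSpos
    rw [hpow] at hbit
    rw [hbit] at hr2
    have hsq_lt : (σ'.reg .rt + 2 ^ (10 * L + 17 - (i + 1))) *
        (σ'.reg .rt + 2 ^ (10 * L + 17 - (i + 1))) < 2 ^ w := by linarith
    have hX_lt : X + 1 < 2 ^ w := by linarith
    have hbit_lt : 2 * (2 : ℤ) ^ (10 * L + 17 - (i + 1)) < 2 ^ w := by linarith
    generalize (2 : ℤ) ^ (10 * L + 17 - (i + 1)) = β at *
    generalize hρ : σ'.reg .rt = ρ at *
    refine (wp_of_vc ?_).mono (t' := 20) (by simp [Com.size, Cond.size, Cond.fst, Cond.snd])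
      (fun σ' _ h => h)
    simp only [Com.vc, Cond.Ok, Cond.Holds, Ex.ok_div, Ex.ok_add, Ex.ok_mul, Ex.ok_var, Ex.ok_lit,
      Ex.eval_var, Ex.eval_lit, Ex.eval_div, Ex.eval_add, Ex.eval_mul, St.set_reg, St.set_mem,
      reduceCtorEq, if_false, if_true, true_and, and_true, hbit, hρ, hxr, hmem, Nat.cast_ofNat,
      Nat.cast_one, hdiv]
    refine ⟨⟨⟨by linarith, hbit_lt⟩, by norm_num, h2w⟩,
      ⟨⟨mul_self_nonneg _, hsq_lt⟩, by linarith, hX_lt⟩, fun h => ?_, fun h => ?_⟩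
    · exact ⟨by linarith, by linarith, by linarith⟩
    · exact ⟨hr0, hr1, by linarith⟩
  · rintro σ' hfr - ⟨hmem, hbit, hr0, hr1, hr2⟩
    rw [hbit] at hr2
    simp only [Nat.sub_self, pow_zero] at hr2
    exact ⟨hmem, hr0, hr1, hr2⟩

/-- The error of the integer square root for the half-angle formula does not grow. -/
theorem cos_half_error {S c R : ℤ} {θ : ℝ} (hS : 100 ≤ S) (hc0 : 0 ≤ c) (hcS : c ≤ S)
    (hθ : 0 ≤ Real.cos θ) (hθ' : 0 ≤ Real.cos (θ / 2)) (h : |(c : ℝ) - S * Real.cos θ| ≤ 4)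
    (heven : 2 ∣ S) (hR : 0 ≤ R) (h1 : R * R ≤ S * (S + c) / 2)
    (h2 : S * (S + c) / 2 < (R + 1) * (R + 1)) :
    R ≤ S ∧ |(R : ℝ) - S * Real.cos (θ / 2)| ≤ 4 := by
  obtain ⟨s, rfl⟩ := heven
  -- Evenness of `S` makes the halving exact, so the square root is the only rounding.
  have hX : 2 * s * (2 * s + c) / 2 = s * (2 * s + c) := by
    rw [mul_assoc, Int.mul_ediv_cancel_left _ (by norm_num)]
  rw [hX] at h1 h2
  refine ⟨by nlinarith, ?_⟩
  have hcos : Real.cos (θ / 2) ^ 2 = 1 / 2 + Real.cos θ / 2 := by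
    rw [Real.cos_sq]; congr 2; ring_nf
  have h1' : (R : ℝ) * R ≤ s * (2 * s + c) := by exact_mod_cast h1
  have h2' : (s : ℝ) * (2 * s + c) < (R + 1) * (R + 1) := by exact_mod_cast h2
  have hR' : (0 : ℝ) ≤ R := by exact_mod_cast hR
  have hS' : (100 : ℝ) ≤ 2 * s := by exact_mod_cast hS
  have hs0 : (0 : ℝ) < s := by linarith
  push_cast at h ⊢
  obtain ⟨h3, h4⟩ := abs_le.1 h
  set T : ℝ := 2 * s * Real.cos (θ / 2) with hT
  have hT2 : T * T = s * (2 * s + 2 * s * Real.cos θ) := by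
    calc T * T = 4 * s * s * Real.cos (θ / 2) ^ 2 := by rw [hT]; ring
      _ = _ := by rw [hcos]; ring
  have hT0 : 0 ≤ T := by positivity
  -- From `T ^ 2 ≥ 2 * s ^ 2` and `√2 > 4 / 3`. The argument of the root is off by at most `4 * s`,
  -- so a root of this size is off by less than 3, and the final rounding adds 1.
  have hTs : (4 / 3 : ℝ) * s ≤ T := by
    by_contra hlt
    push Not at hlt
    have : T * T < 4 / 3 * s * (4 / 3 * s) := mul_self_lt_mul_self hT0 hlt
    have : 0 ≤ (s : ℝ) * (2 * s * Real.cos θ) := by positivity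
    nlinarith
  rw [abs_le]
  constructor
  · by_contra hlt
    push Not at hlt
    have : (R + 1 : ℝ) * (R + 1) < (T - 3) * (T - 3) := by
      apply mul_self_lt_mul_self <;> linarith
    nlinarith
  · by_contra hlt
    push Not at hlt
    have : (T + 4) * (T + 4) < (R : ℝ) * R := by
      apply mul_self_lt_mul_self <;> linarith
    nlinarith

/-- The argument `S ^ 2 - c ^ 2` is off by at most `8 * S`. Near 0 the square root turns this into
an error of order `√S = q`, and `3 * q` suffices since `9 > 8`. -/
theorem sin_error {q S c R : ℤ} {θ : ℝ} (hS : S = q * q) (hq : 1 ≤ q) (hc0 : 0 ≤ c) (hcS : c ≤ S)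
    (hθ : 0 ≤ Real.cos θ) (hθ' : 0 ≤ Real.sin θ) (h : |(c : ℝ) - S * Real.cos θ| ≤ 4)
    (hR : 0 ≤ R) (h1 : R * R ≤ S * S - c * c) (h2 : S * S - c * c < (R + 1) * (R + 1)) :
    |(R : ℝ) - S * Real.sin θ| ≤ 3 * q + 1 := by
  have h1' : (R : ℝ) * R ≤ S * S - c * c := by exact_mod_cast h1
  have h2' : (S : ℝ) * S - c * c < (R + 1) * (R + 1) := by exact_mod_cast h2
  have hR' : (0 : ℝ) ≤ R := by exact_mod_cast hR
  have hq' : (1 : ℝ) ≤ q := by exact_mod_cast hq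
  have hSq : (S : ℝ) = q * q := by exact_mod_cast hS
  have hc0' : (0 : ℝ) ≤ c := by exact_mod_cast hc0
  have hcS' : (c : ℝ) ≤ S := by exact_mod_cast hcS
  have hS0 : (0 : ℝ) < S := by rw [hSq]; positivity
  set T : ℝ := S * Real.sin θ with hT
  set U : ℝ := S * Real.cos θ with hU
  have hU0 : 0 ≤ U := by positivity
  have hT0 : 0 ≤ T := by positivity
  have hUS : U ≤ S := by
    rw [hU]; exact mul_le_of_le_one_right hS0.le (Real.cos_le_one θ)
  have hTU : T * T = S * S - U * U := by
    have := Real.sin_sq_add_cos_sq θ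
    calc T * T = S * S * (Real.sin θ ^ 2 + Real.cos θ ^ 2) - U * U := by rw [hT, hU]; ring
      _ = _ := by rw [this]; ring
  obtain ⟨h3, h4⟩ := abs_le.1 h
  have hd : |(c : ℝ) * c - U * U| ≤ 8 * S := by
    rw [show (c : ℝ) * c - U * U = (c - U) * (c + U) by ring, abs_mul,
      abs_of_nonneg (by positivity : 0 ≤ (c : ℝ) + U)]
    calc |(c : ℝ) - U| * (c + U) ≤ 4 * (2 * S) :=
          mul_le_mul h (by linarith) (by positivity) (by norm_num)
      _ = 8 * S := by ring
  obtain ⟨h5, h6⟩ := abs_le.1 hd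
  rw [abs_le]
  constructor
  · by_contra hlt
    push Not at hlt
    have : (R + 1 + 3 * q : ℝ) * (R + 1 + 3 * q) < T * T := by
      apply mul_self_lt_mul_self <;> linarith
    nlinarith
  · by_contra hlt
    push Not at hlt
    have : (T + 3 * q) * (T + 3 * q) < (R : ℝ) * R := by
      apply mul_self_lt_mul_self <;> linarith
    nlinarith

/-- Error of the twiddle factors of the nodes `2 ^ k`. -/
noncomputable def stepError (L : ℕ) : ℝ := 2 ^ (5 * L + 10)

/-- Both factors have norm 1 and `stepError L ≤ S`, so the product term of the errors is absorbed by
a second `E`. The recursion `E ↦ 2 * E + stepError L + 2` from 0 gives `(2 ^ k - 1) * (stepError L +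
2)`. -/
theorem tableEntries_spec (hw : 24 * L + 45 ≤ w) (hM : 11 * 2 ^ L ≤ M) (hσ : Scaled L σ) {k : ℕ}
    (hk : k + 1 ≤ L) (hpw : σ.reg .pw = (2 ^ k : ℕ)) {E : ℝ} (hE0 : 0 ≤ E)
    (hES : E ≤ 2 ^ (10 * L + 16))
    (hz : Approx (2 ^ (10 * L + 16)) (stepError L) (σ.reg .cs) (σ.reg .sn) (halfRoot k))
    (htab : ∀ j < 2 ^ k, Approx (2 ^ (10 * L + 16)) E (σ.mem (3 * 2 ^ L + (j : ℕ)))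
      (σ.mem (4 * 2 ^ L + (j : ℕ))) (twiddle j)) :
    Wp w M inp (loop .j .pw tableEntry) (2 ^ k * 70 + 6) (fun σ' =>
      (∀ a : ℤ, a < 3 * 2 ^ L ∨ 5 * 2 ^ L ≤ a → σ'.mem a = σ.mem a) ∧
      ∀ j < 2 ^ (k + 1), Approx (2 ^ (10 * L + 16)) (2 * E + stepError L + 2)
        (σ'.mem (3 * 2 ^ L + (j : ℕ))) (σ'.mem (4 * 2 ^ L + (j : ℕ))) (twiddle j)) σ := by
  have hKk : 2 ^ k * 2 ≤ 2 ^ L := by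
    rw [← pow_succ]; exact Nat.pow_le_pow_right (by norm_num) hk
  have hKkz : ((2 ^ k : ℕ) : ℤ) * 2 ≤ 2 ^ L := by exact_mod_cast hKk
  have hKw := size_lt hw
  have hk0 : (0 : ℤ) < ((2 ^ k : ℕ) : ℤ) := by exact_mod_cast Nat.two_pow_pos k
  have hS0 : (0 : ℤ) < 2 ^ (10 * L + 16) := by positivity
  have hS0' : (0 : ℝ) < 2 ^ (10 * L + 16) := by positivity
  have hZ0 : 0 ≤ stepError L := by rw [stepError]; positivity
  have hZS : stepError L ≤ 2 ^ (10 * L + 16) := pow_le_pow_right₀ (by norm_num) (by omega)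
  have hEZ : E * stepError L / 2 ^ (10 * L + 16) ≤ E := by
    rw [div_le_iff₀ hS0']; exact mul_le_mul_of_nonneg_left hZS hE0
  -- Writes go to positions from `2 ^ k` on; the lower parts of both arrays, which are read, stay
  -- intact.
  refine (wp_loop (t := 62) (2 ^ k) (fun j σ' =>
    (∀ a : ℤ, (a < 3 * 2 ^ L + (2 ^ k : ℕ) ∨ (4 * 2 ^ L ≤ a ∧ a < 4 * 2 ^ L + (2 ^ k : ℕ)) ∨
      5 * 2 ^ L ≤ a) → σ'.mem a = σ.mem a) ∧
    ∀ i < j, Approx (2 ^ (10 * L + 16)) (2 * E + stepError L + 2)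
      (σ'.mem (3 * 2 ^ L + ((2 ^ k : ℕ) + i : ℤ))) (σ'.mem (4 * 2 ^ L + ((2 ^ k : ℕ) + i : ℤ)))
        (twiddle (2 ^ k + i)))
    hpw (by linarith) (by decide) rfl rfl ⟨fun _ _ => rfl, fun i hi => absurd hi (by omega)⟩
    ?_ ?_)
  · rintro j hj σ' hfr hjr ⟨hmem, hI⟩
    have hjz : (j : ℤ) < ((2 ^ k : ℕ) : ℤ) := by exact_mod_cast hj
    have hj0 : (0 : ℤ) ≤ j := Int.natCast_nonneg j
    have hR := htab j hj
    rw [← hmem (3 * 2 ^ L + j) (Or.inl (by linarith)),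
      ← hmem (4 * 2 ^ L + j) (Or.inr (Or.inl ⟨by linarith, by linarith⟩))] at hR
    have hcs := (hfr .cs rfl (by decide)).symm
    have hsn := (hfr .sn rfl (by decide)).symm
    have hz' := hz
    rw [hcs, hsn] at hz'
    have hsc : Scaled L σ' := hσ.congr (hfr .K rfl (by decide)) (hfr .S rfl (by decide))
      (hfr .Q rfl (by decide))
    have hpwr : σ'.reg .pw = (2 ^ k : ℕ) := (hfr .pw rfl (by decide)).trans hpw
    have hmul := hR.mul hS0 hz'
    have hbd := hR.abs_mul_le hS0 hz' (D := maxProd L) (by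
      rw [norm_twiddle, norm_halfRoot, maxProd_real, pow_one]
      push_cast
      rw [mul_one]
      have h1 : (1 : ℝ) ≤ (2 ^ L) ^ 3 := one_le_pow₀ (one_le_two_pow_real L)
      calc ((2 : ℝ) ^ (10 * L + 16) + E) * (2 ^ (10 * L + 16) + stepError L) ≤
            (2 ^ (10 * L + 16) + 2 ^ (10 * L + 16)) * (2 ^ (10 * L + 16) + 2 ^ (10 * L + 16)) := by
            gcongr
        _ = 4 * 2 ^ (10 * L + 16) * 2 ^ (10 * L + 16) * 1 := by ring
        _ ≤ _ := mul_le_mul_of_nonneg_left h1 (by positivity))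
    rw [norm_twiddle, norm_halfRoot, one_mul, one_mul, ← twiddle_two_pow_add k j hj] at hmul
    have hnew := hmul.mono (E' := 2 * E + stepError L + 2) (by push_cast; linarith)
    have a3 := cell_mem (M := M) hM (b := 3) (by norm_num) (p := j) hj0 (by linarith)
    have a4 := cell_mem (M := M) hM (b := 4) (by norm_num) (p := j) hj0 (by linarith)
    have c3 := cell_mem (M := M) hM (b := 3) (by norm_num) (p := (2 ^ k : ℕ) + j) (by linarith)
      (by linarith)
    have c4 := cell_mem (M := M) hM (b := 4) (by norm_num) (p := (2 ^ k : ℕ) + j) (by linarith)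
      (by linarith)
    simp only [Nat.cast_ofNat] at a3 a4 c3 c4
    have h43 : (4 * 2 ^ L + j : ℤ) ≠ 3 * 2 ^ L + ((2 ^ k : ℕ) + j) := by intro h; linarith
    generalize ((2 ^ k : ℕ) : ℤ) = P at *
    refine (wp_of_vc ?_).mono (t' := 62) (by simp [tableEntry, Com.size, Ex.mulRe, Ex.mulIm])
      (fun σ' _ h => h)
    simp only [tableEntry, Com.vc, Ex.mulRe, Ex.mulIm, Ex.ok_add, Ex.ok_mul, Ex.ok_sub,
      Ex.ok_var, Ex.ok_ld, Ex.ok_cell, Ex.ok_fdiv, Ex.eval_cell, Ex.eval_var,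
      Ex.eval_add, Ex.eval_mul, Ex.eval_sub, Ex.eval_ld, Ex.eval_fdiv, St.set_reg, St.set_mem,
      St.put_reg, reduceCtorEq, if_true, if_false, true_and, hsc.K, hsc.S, hsc.Q, fdiv_eq,
      hjr, hpwr, Nat.cast_ofNat, a3, a4, c3, c4, fdivOk hw hbd.1, fdivOk hw hbd.2, and_self,
      St.put_mem]
    refine ⟨fun a ha => ?_, fun i hi => ?_⟩
    · rw [if_neg (by rintro rfl; rcases ha with h | ⟨h, h'⟩ | h <;> linarith),
        if_neg (by rintro rfl; rcases ha with h | ⟨h, h'⟩ | h <;> linarith)]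
      exact hmem a ha
    · have hi0 : (0 : ℤ) ≤ i := Int.natCast_nonneg i
      have hiP : (i : ℤ) < P := by
        have : (i : ℤ) ≤ j := by exact_mod_cast (by omega : i ≤ j)
        linarith
      rcases Nat.lt_succ_iff_lt_or_eq.1 hi with hi | rfl
      · have hij : (i : ℤ) < j := by exact_mod_cast hi
        rw [if_neg (by intro h; linarith), if_neg (by intro h; linarith),
          if_neg (by intro h; linarith), if_neg (by intro h; linarith)]
        exact hI i hi
      · rw [if_neg (by intro h; linarith), if_pos rfl, if_pos rfl]
        exact hnew
  · rintro σ' hfr - ⟨hmem, hI⟩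
    refine ⟨fun a ha => hmem a ?_, fun j hj => ?_⟩
    · rcases ha with h | h
      · left; linarith
      · right; right; linarith
    · rcases lt_or_ge j (2 ^ k) with hjk | hjk
      · have hjz : (j : ℤ) < ((2 ^ k : ℕ) : ℤ) := by exact_mod_cast hjk
        have hj0 : (0 : ℤ) ≤ j := Int.natCast_nonneg j
        rw [hmem _ (Or.inl (by linarith)),
          hmem _ (Or.inr (Or.inl ⟨by linarith, by linarith⟩))]
        exact (htab j hjk).mono (by linarith)
      · obtain ⟨i, rfl⟩ := Nat.exists_eq_add_of_le hjk
        have := hI i (by rw [pow_succ] at hj; omega)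
        simpa using this

theorem stepError_add_two_le (L : ℕ) : stepError L + 2 ≤ 2 ^ (5 * L + 11) := by
  rw [stepError, pow_succ _ (5 * L + 10)]
  have : (2 : ℝ) ^ 1 ≤ 2 ^ (5 * L + 10) := pow_le_pow_right₀ (by norm_num) (by omega)
  linarith

theorem two_pow_mul_stepError_le {k L : ℕ} (hk : k ≤ L) :
    2 ^ k * (stepError L + 2) ≤ tableError L := by
  rw [tableError, show 6 * L + 11 = L + (5 * L + 11) by ring, pow_add]
  exact mul_le_mul (pow_le_pow_right₀ (by norm_num) hk) (stepError_add_two_le L)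
    (by rw [stepError]; positivity) (by positivity)

theorem cos_halfRoot_nonneg (k : ℕ) : 0 ≤ Real.cos (Real.pi / 2 ^ (k + 1)) := by
  have hpi := Real.pi_pos
  have h : Real.pi / 2 ^ (k + 1) ≤ Real.pi / 2 := by
    apply div_le_div_of_nonneg_left hpi.le (by norm_num)
    calc (2 : ℝ) = 2 ^ 1 := by norm_num
      _ ≤ _ := pow_le_pow_right₀ (by norm_num) (by omega)
  exact Real.cos_nonneg_of_mem_Icc ⟨by linarith [show 0 ≤ Real.pi / 2 ^ (k + 1) by positivity], h⟩

theorem sin_halfRoot_nonneg (k : ℕ) : 0 ≤ Real.sin (Real.pi / 2 ^ (k + 1)) := by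
  have hpi := Real.pi_pos
  refine Real.sin_nonneg_of_nonneg_of_le_pi (by positivity) ?_
  exact div_le_self hpi.le (one_le_pow₀ (by norm_num))

set_option maxHeartbeats 400000 in
-- The error of the cosine stays at most 4 through all halvings and each sine is computed afresh
-- from its cosine, so the errors of the factors `halfRoot k` do not accumulate; only the table
-- products do.
theorem table_spec (hw : 24 * L + 45 ≤ w) (hM : 11 * 2 ^ L ≤ M) (hσ : Scaled L σ) {l : ℕ}
    (hl : L = l + 1) (hlr : σ.reg .l = l) (hcnt : σ.reg .cnt = 10 * L + 17) :
    Wp w M inp table (l * (2 ^ L * 70 + 560 * L + 1100) + 40) (fun σ' =>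
      (∀ a : ℤ, a < 3 * 2 ^ L ∨ 5 * 2 ^ L ≤ a → σ'.mem a = σ.mem a) ∧
      ∀ j < 2 ^ l, Approx (2 ^ (10 * L + 16)) (tableError L)
        (σ'.mem (3 * 2 ^ L + (j : ℕ))) (σ'.mem (4 * 2 ^ L + (j : ℕ))) (twiddle j)) σ := by
  have a3 := cell_mem (M := M) hM (b := 3) (by norm_num) (p := 0) le_rfl (by positivity)
  have a4 := cell_mem (M := M) hM (b := 4) (by norm_num) (p := 0) le_rfl (by positivity)
  simp only [Nat.cast_ofNat, add_zero] at a3 a4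
  have hS0 : (0 : ℤ) < 2 ^ (10 * L + 16) := by positivity
  have hK0 : (0 : ℤ) < 2 ^ L := by positivity
  have hZ0 : 0 ≤ stepError L := by rw [stepError]; positivity
  have hSq : (2 : ℤ) ^ (10 * L + 16) = 2 ^ (5 * L + 8) * 2 ^ (5 * L + 8) := by
    rw [← pow_add]; congr 1; ring
  have hS100 : (100 : ℤ) ≤ 2 ^ (10 * L + 16) := by
    calc (100 : ℤ) ≤ 2 ^ 16 := by norm_num
      _ ≤ _ := pow_le_pow_right₀ (by norm_num) (by omega)
  have hSdvd : (2 : ℤ) ∣ 2 ^ (10 * L + 16) := dvd_pow_self _ (by omega)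
  have hSS : (2 : ℤ) ^ (10 * L + 16) * 2 ^ (10 * L + 16) * 2 < 2 ^ w := by
    rw [← pow_add, ← pow_succ]
    exact pow_lt_pow_right₀ (by norm_num) (by omega)
  have h2w : (2 : ℤ) < 2 ^ w := by linarith [scale_lt hw]
  have hq1 : (1 : ℤ) ≤ 2 ^ (5 * L + 8) := one_le_pow₀ (by norm_num)
  refine (Wp.mono (Wp.seq (wp_of_vc (c := .store (.cell 3 0) (.var .S)) ?_)
    (t₂ := 7 + (2 + (2 + (l * (2 ^ L * 70 + 560 * L + 1092 + 8) + 6)))))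
    (t := 7 + (7 + (2 + (2 + (l * (2 ^ L * 70 + 560 * L + 1092 + 8) + 6))))) (by linarith)
    (fun σ' _ h => h))
  simp only [Com.vc, Ex.ok_cell, Ex.ok_lit, Ex.ok_var, true_and, Ex.eval_cell, Ex.eval_lit,
    Ex.eval_var, hσ.K, Nat.cast_ofNat, Nat.cast_zero, add_zero, a3]
  refine Wp.seq (wp_of_vc (c := .store (.cell 4 0) 0) ?_)
  simp only [Com.vc, Ex.ok_cell, Ex.ok_lit, Ex.ok_var, true_and, Ex.eval_cell, Ex.eval_lit,
    Ex.eval_var, St.put_reg, hσ.K, Nat.cast_ofNat, Nat.cast_zero, add_zero, a4]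
  refine Wp.seq (wp_of_vc (c := .assign .pw 1) ?_)
  simp only [Com.vc, Ex.ok_lit, true_and, Ex.eval_lit, Nat.cast_one]
  refine Wp.seq (wp_of_vc (c := .assign .cs 0) ?_)
  simp only [Com.vc, Ex.ok_lit, true_and, Ex.eval_lit, Nat.cast_zero]
  refine (wp_loop (t := 2 ^ L * 70 + 560 * L + 1092) l (fun k σ' =>
    (∀ a : ℤ, a < 3 * 2 ^ L ∨ 5 * 2 ^ L ≤ a → σ'.mem a = σ.mem a) ∧
    σ'.reg .pw = (2 ^ k : ℕ) ∧ 0 ≤ σ'.reg .cs ∧ σ'.reg .cs ≤ 2 ^ (10 * L + 16) ∧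
    |(σ'.reg .cs : ℝ) - ((2 ^ (10 * L + 16) : ℤ) : ℝ) * Real.cos (Real.pi / 2 ^ (k + 1))| ≤ 4 ∧
    ∀ j < 2 ^ k, Approx (2 ^ (10 * L + 16)) ((2 ^ k - 1) * (stepError L + 2))
        (σ'.mem (3 * 2 ^ L + (j : ℕ))) (σ'.mem (4 * 2 ^ L + (j : ℕ))) (twiddle j))
    ?_ ?_ (by decide) rfl rfl ?_ ?_ ?_)
  · simp [hlr]
  · have : l < 2 ^ w := lt_of_lt_of_le (by omega : l < w) (Nat.lt_two_pow_self).le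
    exact_mod_cast this
  · simp only [St.set_mem, St.set_reg, St.put_mem, reduceCtorEq, if_true, if_false]
    -- The starting angle is a right angle, whose cosine 0 is exact.
    refine ⟨fun a ha => ?_, by simp, le_rfl, hS0.le, by simp, fun j hj => ?_⟩
    · rw [if_neg (by rintro rfl; rcases ha with h | h <;> linarith),
        if_neg (by rintro rfl; rcases ha with h | h <;> linarith)]
    · obtain rfl : j = 0 := by simpa using hj
      have h34 : (3 : ℤ) * 2 ^ L ≠ 4 * 2 ^ L := by intro h; linarith
      simp only [Nat.cast_zero, add_zero, if_true, h34, if_false, pow_zero, sub_self, zero_mul,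
        twiddle_zero]
      simpa [hσ.S] using Approx.exact (2 ^ (10 * L + 16)) 1
  · rintro k hk σ' hfr hkr ⟨hmem, hpw, hc0, hcS, hc, hI⟩
    have hsc : Scaled L σ' := hσ.congr
      ((hfr .K rfl (by decide)).trans (by simp)) ((hfr .S rfl (by decide)).trans (by simp))
      ((hfr .Q rfl (by decide)).trans (by simp))
    have hcnt' : σ'.reg .cnt = 10 * L + 17 := (hfr .cnt rfl (by decide)).trans (by simp [hcnt])
    have hkL : 2 ^ k ≤ 2 ^ L := Nat.pow_le_pow_right (by norm_num) (by omega)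
    have hkR := one_le_two_pow_real k
    have hcos := cos_halfRoot_nonneg k
    have hcos' := cos_halfRoot_nonneg (k + 1)
    have hsin := sin_halfRoot_nonneg k
    rw [show Real.pi / 2 ^ (k + 1 + 1) = Real.pi / 2 ^ (k + 1) / 2 by
      rw [pow_succ _ (k + 1), div_mul_eq_div_div]] at hcos'
    generalize hcdef : σ'.reg .cs = c at *
    have hcc : c * c ≤ 2 ^ (10 * L + 16) * 2 ^ (10 * L + 16) := mul_self_le_mul_self hc0 hcS
    refine (Wp.mono (Wp.seq (wp_of_vc (c := .assign .x (.var .S * .var .S - .var .cs * .var .cs)) ?_)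
      (t₂ := ((10 * L + 17) * 28 + 12) + (2 + ((2 ^ k * 70 + 6) + (4 + (8 +
        (((10 * L + 17) * 28 + 12) + 2)))))))
      (t := 8 + (((10 * L + 17) * 28 + 12) + (2 + ((2 ^ k * 70 + 6) + (4 + (8 +
        (((10 * L + 17) * 28 + 12) + 2))))))) (by linarith) (fun σ' _ h => h))
    simp only [Com.vc, Ex.ok_mul, Ex.ok_sub, Ex.ok_var, true_and, Ex.eval_mul, Ex.eval_sub,
      Ex.eval_var, hsc.S, hcdef]
    refine Wp.seq (Wp.mono (isqrt_spec hw (hsc.congr (by simp) (by simp) (by simp))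
      (by simp [hcnt']) (X := 2 ^ (10 * L + 16) * 2 ^ (10 * L + 16) - c * c) (by simp)
      (by linarith) (by linarith [mul_self_nonneg c])) le_rfl ?_)
    rintro σ₂ hf₂ ⟨hm₂, hR0, hR1, hR2⟩
    refine Wp.seq (wp_of_vc (c := .assign .sn (.var .rt)) ?_)
    simp only [Com.vc, Ex.ok_var, true_and, Ex.eval_var]
    have hs := sin_error (q := 2 ^ (5 * L + 8)) hSq hq1 hc0 hcS hcos hsin hc hR0 hR1 hR2
    generalize hRdef : σ₂.reg .rt = R at *
    have hz : Approx (2 ^ (10 * L + 16)) (stepError L) c R (halfRoot k) := by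
      refine le_trans (Complex.norm_le_abs_re_add_abs_im _) ?_
      have h1 : ((2 ^ (10 * L + 16) : ℤ) : ℂ) = (((2 ^ (10 * L + 16) : ℤ) : ℝ) : ℂ) := by simp
      rw [h1, Complex.sub_re, Complex.sub_im, Complex.re_ofReal_mul, Complex.im_ofReal_mul]
      -- With `q = 2 ^ (5 * L + 8)`, the square root of `S`, cosine and sine together are off by at
      -- most `4 + (3 * q + 1)`, which is at most `4 * q`.
      have h2 : stepError L = 4 * ((2 ^ (5 * L + 8) : ℤ) : ℝ) := by
        rw [stepError, show 5 * L + 10 = 5 * L + 8 + 2 by ring, pow_add]; push_cast; ring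
      have h3 : (5 : ℝ) ≤ ((2 ^ (5 * L + 8) : ℤ) : ℝ) := by
        have : (2 : ℝ) ^ 8 ≤ 2 ^ (5 * L + 8) := pow_le_pow_right₀ (by norm_num) (by omega)
        push_cast
        linarith
      rw [h2]
      simp only [halfRoot]
      linarith
    have hE0 : 0 ≤ ((2 : ℝ) ^ k - 1) * (stepError L + 2) :=
      mul_nonneg (by linarith) (by linarith)
    have hES : ((2 : ℝ) ^ k - 1) * (stepError L + 2) ≤ 2 ^ (10 * L + 16) := by
      have h1 := two_pow_mul_stepError_le (k := k) (L := L) (by omega)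
      have h2 : tableError L ≤ 2 ^ (10 * L + 16) := by
        simpa using pow_mul_tableError_le (Nat.zero_le L)
      linarith
    refine Wp.seq (Wp.mono (tableEntries_spec hw hM (k := k)
      (E := ((2 : ℝ) ^ k - 1) * (stepError L + 2))
      (hsc.congr (by simp [hf₂ .K rfl]) (by simp [hf₂ .S rfl]) (by simp [hf₂ .Q rfl]))
      (by omega) (by simp [hf₂ .pw rfl, hpw]) hE0 hES (by simpa [hf₂ .cs rfl, hcdef] using hz)
      (by simpa [hm₂] using hI)) le_rfl ?_)
    rintro σ₃ hf₃ ⟨hm₃, hI₃⟩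
    refine Wp.seq (wp_of_vc (c := .assign .pw (.var .pw * 2)) ?_)
    simp only [Com.vc, Ex.ok_mul, Ex.ok_var, Ex.ok_lit, true_and, Ex.eval_mul, Ex.eval_lit,
      Ex.eval_var]
    refine Wp.seq (wp_of_vc (c := .assign .x (.var .S * (.var .S + .var .cs) / 2)) ?_)
    have hS₃ : σ₃.reg .S = 2 ^ (10 * L + 16) := by simp [hf₃ .S rfl, hf₂ .S rfl, hsc.S]
    have hcs₃ : σ₃.reg .cs = c := by simp [hf₃ .cs rfl, hf₂ .cs rfl, hcdef]
    have hXle : 2 ^ (10 * L + 16) * (2 ^ (10 * L + 16) + c) ≤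
        2 ^ (10 * L + 16) * 2 ^ (10 * L + 16) * 2 := by
      rw [mul_assoc]
      exact mul_le_mul_of_nonneg_left (by linarith) hS0.le
    have hX0 : 0 ≤ 2 ^ (10 * L + 16) * (2 ^ (10 * L + 16) + c) := mul_nonneg hS0.le (by linarith)
    simp only [Com.vc, Ex.ok_mul, Ex.ok_add, Ex.ok_div, Ex.ok_var, Ex.ok_lit, true_and, Ex.eval_mul,
      Ex.eval_add, Ex.eval_div, Ex.eval_lit, Ex.eval_var, St.set_reg, reduceCtorEq, if_false,
      hS₃, hcs₃, Nat.cast_ofNat]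
    refine ⟨⟨⟨hX0, by linarith⟩, by norm_num, h2w⟩, ?_⟩
    refine Wp.seq (Wp.mono (isqrt_spec hw
      (hsc.congr (by simp [hf₃ .K rfl, hf₂ .K rfl]) (by simp [hf₃ .S rfl, hf₂ .S rfl])
        (by simp [hf₃ .Q rfl, hf₂ .Q rfl])) (by simp [hf₃ .cnt rfl, hf₂ .cnt rfl, hcnt'])
      (X := 2 ^ (10 * L + 16) * (2 ^ (10 * L + 16) + c) / 2) (by simp)
      (Int.ediv_nonneg hX0 (by norm_num))
      (Int.ediv_le_of_le_mul (by norm_num) hXle)) le_rfl ?_)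
    rintro σ₄ hf₄ ⟨hm₄, hR0', hR1', hR2'⟩
    refine wp_of_vc (c := .assign .cs (.var .rt)) ?_
    obtain ⟨hRS, hRc⟩ := cos_half_error hS100 hc0 hcS hcos hcos' hc hSdvd hR0' hR1' hR2'
    simp only [Com.vc, Ex.ok_var, true_and, Ex.eval_var, St.set_reg, St.set_mem, reduceCtorEq,
      if_false, if_true, hm₄]
    refine ⟨fun a ha => ?_, ?_, hR0', hRS, ?_, fun j hj => ?_⟩
    · rw [hm₃ a ha]
      simp only [St.set_mem, hm₂]
      exact hmem a ha
    · rw [hf₄ .pw rfl]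
      simp only [St.set_reg, reduceCtorEq, if_false, if_true, hf₃ .pw rfl, hf₂ .pw rfl, hpw]
      push_cast
      rw [pow_succ]
    · rwa [show Real.pi / 2 ^ (k + 1 + 1) = Real.pi / 2 ^ (k + 1) / 2 by
        rw [pow_succ _ (k + 1), div_mul_eq_div_div]]
    · refine (hI₃ j hj).mono (le_of_eq ?_)
      rw [pow_succ]
      ring
  · rintro σ' hfr - ⟨hmem, -, -, -, -, hI⟩
    refine ⟨hmem, fun j hj => (hI j hj).mono ?_⟩
    have := two_pow_mul_stepError_le (k := l) (L := L) (by omega)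
    linarith

end

end WordRAM

/-! ### Loading a block and summing the products of its transforms. -/

namespace WordRAM

open FourierCount Com

open Var in
/-- Clear the arrays `5, …, 10`. -/
def clear : Com :=
  loop t N <|
  .seq (.store (.cell 5 t) 0) <|
  .seq (.store (.cell 6 t) 0) <|
  .seq (.store (.cell 7 t) 0) <|
  .seq (.store (.cell 8 t) 0) <|
  .seq (.store (.cell 9 t) 0) <|
  .store (.cell 10 t) 0

open Var in
/-- Copy the block that starts at `s` to the arrays `5`, `7`, `9`. -/
def fill : Com :=
  loop t h <|
  .seq (.assign ur (.ld (.cell 0 (s + t)))) <|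
  .seq (.assign vr (.ld (.cell 2 (s + h + t)))) <|
  .seq (.assign wr (.ld (.cell 1 (s + h / 2 + (h - 1 - t))))) <|
  .seq (.store (.cell 5 (t + 1)) ur) <|
  .seq (.store (.cell 7 (t + 1)) vr) <|
  .store (.cell 9 (2 * t)) wr

open Var in
/-- Add up the products of corresponding entries of the three transforms. -/
def product : Com :=
  .seq (.assign acc 0) <|
  loop j N <|
  .seq (.assign ur (.ld (.cell 5 j))) <|
  .seq (.assign ui (.ld (.cell 6 j))) <|
  .seq (.assign vr (.ld (.cell 7 j))) <|
  .seq (.assign vi (.ld (.cell 8 j))) <|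
  .seq (.assign wr (.ld (.cell 9 j))) <|
  .seq (.assign wi (.ld (.cell 10 j))) <|
  .seq (.assign x (.mulRe ur ui vr vi)) <|
  .seq (.assign it (.mulIm ur ui vr vi)) <|
  .assign acc (acc + .mulRe x it wr wi)

section

variable {α : Type*} {w M L : ℕ} {inp : List α} {σ : St}

theorem clear_spec (hw : 24 * L + 45 ≤ w) (hM : 11 * 2 ^ L ≤ M) (hσ : Scaled L σ) {n : ℕ}
    (hn : n ≤ 2 ^ L) (hN : σ.reg .N = n) :
    Wp w M inp clear (n * 50 + 6) (fun σ' =>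
      (∀ a : ℤ, a < 5 * 2 ^ L → σ'.mem a = σ.mem a) ∧
      ∀ A : ℕ, 5 ≤ A → A ≤ 10 → ∀ i < n, σ'.mem (A * 2 ^ L + (i : ℕ)) = 0) σ := by
  have hnz : (n : ℤ) ≤ 2 ^ L := by exact_mod_cast hn
  have hK0 : (0 : ℤ) < 2 ^ L := by positivity
  refine wp_loop (t := 42) n (fun t σ' =>
      (∀ a : ℤ, a < 5 * 2 ^ L → σ'.mem a = σ.mem a) ∧
      ∀ A : ℕ, 5 ≤ A → A ≤ 10 → ∀ i < t, σ'.mem (A * 2 ^ L + (i : ℕ)) = 0) hN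
    (by linarith [size_lt hw]) (by decide) rfl rfl ⟨fun _ _ => rfl, fun _ _ _ i hi => absurd hi
      (by omega)⟩ ?_ (fun σ' _ _ h => h)
  rintro t ht σ' hfr htr ⟨hmem, hI⟩
  have htz : (t : ℤ) < n := by exact_mod_cast ht
  have ht0 : (0 : ℤ) ≤ t := Int.natCast_nonneg t
  have hKr : σ'.reg .K = 2 ^ L := (hfr .K rfl (by decide)).trans hσ.K
  have hc : ∀ {b : ℕ}, b ≤ 10 → 0 ≤ (b : ℤ) * 2 ^ L + t ∧ (b : ℤ) * 2 ^ L + t < M :=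
    fun hb => cell_mem hM hb ht0 (by linarith)
  refine (wp_of_vc ?_).mono (t' := 42) (by simp [Com.size]) (fun σ' _ h => h)
  simp only [Com.vc, Ex.ok_var, Ex.ok_lit, Ex.ok_cell, Ex.eval_cell, Ex.eval_var, Ex.eval_lit,
    St.put_reg, St.set_mem, true_and, hKr, htr, hc (b := 5) (by norm_num),
    hc (b := 6) (by norm_num), hc (b := 7) (by norm_num), hc (b := 8) (by norm_num),
    hc (b := 9) (by norm_num), hc (b := 10) le_rfl, St.put_mem, Nat.cast_zero]
  push_cast
  refine ⟨fun a ha => ?_, fun A hA hA' i hi => ?_⟩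
  · rw [if_neg (by intro h; linarith), if_neg (by intro h; linarith), if_neg (by intro h; linarith),
      if_neg (by intro h; linarith), if_neg (by intro h; linarith), if_neg (by intro h; linarith)]
    exact hmem a ha
  · rcases Nat.lt_succ_iff_lt_or_eq.1 hi with hi | rfl
    · simp [hI A hA hA' i hi]
    · interval_cases A <;> simp

theorem fill_spec (hw : 24 * L + 45 ≤ w) (hM : 11 * 2 ^ L ≤ M) (hσ : Scaled L σ) {H s : ℕ}
    (hH : 0 < H) (hs : s + 2 * (2 * H) ≤ 2 ^ L) (hh : σ.reg .h = (2 * H : ℕ)) (hsr : σ.reg .s = s)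
    {fA fB fC : ℕ → ℤ}
    (hfA : ∀ q < 2 ^ L, σ.mem ((q : ℕ) : ℤ) = 2 ^ (10 * L + 16) * fA q)
    (hfB : ∀ q < 2 ^ L, σ.mem (2 ^ L + (q : ℕ)) = 2 ^ (10 * L + 16) * fB q)
    (hfC : ∀ q < 2 ^ L, σ.mem (2 * 2 ^ L + (q : ℕ)) = 2 ^ (10 * L + 16) * fC q)
    (hzero : ∀ A : ℕ, 5 ≤ A → A ≤ 10 → ∀ i < 2 * (2 * H), σ.mem (A * 2 ^ L + (i : ℕ)) = 0) :
    Wp w M inp fill (2 * H * 80 + 6) (fun σ' =>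
      (∀ a : ℤ, a < 5 * 2 ^ L → σ'.mem a = σ.mem a) ∧
      ∀ i < 2 * (2 * H),
        σ'.mem (5 * 2 ^ L + (i : ℕ)) =
          2 ^ (10 * L + 16) * shifted (fun a => fA (s + a)) (2 * H) i ∧
        σ'.mem (6 * 2 ^ L + (i : ℕ)) = 0 ∧
        σ'.mem (7 * 2 ^ L + (i : ℕ)) =
          2 ^ (10 * L + 16) * shifted (fun c => fC (s + 2 * H + c)) (2 * H) i ∧
        σ'.mem (8 * 2 ^ L + (i : ℕ)) = 0 ∧
        σ'.mem (9 * 2 ^ L + (i : ℕ)) =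
          2 ^ (10 * L + 16) * spread (fun u => fB (s + H + (2 * H - 1 - u))) i ∧
        σ'.mem (10 * 2 ^ L + (i : ℕ)) = 0) σ := by
  have hsz : (s : ℤ) + 2 * (2 * H) ≤ 2 ^ L := by exact_mod_cast hs
  have hK0 : (0 : ℤ) < 2 ^ L := by positivity
  have hs0 : (0 : ℤ) ≤ s := Int.natCast_nonneg s
  have hH0 : (0 : ℤ) < H := by exact_mod_cast hH
  have hKw := size_lt hw
  -- In array 9 only even positions are written; odd ones keep the cleared value, so the prefix of
  -- length `2 * t` is final after `t` rounds.
  refine (wp_loop (t := 72) (2 * H) (fun t σ' =>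
      (∀ a : ℤ, a < 5 * 2 ^ L → σ'.mem a = σ.mem a) ∧
      ∀ i < 2 * (2 * H),
        σ'.mem (5 * 2 ^ L + (i : ℕ)) =
          2 ^ (10 * L + 16) * shifted (fun a => fA (s + a)) t i ∧
        σ'.mem (6 * 2 ^ L + (i : ℕ)) = 0 ∧
        σ'.mem (7 * 2 ^ L + (i : ℕ)) =
          2 ^ (10 * L + 16) * shifted (fun c => fC (s + 2 * H + c)) t i ∧
        σ'.mem (8 * 2 ^ L + (i : ℕ)) = 0 ∧
        σ'.mem (9 * 2 ^ L + (i : ℕ)) = (if i < 2 * t then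
          2 ^ (10 * L + 16) * spread (fun u => fB (s + H + (2 * H - 1 - u))) i else 0) ∧
        σ'.mem (10 * 2 ^ L + (i : ℕ)) = 0) hh
    (by push_cast; linarith) (by decide) rfl rfl ⟨fun _ _ => rfl, fun i hi => ?_⟩ ?_ ?_)
  · have h5 := hzero 5 (by norm_num) (by norm_num) i hi
    have h6 := hzero 6 (by norm_num) (by norm_num) i hi
    have h7 := hzero 7 (by norm_num) (by norm_num) i hi
    have h8 := hzero 8 (by norm_num) (by norm_num) i hi
    have h9 := hzero 9 (by norm_num) (by norm_num) i hi
    have h10 := hzero 10 (by norm_num) (by norm_num) i hi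
    simp only [Nat.cast_ofNat] at h5 h6 h7 h8 h9 h10
    have hsh : ∀ f : ℕ → ℤ, shifted f 0 i = 0 := fun f => if_neg (by omega)
    simp [h5, h6, h7, h8, h9, h10, hsh]
  · rintro t ht σ' hfr htr ⟨hmem, hI⟩
    have htz : (t : ℤ) < 2 * H := by exact_mod_cast ht
    have ht0 : (0 : ℤ) ≤ t := Int.natCast_nonneg t
    have hKr : σ'.reg .K = 2 ^ L := (hfr .K rfl (by decide)).trans hσ.K
    have hhr : σ'.reg .h = 2 * H := by rw [hfr .h rfl (by decide), hh]; push_cast; rfl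
    have hsr' : σ'.reg .s = s := (hfr .s rfl (by decide)).trans hsr
    have c0 := cell_mem (M := M) hM (b := 0) (by norm_num) (p := s + t) (by linarith) (by linarith)
    have c2 := cell_mem (M := M) hM (b := 2) (by norm_num) (p := s + 2 * H + t) (by linarith)
      (by linarith)
    have c1 := cell_mem (M := M) hM (b := 1) (by norm_num) (p := s + H + (2 * H - 1 - t))
      (by linarith) (by linarith)
    have c5 := cell_mem (M := M) hM (b := 5) (by norm_num) (p := t + 1) (by linarith) (by linarith)
    have c7 := cell_mem (M := M) hM (b := 7) (by norm_num) (p := t + 1) (by linarith) (by linarith)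
    have c9 := cell_mem (M := M) hM (b := 9) (by norm_num) (p := 2 * t) (by linarith) (by linarith)
    have vA : σ'.mem (s + t) = 2 ^ (10 * L + 16) * fA (s + t) := by
      rw [hmem _ (by linarith)]
      exact_mod_cast hfA (s + t) (by omega)
    have vC : σ'.mem (2 * 2 ^ L + (s + 2 * H + t)) = 2 ^ (10 * L + 16) * fC (s + 2 * H + t) := by
      rw [hmem _ (by linarith)]
      exact_mod_cast hfC (s + 2 * H + t) (by omega)
    have vB : σ'.mem (2 ^ L + (s + H + (2 * H - 1 - t))) =
        2 ^ (10 * L + 16) * fB (s + H + (2 * H - 1 - t)) := by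
      rw [hmem _ (by linarith), ← hfB (s + H + (2 * H - 1 - t)) (by omega)]
      congr 2
      push_cast [Nat.cast_sub (show t ≤ 2 * H - 1 by omega), Nat.cast_sub (show 1 ≤ 2 * H by omega)]
      ring
    have hdiv : (2 * H : ℤ) / 2 = H := by omega
    simp only [Nat.cast_ofNat, Nat.cast_zero, Nat.cast_one, zero_mul, one_mul, zero_add]
      at c0 c1 c2 c5 c7 c9
    have h2w : (2 : ℤ) < 2 ^ w := by
      calc (2 : ℤ) = 2 ^ 1 := by norm_num
        _ < _ := pow_lt_pow_right₀ (by norm_num) (by omega)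
    refine (wp_of_vc ?_).mono (t' := 72) (by simp [Com.size]) (fun σ' _ h => h)
    simp only [Com.vc, Ex.ok_var, Ex.ok_lit, Ex.ok_cell, Ex.ok_ld, Ex.ok_add, Ex.ok_sub, Ex.ok_mul,
      Ex.ok_div, Ex.eval_cell, Ex.eval_var, Ex.eval_lit, Ex.eval_ld, Ex.eval_add, Ex.eval_sub,
      Ex.eval_mul, Ex.eval_div, St.set_reg, reduceCtorEq, if_false, if_true,
      St.put_reg, St.set_mem, true_and, and_true, hKr, htr, hhr, hsr', hdiv, Nat.cast_ofNat,
      Nat.cast_zero, Nat.cast_one, zero_mul, one_mul, zero_add, c0, c1, c2, c5, c7, c9,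
      St.put_mem, vA, vB, vC]
    refine ⟨⟨⟨by linarith, by linarith⟩, by norm_num, h2w⟩, fun a ha => ?_, fun i hi => ?_⟩
    · rw [if_neg (by intro h; linarith), if_neg (by intro h; linarith),
        if_neg (by intro h; linarith)]
      exact hmem a ha
    · have hiz : (i : ℤ) < 2 * (2 * H) := by exact_mod_cast hi
      have hi0 : (0 : ℤ) ≤ i := Int.natCast_nonneg i
      obtain ⟨h5, h6, h7, h8, h9, h10⟩ := hI i hi
      have hsh : ∀ f : ℕ → ℤ, shifted f (t + 1) i = if i = t + 1 then f t else shifted f t i := by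
        intro f
        simp only [shifted]
        by_cases hit : i = t + 1
        · subst hit; simp
        · rw [if_neg hit]
          congr 1
          simp only [eq_iff_iff]
          omega
      refine ⟨?_, ?_, ?_, ?_, ?_, ?_⟩
      · rw [if_neg (by intro h; linarith), if_neg (by intro h; linarith), hsh, h5]
        by_cases hit : i = t + 1
        · subst hit; simp
        · rw [if_neg hit, if_neg (by omega)]
      · rw [if_neg (by intro h; linarith), if_neg (by intro h; linarith),
          if_neg (by intro h; linarith), h6]
      · rw [if_neg (by intro h; linarith), hsh, h7]
        by_cases hit : i = t + 1
        · subst hit; simp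
        · rw [if_neg hit, if_neg (by omega), if_neg (by intro h; linarith)]
      · rw [if_neg (by intro h; linarith), if_neg (by intro h; linarith),
          if_neg (by intro h; linarith), h8]
      · by_cases hit : i = 2 * t
        · subst hit
          simp [spread]
        · rw [if_neg (by omega), if_neg (by intro h; linarith), if_neg (by intro h; linarith), h9]
          by_cases hlt : i < 2 * t
          · rw [if_pos hlt, if_pos (by omega)]
          · rw [if_neg hlt]
            split_ifs with h
            · rw [spread, if_neg (by omega), mul_zero]
            · rfl
      · rw [if_neg (by intro h; linarith), if_neg (by intro h; linarith),
          if_neg (by intro h; linarith), h10]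
  · rintro σ' - - ⟨hmem, hI⟩
    refine ⟨hmem, fun i hi => ?_⟩
    have := hI i hi
    rwa [if_pos hi] at this

/-- Error of a transform. -/
noncomputable def transformError (L : ℕ) : ℝ := 4 ^ L * tableError L

theorem transformError_eq (L : ℕ) : transformError L = 2 ^ (8 * L + 11) := by
  rw [transformError, tableError, show (4 : ℝ) = 2 ^ 2 by norm_num, ← pow_mul, ← pow_add]
  congr 1; ring

/-- All values have norm at most `K`. With `E` the error of a transform, the first product is off by
at most `4 * K * E` and the triple product by at most `11 * K ^ 2 * E`; summation adds these bounds.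
-/
theorem product_spec (hw : 24 * L + 45 ≤ w) (hM : 11 * 2 ^ L ≤ M) (hσ : Scaled L σ) {n : ℕ}
    (hn : n ≤ 2 ^ L) (hN : σ.reg .N = n) {z₁ z₂ z₃ : ℕ → ℂ} (hz₁ : ∀ j, ‖z₁ j‖ ≤ 2 ^ L)
    (hz₂ : ∀ j, ‖z₂ j‖ ≤ 2 ^ L) (hz₃ : ∀ j, ‖z₃ j‖ ≤ 2 ^ L)
    (h₁ : ∀ j < n, Approx (2 ^ (10 * L + 16)) (transformError L) (σ.mem (5 * 2 ^ L + (j : ℕ)))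
      (σ.mem (6 * 2 ^ L + (j : ℕ))) (z₁ j))
    (h₂ : ∀ j < n, Approx (2 ^ (10 * L + 16)) (transformError L) (σ.mem (7 * 2 ^ L + (j : ℕ)))
      (σ.mem (8 * 2 ^ L + (j : ℕ))) (z₂ j))
    (h₃ : ∀ j < n, Approx (2 ^ (10 * L + 16)) (transformError L) (σ.mem (9 * 2 ^ L + (j : ℕ)))
      (σ.mem (10 * 2 ^ L + (j : ℕ))) (z₃ j)) :
    Wp w M inp product (n * 110 + 8) (fun σ' => σ'.mem = σ.mem ∧
      |(σ'.reg .acc : ℝ) - ((2 ^ (10 * L + 16) : ℤ) : ℝ) *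
        (∑ j ∈ Finset.range n, z₁ j * z₂ j * z₃ j).re| ≤
        n * (11 * (2 ^ L * 2 ^ L * transformError L))) σ := by
  have hnz : (n : ℤ) ≤ 2 ^ L := by exact_mod_cast hn
  have hS0 : (0 : ℤ) < 2 ^ (10 * L + 16) := by positivity
  have hS0' : (0 : ℝ) < 2 ^ (10 * L + 16) := by positivity
  have hK1 := one_le_two_pow_real L
  have hE2 : 2 ≤ transformError L := by
    rw [transformError_eq]
    calc (2 : ℝ) = 2 ^ 1 := by norm_num
      _ ≤ _ := pow_le_pow_right₀ (by norm_num) (by omega)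
  have hES : 4 * transformError L ≤ 2 ^ (10 * L + 16) := by
    rw [transformError_eq, show (4 : ℝ) = 2 ^ 2 by norm_num, ← pow_add]
    exact pow_le_pow_right₀ (by norm_num) (by omega)
  refine (Wp.mono (Wp.seq (wp_of_vc (c := .assign .acc 0) ?_) (t₂ := n * 110 + 6))
    (t := 2 + (n * 110 + 6)) (by omega) (fun σ' _ h => h))
  simp only [Com.vc, Ex.ok_lit, true_and, Ex.eval_lit, Nat.cast_zero]
  refine (wp_loop (t := 102) n (fun j σ' => σ'.mem = σ.mem ∧
      |(σ'.reg .acc : ℝ) - ((2 ^ (10 * L + 16) : ℤ) : ℝ) *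
        (∑ i ∈ Finset.range j, z₁ i * z₂ i * z₃ i).re| ≤
        j * (11 * (2 ^ L * 2 ^ L * transformError L))) (by simp [hN]) (by linarith [size_lt hw])
      (by decide) rfl rfl (by simp) ?_ (fun σ' _ _ h => h))
  rintro j hj σ' hfr hjr ⟨hmem, hI⟩
  have hjz : (j : ℤ) < n := by exact_mod_cast hj
  have hsc : Scaled L σ' := hσ.congr ((hfr .K rfl (by decide)).trans (by simp))
    ((hfr .S rfl (by decide)).trans (by simp)) ((hfr .Q rfl (by decide)).trans (by simp))
  have hc : ∀ {b : ℕ}, b ≤ 10 → 0 ≤ (b : ℤ) * 2 ^ L + j ∧ (b : ℤ) * 2 ^ L + j < M :=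
    fun hb => cell_mem hM hb (Int.natCast_nonneg j) (by linarith)
  have c5 := hc (b := 5) (by norm_num)
  have c6 := hc (b := 6) (by norm_num)
  have c7 := hc (b := 7) (by norm_num)
  have c8 := hc (b := 8) (by norm_num)
  have c9 := hc (b := 9) (by norm_num)
  have c10 := hc (b := 10) (by norm_num)
  simp only [Nat.cast_ofNat] at c5 c6 c7 c8 c9 c10
  have hb1 := hz₁ j
  have hb2 := hz₂ j
  have hb3 := hz₃ j
  have hm1 := (h₁ j hj).mul hS0 (h₂ j hj)
  have hmax := maxProd_real L
  rw [pow_one] at hmax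
  generalize hEdef : transformError L = E at *
  have hE0 : 0 ≤ E := by linarith
  have hb12 : ‖z₁ j * z₂ j‖ ≤ 2 ^ L * 2 ^ L := by
    rw [norm_mul]; exact mul_le_mul hb1 hb2 (norm_nonneg _) (by positivity)
  have hKE : E ≤ 2 ^ L * E := le_mul_of_one_le_left hE0 hK1
  have hKKE : 2 ^ L * E ≤ 2 ^ L * (2 ^ L * E) := mul_le_mul_of_nonneg_left hKE (by positivity)
  have hm1' := hm1.mono (E' := 4 * (2 ^ L * E)) (by
    push_cast
    have e1 : ‖z₁ j‖ * E ≤ 2 ^ L * E := mul_le_mul_of_nonneg_right hb1 hE0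
    have e2 : ‖z₂ j‖ * E ≤ 2 ^ L * E := mul_le_mul_of_nonneg_right hb2 hE0
    have e3 : E * E / 2 ^ (10 * L + 16) ≤ E := by
      rw [div_le_iff₀ hS0']; exact mul_le_mul_of_nonneg_left (by linarith) hE0
    linarith)
  have hd1 := (h₁ j hj).abs_mul_le hS0 (h₂ j hj) (D := maxProd L) (by
    rw [hmax]
    push_cast
    have e1 : (2 : ℝ) ^ (10 * L + 16) * ‖z₁ j‖ ≤ 2 ^ (10 * L + 16) * 2 ^ L :=
      mul_le_mul_of_nonneg_left hb1 hS0'.le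
    have e2 : (2 : ℝ) ^ (10 * L + 16) * ‖z₂ j‖ ≤ 2 ^ (10 * L + 16) * 2 ^ L :=
      mul_le_mul_of_nonneg_left hb2 hS0'.le
    have e3 : E ≤ 2 ^ (10 * L + 16) * 2 ^ L := by
      linarith [le_mul_of_one_le_right hS0'.le hK1]
    have e4 : ((2 : ℝ) ^ L) ^ 2 ≤ (2 ^ L) ^ 3 := pow_le_pow_right₀ hK1 (by norm_num)
    calc _ ≤ ((2 : ℝ) ^ (10 * L + 16) * 2 ^ L + 2 ^ (10 * L + 16) * 2 ^ L) *
          (2 ^ (10 * L + 16) * 2 ^ L + 2 ^ (10 * L + 16) * 2 ^ L) := by gcongr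
      _ = 4 * 2 ^ (10 * L + 16) * 2 ^ (10 * L + 16) * (2 ^ L) ^ 2 := by ring
      _ ≤ _ := mul_le_mul_of_nonneg_left e4 (by positivity))
  have hm2 := (hm1'.mul hS0 (h₃ j hj)).mono (E' := 11 * (2 ^ L * 2 ^ L * E)) (by
    push_cast
    have e1 : ‖z₁ j * z₂ j‖ * E ≤ 2 ^ L * 2 ^ L * E := mul_le_mul_of_nonneg_right hb12 hE0
    have e2 : ‖z₃ j‖ * (4 * (2 ^ L * E)) ≤ 2 ^ L * (4 * (2 ^ L * E)) :=
      mul_le_mul_of_nonneg_right hb3 (by positivity)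
    have e3 : 4 * (2 ^ L * E) * E / 2 ^ (10 * L + 16) ≤ 4 * (2 ^ L * E) := by
      rw [div_le_iff₀ hS0']; exact mul_le_mul_of_nonneg_left (by linarith) (by positivity)
    linarith)
  -- The bound `(2 * S * K ^ 2) * (2 * S * K)` is exactly `maxProd L`: this multiplication dictates
  -- the offset `Q = 4 * S * K ^ 3`.
  have hd2 := hm1'.abs_mul_le hS0 (h₃ j hj) (D := maxProd L) (by
    rw [hmax]
    push_cast
    have e1 : (2 : ℝ) ^ (10 * L + 16) * ‖z₁ j * z₂ j‖ ≤ 2 ^ (10 * L + 16) * (2 ^ L * 2 ^ L) :=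
      mul_le_mul_of_nonneg_left hb12 hS0'.le
    have e2 : (2 : ℝ) ^ (10 * L + 16) * ‖z₃ j‖ ≤ 2 ^ (10 * L + 16) * 2 ^ L :=
      mul_le_mul_of_nonneg_left hb3 hS0'.le
    have e3 : E ≤ 2 ^ (10 * L + 16) * 2 ^ L := by
      linarith [le_mul_of_one_le_right hS0'.le hK1]
    have e4 : 4 * (2 ^ L * E) ≤ 2 ^ (10 * L + 16) * (2 ^ L * 2 ^ L) := by
      calc 4 * (2 ^ L * E) = (4 * E) * 2 ^ L := by ring
        _ ≤ 2 ^ (10 * L + 16) * 2 ^ L := mul_le_mul_of_nonneg_right hES (by positivity)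
        _ ≤ _ := mul_le_mul_of_nonneg_left (le_mul_of_one_le_left (by positivity) hK1) hS0'.le
    calc _ ≤ ((2 : ℝ) ^ (10 * L + 16) * (2 ^ L * 2 ^ L) + 2 ^ (10 * L + 16) * (2 ^ L * 2 ^ L)) *
          (2 ^ (10 * L + 16) * 2 ^ L + 2 ^ (10 * L + 16) * 2 ^ L) := by gcongr
      _ = _ := by ring)
  have hre := hm2.abs_re_sub_le
  refine (wp_of_vc ?_).mono (t' := 102) (by simp [Com.size, Ex.mulRe, Ex.mulIm]) (fun σ' _ h => h)
  rw [← hmem] at hd1 hd2 hre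
  simp only [Com.vc, Ex.mulRe, Ex.mulIm, Ex.ok_add, Ex.ok_mul, Ex.ok_sub,
    Ex.ok_var, Ex.ok_ld, Ex.ok_cell, Ex.ok_fdiv, Ex.eval_cell, Ex.eval_var,
    Ex.eval_add, Ex.eval_mul, Ex.eval_sub, Ex.eval_ld, Ex.eval_fdiv, St.set_reg, St.set_mem,
    reduceCtorEq, if_true, if_false, true_and, hsc.K, hsc.S, hsc.Q, fdiv_eq,
    hjr, Nat.cast_ofNat, c5, c6, c7, c8, c9, c10, fdivOk hw hd1.1, fdivOk hw hd1.2,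
    fdivOk hw hd2.1, and_self]
  refine ⟨hmem, ?_⟩
  rw [Finset.sum_range_succ, Complex.add_re]
  push_cast at hre hI ⊢
  rw [abs_le] at *
  constructor <;> linarith [hI.1, hI.2, hre.1, hre.2]

end

end WordRAM

/-! ### Blocks, levels and the total count. -/

namespace WordRAM

open FourierCount Com

open Var in
/-- Add the rounded quotient of `acc` to `ans` and go on to the next block. -/
def accumulate : Com :=
  .seq (.assign ans (ans + (acc + h * S) / (N * S))) (.assign s (s + N))

/-- Add to `ans` the triples of the block at `s` whose ends lie in different halves of it. -/
def block : Com :=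
  .seq clear <|
  .seq fill <|
  .seq (transform 5) <|
  .seq (transform 7) <|
  .seq (transform 9) <|
  .seq product accumulate

open Var in
/-- All blocks of size `2 h`; then `h` is doubled. -/
def level : Com :=
  .seq (.assign N (h + h)) <|
  .seq (.assign nb (K / N)) <|
  .seq (.assign lg (r + 2)) <|
  .seq (.assign s 0) <|
  .seq (loop b nb block) <|
  .assign h N

open Var in
/-- Count the triples in `ans`. -/
def levels : Com :=
  .seq (.assign ans 0) <|
  .seq (.assign h 2) <|
  loop r l level

section

variable {α : Type*} {w M L : ℕ} {inp : List α} {σ : St}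

theorem norm_sum_root_le {f : ℕ → ℤ} (hf : ∀ i, |f i| ≤ 1) {r : ℕ} (hr : r ≤ L) (j : ℕ) :
    ‖∑ i ∈ Finset.range (2 ^ r), (f i : ℂ) * root j ^ i‖ ≤ 2 ^ L := by
  have h := norm_residue_le (f := fun i => (f i : ℂ)) (fun i => by
    rw [Complex.norm_intCast]; exact_mod_cast hf i) 1 r j 0
  simp only [residue, zero_add, one_mul] at h
  exact h.trans (pow_le_pow_right₀ (by norm_num) hr)

theorem sum_product_transforms (fA fB fC : ℕ → ℤ) (s r : ℕ) :
    ∑ j ∈ Finset.range (2 ^ (r + 2)),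
      (∑ i ∈ Finset.range (2 ^ (r + 2)),
        (shifted (fun a => fA (s + a)) (2 ^ (r + 1)) i : ℂ) * root j ^ i) *
      (∑ i ∈ Finset.range (2 ^ (r + 2)),
        (shifted (fun c => fC (s + 2 ^ (r + 1) + c)) (2 ^ (r + 1)) i : ℂ) * root j ^ i) *
      (∑ i ∈ Finset.range (2 ^ (r + 2)),
        (spread (fun u => fB (s + 2 ^ r + (2 ^ (r + 1) - 1 - u))) i : ℂ) * root j ^ i) =
    2 ^ (r + 2) * (crossSum (triple fA fB fC) s (2 ^ (r + 1)) : ℂ) := by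
  have h2 : 2 ^ (r + 2) = 2 * 2 ^ (r + 1) := pow_succ' 2 (r + 1)
  have := sum_transforms (fun a => fA (s + a)) (fun c => fC (s + 2 ^ (r + 1) + c))
    (fun u => fB (s + 2 ^ r + (2 ^ (r + 1) - 1 - u))) (r + 1)
  rw [crossSum_triple, ← this]
  refine Finset.sum_congr rfl fun j _ => ?_
  rw [h2, sum_shifted _ (by positivity), sum_shifted _ (by positivity), sum_spread]

/-- These a priori bounds keep the dividend of the final rounding within a word. -/
theorem crossSum_triple_mem {fA fB fC : ℕ → ℤ} (hA : ∀ i, 0 ≤ fA i ∧ fA i ≤ 1)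
    (hB : ∀ i, 0 ≤ fB i ∧ fB i ≤ 1) (hC : ∀ i, 0 ≤ fC i ∧ fC i ≤ 1) (s h : ℕ) :
    0 ≤ crossSum (triple fA fB fC) s h ∧ crossSum (triple fA fB fC) s h ≤ h * h := by
  have key : ∀ a c, 0 ≤ triple fA fB fC a c ∧ triple fA fB fC a c ≤ 1 := by
    intro a c
    rw [triple]
    have h1 := hA a
    have h2 := hC c
    have h3 := hB ((a + c) / 2)
    have h12 : fA a * fC c ≤ 1 := mul_le_one₀ h1.2 h2.1 h2.2
    have h12' : 0 ≤ fA a * fC c := mul_nonneg h1.1 h2.1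
    split_ifs
    · exact ⟨mul_nonneg h12' h3.1, mul_le_one₀ h12 h3.1 h3.2⟩
    · simp
  constructor
  · exact Finset.sum_nonneg fun a _ => Finset.sum_nonneg fun c _ => (key _ _).1
  · calc _ ≤ ∑ a ∈ Finset.range h, ∑ c ∈ Finset.range h, (1 : ℤ) :=
        Finset.sum_le_sum fun a _ => Finset.sum_le_sum fun c _ => (key _ _).2
      _ = _ := by simp

/-- Adding half of the divisor turns the floor into rounding to the nearest integer. -/
theorem rounded_div {S h acc V : ℤ} (hS : 0 < S) (hh : 0 < h)
    (hacc : |acc - S * (2 * h * V)| < h * S) : (acc + h * S) / (2 * h * S) = V := by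
  have h1 := abs_lt.1 hacc
  have hp : 0 < 2 * h * S := by positivity
  rw [Int.ediv_eq_iff_of_pos hp]
  constructor <;> nlinarith [h1.1, h1.2]

theorem shifted_abs_le {f : ℕ → ℤ} (hf : ∀ i, |f i| ≤ 1) (h i : ℕ) : |shifted f h i| ≤ 1 := by
  rw [shifted]; split_ifs
  · exact hf _
  · simp

theorem spread_abs_le {f : ℕ → ℤ} (hf : ∀ i, |f i| ≤ 1) (i : ℕ) : |spread f i| ≤ 1 := by
  rw [spread]; split_ifs
  · exact hf _
  · simp

/-- Here `S = 32 * K ^ 2 * transformError L`, and the claim comes down to `22 < 32`. This inequality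
fixes the size of the scale. -/
theorem product_error_lt (L r : ℕ) :
    (2 ^ (r + 2) : ℝ) * (11 * (2 ^ L * 2 ^ L * transformError L)) <
      2 ^ (r + 1) * 2 ^ (10 * L + 16) := by
  rw [transformError_eq]
  have : (2 : ℝ) ^ (10 * L + 16) = 2 ^ L * 2 ^ L * 2 ^ (8 * L + 11) * 32 := by
    rw [show 10 * L + 16 = L + L + (8 * L + 11) + 5 by ring, pow_add, pow_add, pow_add]
    norm_num
  rw [this, pow_succ _ (r + 1)]
  have hp : (0 : ℝ) < 2 ^ (r + 1) * (2 ^ L * 2 ^ L * 2 ^ (8 * L + 11)) := by positivity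
  linarith

theorem accumulate_spec (hw : 24 * L + 45 ≤ w) (hσ : Scaled L σ) {r : ℕ} (hL : r + 2 ≤ L) {V : ℤ}
    (hbound : |σ.reg .acc - 2 ^ (10 * L + 16) * (2 * 2 ^ (r + 1) * V)| <
      2 ^ (r + 1) * 2 ^ (10 * L + 16))
    (hV2 : 0 ≤ V ∧ V ≤ (2 ^ (r + 1) : ℕ) * (2 ^ (r + 1) : ℕ))
    (hh : σ.reg .h = 2 ^ (r + 1)) (hN : σ.reg .N = 2 ^ (r + 2)) :
    Wp w M inp accumulate 16 (fun σ' => σ'.mem = σ.mem ∧ σ'.reg .ans = σ.reg .ans + V ∧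
      σ'.reg .s = σ.reg .s + 2 ^ (r + 2)) σ := by
  have hK0 : (0 : ℤ) < 2 ^ L := by positivity
  have hS0 : (0 : ℤ) < 2 ^ (10 * L + 16) := by positivity
  have hdiv := rounded_div hS0 (by positivity) hbound
  have hb := abs_lt.1 hbound
  have hh1 : (1 : ℤ) ≤ 2 ^ (r + 1) := one_le_pow₀ (by norm_num)
  have hhK : (2 : ℤ) * 2 ^ (r + 1) ≤ 2 ^ L := by
    rw [← pow_succ']; exact pow_le_pow_right₀ (by norm_num) hL
  have hVnn : 0 ≤ (2 : ℤ) ^ (10 * L + 16) * (2 * 2 ^ (r + 1) * V) :=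
    mul_nonneg hS0.le (mul_nonneg (by positivity) hV2.1)
  have hKw : (2 : ℤ) ^ (10 * L + 16) * (2 ^ L * 2 ^ L * 2 ^ L * 4) < 2 ^ w := by
    have : (2 : ℤ) ^ (10 * L + 16) * (2 ^ L * 2 ^ L * 2 ^ L * 4) = 2 ^ (13 * L + 18) := by ring
    rw [this]
    exact pow_lt_pow_right₀ (by norm_num) (by omega)
  have hacc0 : 0 ≤ σ.reg .acc + 2 ^ (r + 1) * 2 ^ (10 * L + 16) := by linarith [hb.1]
  have hVle : (2 : ℤ) * 2 ^ (r + 1) * V ≤ 2 ^ L * 2 ^ L * 2 ^ L := by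
    have : V ≤ 2 ^ L * 2 ^ L := by
      refine hV2.2.trans ?_
      push_cast
      exact mul_le_mul (by linarith) (by linarith) (by positivity) hK0.le
    calc _ ≤ 2 ^ L * (2 ^ L * 2 ^ L) := mul_le_mul hhK this hV2.1 hK0.le
      _ = _ := by ring
  have hK3 : (2 : ℤ) ^ L ≤ 2 ^ L * 2 ^ L * 2 ^ L := by
    have h1 : (1 : ℤ) ≤ 2 ^ L := one_le_pow₀ (by norm_num)
    nlinarith
  have hNS : (2 : ℤ) * 2 ^ (r + 1) * 2 ^ (10 * L + 16) < 2 ^ w := by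
    refine lt_of_le_of_lt ?_ hKw
    rw [mul_comm]
    exact mul_le_mul_of_nonneg_left (by linarith) hS0.le
  have haccw : σ.reg .acc + 2 ^ (r + 1) * 2 ^ (10 * L + 16) < 2 ^ w := by
    refine lt_of_le_of_lt ?_ hKw
    have e1 := mul_le_mul_of_nonneg_left hVle hS0.le
    have e2 : 2 ^ (r + 1) * (2 : ℤ) ^ (10 * L + 16) ≤ (2 ^ L * 2 ^ L * 2 ^ L) * 2 ^ (10 * L + 16) :=
      mul_le_mul_of_nonneg_right (by linarith) hS0.le
    linarith [hb.2]
  have hN' : σ.reg .N = 2 * 2 ^ (r + 1) := by rw [hN, pow_succ' 2 (r + 1)]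
  refine (wp_of_vc ?_).mono (t' := 16) (by simp [accumulate, Com.size]) (fun σ' _ h => h)
  simp only [Com.vc, accumulate, Ex.ok_var, Ex.ok_add, Ex.ok_mul, Ex.ok_div, Ex.eval_var,
    Ex.eval_add, Ex.eval_mul, Ex.eval_div, St.set_reg, St.set_mem, reduceCtorEq, if_true, if_false,
    true_and, and_true, hh, hN', hσ.S, hdiv, hacc0, haccw, hNS]
  exact ⟨by positivity, by rw [pow_succ' _ (r + 1)]⟩

theorem block_spec (hw : 24 * L + 45 ≤ w) (hM : 11 * 2 ^ L ≤ M) (hσ : Scaled L σ) {r s : ℕ}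
    (hL : r + 2 ≤ L) (hs : s + 2 ^ (r + 2) ≤ 2 ^ L) (hh : σ.reg .h = 2 ^ (r + 1))
    (hN : σ.reg .N = 2 ^ (r + 2)) (hlg : σ.reg .lg = r + 2) (hsr : σ.reg .s = s)
    {fA fB fC : ℕ → ℤ} (hA : ∀ i, 0 ≤ fA i ∧ fA i ≤ 1) (hB : ∀ i, 0 ≤ fB i ∧ fB i ≤ 1)
    (hC : ∀ i, 0 ≤ fC i ∧ fC i ≤ 1)
    (htab : ∀ j < 2 ^ (r + 1), Approx (2 ^ (10 * L + 16)) (tableError L)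
      (σ.mem (3 * 2 ^ L + (j : ℕ))) (σ.mem (4 * 2 ^ L + (j : ℕ))) (twiddle j))
    (hfA : ∀ q < 2 ^ L, σ.mem ((q : ℕ) : ℤ) = 2 ^ (10 * L + 16) * fA q)
    (hfB : ∀ q < 2 ^ L, σ.mem (2 ^ L + (q : ℕ)) = 2 ^ (10 * L + 16) * fB q)
    (hfC : ∀ q < 2 ^ L, σ.mem (2 * 2 ^ L + (q : ℕ)) = 2 ^ (10 * L + 16) * fC q) :
    Wp w M inp block (2 ^ (r + 1) * (462 * L + 460)) (fun σ' =>
      (∀ a : ℤ, a < 5 * 2 ^ L → σ'.mem a = σ.mem a) ∧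
      σ'.reg .ans = σ.reg .ans + crossSum (triple fA fB fC) s (2 ^ (r + 1)) ∧
      σ'.reg .s = s + 2 ^ (r + 2)) σ := by
  have hK0 : (0 : ℤ) < 2 ^ L := by positivity
  have hjK : ∀ j : ℕ, j < 2 ^ (r + 2) → (j : ℤ) < 2 ^ L := fun j hj => by
    exact_mod_cast hj.trans_le (Nat.pow_le_pow_right (by norm_num) hL)
  have hj1 : ∀ j : ℕ, j < 2 ^ (r + 1) → j < 2 ^ (r + 2) := fun j hj =>
    hj.trans_le (Nat.pow_le_pow_right (by norm_num) (by omega))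
  have h4 : 2 * (2 * 2 ^ r) = 2 ^ (r + 2) := by rw [← pow_succ', ← pow_succ']
  have h2 : 2 * 2 ^ r = 2 ^ (r + 1) := by rw [← pow_succ']
  have habs : ∀ {f : ℕ → ℤ}, (∀ i, 0 ≤ f i ∧ f i ≤ 1) → ∀ i, |f i| ≤ 1 := fun hf i => by
    rw [abs_le]; constructor <;> linarith [(hf i).1, (hf i).2]
  set F₁ := shifted (fun a => fA (s + a)) (2 ^ (r + 1)) with hF₁
  set F₂ := shifted (fun c => fC (s + 2 ^ (r + 1) + c)) (2 ^ (r + 1)) with hF₂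
  set F₃ := spread (fun u => fB (s + 2 ^ r + (2 ^ (r + 1) - 1 - u))) with hF₃
  have hF₁1 : ∀ i, |F₁ i| ≤ 1 := shifted_abs_le (fun i => habs hA _) _
  have hF₂1 : ∀ i, |F₂ i| ≤ 1 := shifted_abs_le (fun i => habs hC _) _
  have hF₃1 : ∀ i, |F₃ i| ≤ 1 := spread_abs_le (fun i => habs hB _)
  set T := (r + 2) * (2 ^ (r + 1) * 136 + 18) + 8 with hT
  refine Wp.mono (t := (2 ^ (r + 2) * 50 + 6) + ((2 * 2 ^ r * 80 + 6) + (T + (T + (T +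
    ((2 ^ (r + 2) * 110 + 8) + 16)))))) ?_ ?_ (fun _ _ h => h)
  rotate_left
  -- With `h = 2 ^ (r + 1)`, the three transforms give `3 * (136 + 18) = 462` per `h * L`;
  -- everything else is at most `400 * h + 60`.
  · have h1 : (r + 2) * (2 ^ (r + 1) * 136 + 18) ≤ L * (2 ^ (r + 1) * 136 + 18) :=
      Nat.mul_le_mul_right _ hL
    have h3 : 1 ≤ 2 ^ (r + 1) := Nat.one_le_two_pow
    have h5 : L ≤ 2 ^ (r + 1) * L := Nat.le_mul_of_pos_left _ (by omega)
    rw [hT, h2, pow_succ' 2 (r + 1)]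
    nlinarith
  refine Wp.seq ((clear_spec hw hM hσ (n := 2 ^ (r + 2))
    (Nat.pow_le_pow_right (by norm_num) hL) (by rw [hN]; push_cast; rfl)).mono le_rfl ?_)
  rintro σ₁ fr₁ ⟨m₁, z₁⟩
  have sc₁ : Scaled L σ₁ := hσ.congr (fr₁ _ rfl) (fr₁ _ rfl) (fr₁ _ rfl)
  refine Wp.seq ((fill_spec hw hM sc₁ (H := 2 ^ r) (s := s) (by positivity) (by rw [h4]; exact hs)
    (by rw [fr₁ _ rfl, hh, h2]; push_cast; rfl) (by rw [fr₁ _ rfl, hsr])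
    (fA := fA) (fB := fB) (fC := fC)
    (fun q hq => ?_) (fun q hq => ?_) (fun q hq => ?_)
    (fun A hA hA' i hi => z₁ A hA hA' i (by rwa [h4] at hi))).mono le_rfl ?_)
  · rw [m₁ _ ?_, hfA q hq]
    have : (q : ℤ) < 2 ^ L := by exact_mod_cast hq
    linarith
  · rw [m₁ _ ?_, hfB q hq]
    have : (q : ℤ) < 2 ^ L := by exact_mod_cast hq
    linarith
  · rw [m₁ _ ?_, hfC q hq]
    have : (q : ℤ) < 2 ^ L := by exact_mod_cast hq
    linarith
  rintro σ₂ fr₂ ⟨m₂, z₂⟩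
  rw [h4, h2] at z₂
  have sc₂ : Scaled L σ₂ := sc₁.congr (fr₂ _ rfl) (fr₂ _ rfl) (fr₂ _ rfl)
  have tab₂ : ∀ j < 2 ^ (r + 1), Approx (2 ^ (10 * L + 16)) (tableError L)
      (σ₂.mem (3 * 2 ^ L + (j : ℕ))) (σ₂.mem (4 * 2 ^ L + (j : ℕ))) (twiddle j) := by
    intro j hj
    have := hjK j (hj1 j hj)
    rw [m₂ _ (by linarith), m₂ _ (by linarith), m₁ _ (by linarith), m₁ _ (by linarith)]
    exact htab j hj
  refine Wp.seq ((transform_spec hw hM sc₂ (A := 5) (r := r + 1) (f := F₁) le_rfl (by norm_num) hL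
    (by rw [fr₂ _ rfl, fr₁ _ rfl, hh])
    (by rw [fr₂ _ rfl, fr₁ _ rfl, hlg]; push_cast; ring) hF₁1 tab₂
    (fun i hi => ?_)).mono le_rfl ?_)
  · have := z₂ i hi
    exact ⟨by exact_mod_cast this.1, by norm_num; exact this.2.1⟩
  rintro σ₃ fr₃ ⟨m₃, z₃⟩
  simp only [Nat.cast_ofNat] at m₃ z₃
  norm_num only at m₃ z₃
  have sc₃ : Scaled L σ₃ := sc₂.congr (fr₃ _ rfl) (fr₃ _ rfl) (fr₃ _ rfl)
  have tab₃ : ∀ j < 2 ^ (r + 1), Approx (2 ^ (10 * L + 16)) (tableError L)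
      (σ₃.mem (3 * 2 ^ L + (j : ℕ))) (σ₃.mem (4 * 2 ^ L + (j : ℕ))) (twiddle j) := by
    intro j hj
    have := hjK j (hj1 j hj)
    rw [m₃ _ (Or.inl (by linarith)), m₃ _ (Or.inl (by linarith))]
    exact tab₂ j hj
  refine Wp.seq ((transform_spec hw hM sc₃ (A := 7) (r := r + 1) (f := F₂) (by norm_num)
    (by norm_num) hL (by rw [fr₃ _ rfl, fr₂ _ rfl, fr₁ _ rfl, hh])
    (by rw [fr₃ _ rfl, fr₂ _ rfl, fr₁ _ rfl, hlg]; push_cast; ring) hF₂1 tab₃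
    (fun i hi => ?_)).mono le_rfl ?_)
  · have := z₂ i hi
    have hi0 : (0 : ℤ) ≤ i := Int.natCast_nonneg i
    norm_num only [Nat.cast_ofNat]
    rw [m₃ _ (Or.inr (by linarith)), m₃ _ (Or.inr (by linarith))]
    exact ⟨this.2.2.1, this.2.2.2.1⟩
  rintro σ₄ fr₄ ⟨m₄, z₄⟩
  simp only [Nat.cast_ofNat] at m₄ z₄
  norm_num only at m₄ z₄
  have sc₄ : Scaled L σ₄ := sc₃.congr (fr₄ _ rfl) (fr₄ _ rfl) (fr₄ _ rfl)
  have tab₄ : ∀ j < 2 ^ (r + 1), Approx (2 ^ (10 * L + 16)) (tableError L)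
      (σ₄.mem (3 * 2 ^ L + (j : ℕ))) (σ₄.mem (4 * 2 ^ L + (j : ℕ))) (twiddle j) := by
    intro j hj
    have := hjK j (hj1 j hj)
    rw [m₄ _ (Or.inl (by linarith)), m₄ _ (Or.inl (by linarith))]
    exact tab₃ j hj
  refine Wp.seq ((transform_spec hw hM sc₄ (A := 9) (r := r + 1) (f := F₃) (by norm_num)
    (by norm_num) hL (by rw [fr₄ _ rfl, fr₃ _ rfl, fr₂ _ rfl, fr₁ _ rfl, hh])
    (by rw [fr₄ _ rfl, fr₃ _ rfl, fr₂ _ rfl, fr₁ _ rfl, hlg]; push_cast; ring) hF₃1 tab₄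
    (fun i hi => ?_)).mono le_rfl ?_)
  · have := z₂ i hi
    have hi0 : (0 : ℤ) ≤ i := Int.natCast_nonneg i
    norm_num only [Nat.cast_ofNat]
    rw [m₄ _ (Or.inr (by linarith)), m₄ _ (Or.inr (by linarith)),
      m₃ _ (Or.inr (by linarith)), m₃ _ (Or.inr (by linarith))]
    exact ⟨this.2.2.2.2.1, this.2.2.2.2.2⟩
  rintro σ₅ fr₅ ⟨m₅, z₅⟩
  simp only [Nat.cast_ofNat] at m₅ z₅
  norm_num only at m₅ z₅
  have sc₅ : Scaled L σ₅ := sc₄.congr (fr₅ _ rfl) (fr₅ _ rfl) (fr₅ _ rfl)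
  refine Wp.seq ((product_spec hw hM sc₅ (n := 2 ^ (r + 2))
    (Nat.pow_le_pow_right (by norm_num) hL)
    (by rw [fr₅ _ rfl, fr₄ _ rfl, fr₃ _ rfl, fr₂ _ rfl, fr₁ _ rfl, hN]; push_cast; rfl)
    (norm_sum_root_le hF₁1 hL) (norm_sum_root_le hF₂1 hL) (norm_sum_root_le hF₃1 hL)
    (fun j hj => ?_) (fun j hj => ?_) (fun j hj => z₅ j hj)).mono le_rfl ?_)
  · have := hjK j hj
    rw [m₅ _ (Or.inl (by linarith)), m₅ _ (Or.inl (by linarith)), m₄ _ (Or.inl (by linarith)),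
      m₄ _ (Or.inl (by linarith))]
    exact z₃ j hj
  · have := hjK j hj
    rw [m₅ _ (Or.inl (by linarith)), m₅ _ (Or.inl (by linarith))]
    exact z₄ j hj
  rintro σ₆ fr₆ ⟨m₆, hacc⟩
  have sc₆ : Scaled L σ₆ := sc₅.congr (fr₆ _ rfl) (fr₆ _ rfl) (fr₆ _ rfl)
  have hall : ∀ v : Var, clear.writes v = false → fill.writes v = false →
      (transform 5).writes v = false → (transform 7).writes v = false →
      (transform 9).writes v = false → product.writes v = false → σ₆.reg v = σ.reg v :=
    fun v v1 v2 v3 v4 v5 v6 => by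
      rw [fr₆ _ v6, fr₅ _ v5, fr₄ _ v4, fr₃ _ v3, fr₂ _ v2, fr₁ _ v1]
  rw [hF₁, hF₂, hF₃, sum_product_transforms] at hacc
  set V := crossSum (triple fA fB fC) s (2 ^ (r + 1)) with hV
  have hV2 := crossSum_triple_mem hA hB hC s (2 ^ (r + 1))
  rw [← hV] at hV2
  have hbound : |σ₆.reg .acc - 2 ^ (10 * L + 16) * (2 * 2 ^ (r + 1) * V)| <
      2 ^ (r + 1) * 2 ^ (10 * L + 16) := by
    have hre : ((2 : ℂ) ^ (r + 2) * (V : ℂ)).re = 2 * 2 ^ (r + 1) * V := by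
      have : (2 : ℂ) ^ (r + 2) * (V : ℂ) = ((2 * 2 ^ (r + 1) * V : ℝ) : ℂ) := by
        push_cast; ring
      rw [this, Complex.ofReal_re]
    rw [hre] at hacc
    have := lt_of_le_of_lt hacc (by push_cast; exact product_error_lt L r)
    exact_mod_cast this
  refine (accumulate_spec hw sc₆ hL hbound hV2 ((hall _ rfl rfl rfl rfl rfl rfl).trans hh)
    ((hall _ rfl rfl rfl rfl rfl rfl).trans hN)).mono le_rfl ?_
  rintro σ' - ⟨hm, ha, hs'⟩
  refine ⟨fun a ha => ?_, ?_, ?_⟩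
  · rw [hm, m₆, m₅ _ (Or.inl (by linarith)), m₄ _ (Or.inl (by linarith)),
      m₃ _ (Or.inl (by linarith)), m₂ _ ha, m₁ _ ha]
  · rw [ha, hall _ rfl rfl rfl rfl rfl rfl]
  · rw [hs', hall _ rfl rfl rfl rfl rfl rfl, hsr]

/-- The table of twiddle factors and the three sequences are in memory. -/
structure Loaded (L : ℕ) (fA fB fC : ℕ → ℤ) (σ : St) : Prop where
  scaled : Scaled L σ
  table : ∀ r, r + 2 ≤ L → ∀ j < 2 ^ (r + 1), Approx (2 ^ (10 * L + 16)) (tableError L)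
    (σ.mem (3 * 2 ^ L + (j : ℕ))) (σ.mem (4 * 2 ^ L + (j : ℕ))) (twiddle j)
  fst : ∀ q < 2 ^ L, σ.mem ((q : ℕ) : ℤ) = 2 ^ (10 * L + 16) * fA q
  snd : ∀ q < 2 ^ L, σ.mem (2 ^ L + (q : ℕ)) = 2 ^ (10 * L + 16) * fB q
  trd : ∀ q < 2 ^ L, σ.mem (2 * 2 ^ L + (q : ℕ)) = 2 ^ (10 * L + 16) * fC q

theorem Loaded.congr {fA fB fC : ℕ → ℤ} {σ' : St} (h : Loaded L fA fB fC σ)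
    (hs : Scaled L σ') (hm : ∀ a : ℤ, a < 5 * 2 ^ L → σ'.mem a = σ.mem a) :
    Loaded L fA fB fC σ' := by
  have hq : ∀ q : ℕ, q < 2 ^ L → (q : ℤ) < 2 ^ L := fun q hq => by exact_mod_cast hq
  have hK0 : (0 : ℤ) < 2 ^ L := by positivity
  refine ⟨hs, fun r hr j hj => ?_, fun q hlt => ?_, fun q hlt => ?_, fun q hlt => ?_⟩
  · have := hq j (hj.trans_le (Nat.pow_le_pow_right (by norm_num) (by omega)))
    rw [hm _ (by linarith), hm _ (by linarith)]
    exact h.table r hr j hj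
  · have := hq q hlt
    rw [hm _ (by linarith), h.fst q hlt]
  · have := hq q hlt
    rw [hm _ (by linarith), h.snd q hlt]
  · have := hq q hlt
    rw [hm _ (by linarith), h.trd q hlt]

theorem level_spec (hw : 24 * L + 45 ≤ w) (hM : 11 * 2 ^ L ≤ M) {fA fB fC : ℕ → ℤ}
    (hσ : Loaded L fA fB fC σ) {r : ℕ} (hL : r + 2 ≤ L) (hr : σ.reg .r = r)
    (hh : σ.reg .h = 2 ^ (r + 1)) (hA : ∀ i, 0 ≤ fA i ∧ fA i ≤ 1)
    (hB : ∀ i, 0 ≤ fB i ∧ fB i ≤ 1) (hC : ∀ i, 0 ≤ fC i ∧ fC i ≤ 1) :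
    Wp w M inp level (2 ^ L * (231 * L + 234) + 22) (fun σ' =>
      Loaded L fA fB fC σ' ∧ σ'.reg .h = 2 ^ (r + 2) ∧
      σ'.reg .ans = σ.reg .ans + ∑ i ∈ Finset.range (2 ^ (L - (r + 2))),
        crossSum (triple fA fB fC) (i * (2 * 2 ^ (r + 1))) (2 ^ (r + 1))) σ := by
  have hsplit : 2 ^ (L - (r + 2)) * 2 ^ (r + 2) = 2 ^ L := by
    rw [← pow_add]; congr 1; omega
  have hB' : 2 ^ (L - (r + 2)) * 2 ^ (r + 1) * 2 = 2 ^ L := by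
    rw [← hsplit, pow_succ 2 (r + 1), mul_assoc]
  have hNw : (2 : ℤ) ^ (r + 2) < 2 ^ w := pow_lt_pow_right₀ (by norm_num) (by omega)
  have hKw := size_lt hw
  have hN : (2 : ℤ) ^ (r + 1) + 2 ^ (r + 1) = 2 ^ (r + 2) := by rw [pow_succ 2 (r + 1)]; ring
  have hdiv : (2 : ℤ) ^ L / 2 ^ (r + 2) = 2 ^ (L - (r + 2)) := by
    rw [show (2 : ℤ) ^ L = 2 ^ (L - (r + 2)) * 2 ^ (r + 2) by exact_mod_cast hsplit.symm]
    exact Int.mul_ediv_cancel _ (by positivity)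
  refine Wp.mono (t := 4 + (4 + (4 + (2 + ((2 ^ (L - (r + 2)) *
    (2 ^ (r + 1) * (462 * L + 460) + 8) + 6) + 2))))) ?_ ?_ (fun _ _ h => h)
  rotate_left
  -- The number of blocks times half a block is `K / 2`, independently of the level; the loop
  -- overhead of 8 per block is at most `4 * K`.
  · have h1 : 1 ≤ 2 ^ (r + 1) := Nat.one_le_two_pow
    have h3 : 2 ^ (L - (r + 2)) ≤ 2 ^ (L - (r + 2)) * 2 ^ (r + 1) := Nat.le_mul_of_pos_right _ h1
    generalize hb : 2 ^ (L - (r + 2)) = b at *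
    have h5 : b * (2 ^ (r + 1) * (462 * L + 460) + 8) =
      b * 2 ^ (r + 1) * 2 * (231 * L + 230) + 8 * b := by ring
    rw [h5, hB']
    have h6 : 2 ^ L * (231 * L + 234) = 2 ^ L * (231 * L + 230) + 2 ^ L * 4 := by ring
    omega
  refine Wp.seq (wp_of_vc ?_)
  refine ⟨by simp, Wp.seq (wp_of_vc ?_)⟩
  refine ⟨?_, Wp.seq (wp_of_vc ?_)⟩
  · simp [hσ.scaled.K, hh, hN, hNw, hKw]
  refine ⟨by simp, Wp.seq (wp_of_vc ?_)⟩
  refine ⟨by simp, Wp.seq ?_⟩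
  refine (wp_loop (t := 2 ^ (r + 1) * (462 * L + 460)) (2 ^ (L - (r + 2))) (fun i σ' =>
    (∀ a : ℤ, a < 5 * 2 ^ L → σ'.mem a = σ.mem a) ∧
    σ'.reg .s = (i * 2 ^ (r + 2) : ℕ) ∧
    σ'.reg .ans = σ.reg .ans + ∑ i ∈ Finset.range i,
      crossSum (triple fA fB fC) (i * (2 * 2 ^ (r + 1))) (2 ^ (r + 1)))
    (by simp [hσ.scaled.K, hh, hN, hdiv]) ?_ (by decide) rfl rfl (by simp) ?_ ?_)
  · push_cast
    exact pow_lt_pow_right₀ (by norm_num) (by omega)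
  · rintro i hi σ' hfr - ⟨hm, hs, hans⟩
    have hfr' : ∀ v : Var, block.writes v = false → v ≠ .b → v ≠ .N → v ≠ .nb → v ≠ .lg → v ≠ .s →
        σ'.reg v = σ.reg v := fun v h1 h2 h3 h4 h5 h6 => by
      rw [hfr v h1 h2]; simp [h3, h4, h5, h6]
    have hld : Loaded L fA fB fC σ' := hσ.congr (hσ.scaled.congr
      (hfr' _ rfl (by decide) (by decide) (by decide) (by decide) (by decide))
      (hfr' _ rfl (by decide) (by decide) (by decide) (by decide) (by decide))
      (hfr' _ rfl (by decide) (by decide) (by decide) (by decide) (by decide))) hm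
    refine (block_spec hw hM hld.scaled hL (s := i * 2 ^ (r + 2)) ?_ ?_ ?_ ?_ hs hA hB hC
      (hld.table r hL) hld.fst hld.snd hld.trd).mono le_rfl ?_
    · rw [← hsplit, ← Nat.succ_mul]
      exact Nat.mul_le_mul_right _ hi
    · rw [hfr' _ rfl (by decide) (by decide) (by decide) (by decide) (by decide), hh]
    · rw [hfr _ rfl (by decide)]; simp [hh, hN]
    · rw [hfr _ rfl (by decide)]; simp [hr]
    · rintro σ'' - ⟨hm', hans', hs'⟩
      refine ⟨fun a ha => ?_, ?_, ?_⟩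
      · rw [St.set_mem, hm' a ha, hm a ha]
      · simp only [St.set_reg, reduceCtorEq, if_false, hs']
        push_cast; ring
      · simp only [St.set_reg, reduceCtorEq, if_false, hans', hans, Finset.sum_range_succ,
          add_assoc, ← pow_succ']
  · rintro σ' hfr - ⟨hm, -, hans⟩
    have hfr' : ∀ v : Var, block.writes v = false → v ≠ .b → v ≠ .N → v ≠ .nb → v ≠ .lg → v ≠ .s →
        σ'.reg v = σ.reg v := fun v h1 h2 h3 h4 h5 h6 => by
      rw [hfr v h1 h2]; simp [h3, h4, h5, h6]
    refine wp_of_vc ⟨by simp, hσ.congr (hσ.scaled.congr ?_ ?_ ?_) hm, ?_, ?_⟩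
    · exact hfr' _ rfl (by decide) (by decide) (by decide) (by decide) (by decide)
    · exact hfr' _ rfl (by decide) (by decide) (by decide) (by decide) (by decide)
    · exact hfr' _ rfl (by decide) (by decide) (by decide) (by decide) (by decide)
    · simp [hfr .N rfl (by decide), hh, hN]
    · simpa using hans

/-- Before round `r`, `ans` counts the triples inside blocks of size `2 ^ (r + 1)`. It starts at 0
because blocks of size 2 hold none, and after `L - 1` rounds one block covers everything. -/
theorem levels_spec (hw : 24 * L + 45 ≤ w) (hM : 11 * 2 ^ L ≤ M) {fA fB fC : ℕ → ℤ}
    (hσ : Loaded L fA fB fC σ) {l : ℕ} (hl : L = l + 1) (hlr : σ.reg .l = l)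
    (hA : ∀ i, 0 ≤ fA i ∧ fA i ≤ 1)
    (hB : ∀ i, 0 ≤ fB i ∧ fB i ≤ 1) (hC : ∀ i, 0 ≤ fC i ∧ fC i ≤ 1) :
    Wp w M inp levels (l * (2 ^ L * (231 * L + 234) + 30) + 10) (fun σ' =>
      σ'.reg .ans = pairSum (triple fA fB fC) 0 (2 ^ L)) σ := by
  refine Wp.mono (t := 2 + (2 + (l * ((2 ^ L * (231 * L + 234) + 22) + 8) + 6))) ?_
    (by ring_nf; rfl) (fun _ _ h => h)
  refine Wp.seq (wp_of_vc ⟨by simp, Wp.seq (wp_of_vc ⟨by simp, ?_⟩)⟩)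
  have hlw : (l : ℤ) < 2 ^ w := by
    have : l < 2 ^ w := lt_of_le_of_lt (by omega) (Nat.lt_two_pow_self (n := w))
    exact_mod_cast this
  refine wp_loop l (fun r σ' => Loaded L fA fB fC σ' ∧ σ'.reg .h = 2 ^ (r + 1) ∧
    σ'.reg .ans = ∑ i ∈ Finset.range (2 ^ (L - (r + 1))),
      pairSum (triple fA fB fC) (i * 2 ^ (r + 1)) (2 ^ (r + 1))) (by simp [hlr]) hlw (by decide)
    rfl rfl ?_ ?_ ?_
  · refine ⟨hσ.congr (hσ.scaled.congr ?_ ?_ ?_) (fun _ _ => rfl), by simp, ?_⟩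
    · simp
    · simp
    · simp
    · simp [pairSum_triple_two]
  · rintro r hr σ' hfr hrr ⟨hld, hh, hans⟩
    refine (level_spec hw hM hld (by omega) hrr hh hA hB hC).mono le_rfl ?_
    rintro σ'' - ⟨hld', hh', hans'⟩
    refine ⟨hld'.congr (hld'.scaled.congr (by simp) (by simp) (by simp)) (fun _ _ => rfl),
      by simp [hh'], ?_⟩
    have e : 2 * 2 ^ (L - (r + 2)) = 2 ^ (L - (r + 1)) := by
      rw [← pow_succ']; congr 1; omega
    have := sum_pairSum_succ (triple fA fB fC) (r + 1) (2 ^ (L - (r + 2)))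
    rw [e] at this
    simp only [St.set_reg, reduceCtorEq, if_false]
    rw [hans', hans]
    exact this.symm
  · rintro σ' - - ⟨-, -, hans⟩
    rw [hans, ← hl]
    simp

end

end WordRAM

/-! ### Parameters and indicator sequences from the input. -/

namespace WordRAM

open FourierCount Com

open Var in
/-- Compute the least power `2 ^ l` above `n`, and set `K` to twice that power. -/
def sizing : Com :=
  .seq (.assign K 2) <|
  .seq (.assign l 0) <|
  loop i n <|
  .ifc (.lt K (2 * i + 3)) <|
  .seq (.assign K (K * 2)) (.assign l (l + 1))

open Var in
/-- Compute the scale, the offset of divisions, and the number of bits of square roots. -/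
def constants : Com :=
  .seq (.assign S (K * K * K * K * K * (K * K * K * K * K) * 65536)) <|
  .seq (.assign Q (4 * S * (K * K * K))) <|
  .assign cnt (10 * l + 27)

open Var in
/-- Store the positions of the three characters of the pattern in the arrays `0`, `1`, `2`. -/
def indicators : Com :=
  loop i n <|
  .seq (.ifc (.charEq i n) (.store (.cell 0 i) S)) <|
  .seq (.ifc (.charEq i (n + 1)) (.store (.cell 1 i) S)) <|
  .ifc (.charEq i (n + 2)) (.store (.cell 2 i) S)

/-- The counting program. -/
def counting : Com :=
  .seq sizing <| .seq constants <| .seq indicators <| .seq table <| .seq levels <|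
  .assign .n Var.ans

section

variable {α : Type*} {w M L : ℕ} {inp : List α} {σ : St}

/-- As `k < 2 ^ l`, the test succeeds only for `2 ^ l = k + 1`, so one doubling is enough and never
overshoots. The upper bound on `2 ^ l` makes the memory linear. -/
theorem sizing_spec {n : ℕ} (hn : σ.reg .n = n) (hw : (4 * n + 3 : ℤ) < 2 ^ w) :
    Wp w M inp sizing (n * 24 + 10) (fun σ' => σ'.mem = σ.mem ∧ ∃ l : ℕ,
      σ'.reg .K = 2 ^ (l + 1) ∧ σ'.reg .l = l ∧ n < 2 ^ l ∧ 2 ^ l ≤ 2 * n + 1) σ := by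
  refine Wp.mono (t := 2 + (2 + (n * (16 + 8) + 6))) ?_ (by omega) (fun _ _ h => h)
  refine Wp.seq (wp_of_vc ⟨by simp, Wp.seq (wp_of_vc ⟨by simp, ?_⟩)⟩)
  refine wp_loop n (fun k σ' => σ'.mem = σ.mem ∧ ∃ l : ℕ,
      σ'.reg .K = 2 ^ (l + 1) ∧ σ'.reg .l = l ∧ k < 2 ^ l ∧ 2 ^ l ≤ 2 * k + 1) (by simp [hn])
    (by linarith [Int.natCast_nonneg n]) (by decide) rfl rfl ⟨rfl, 0, by simp⟩ ?_
    (fun σ' _ _ h => h)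
  rintro k hk σ' - hk' ⟨hm, l, hK, hl, h1, h2⟩
  have hkz : (k : ℤ) < n := by exact_mod_cast hk
  have h2z : (2 : ℤ) ^ l ≤ 2 * k + 1 := by exact_mod_cast h2
  have hpow : (2 : ℤ) ^ (l + 1) = 2 * 2 ^ l := pow_succ' 2 l
  have hpow' : 2 ^ (l + 1) = 2 * 2 ^ l := pow_succ' 2 l
  have hpos : (0 : ℤ) < 2 ^ l := by positivity
  refine (wp_of_vc ?_).mono (t' := 16) (by simp [Com.size, Cond.size, Cond.fst, Cond.snd])
    (fun σ' _ h => h)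
  simp only [Com.vc, Cond.Ok, Cond.Holds, Ex.ok_var, Ex.ok_lit, Ex.ok_add, Ex.ok_mul, Ex.eval_var,
    Ex.eval_lit, Ex.eval_add, Ex.eval_mul, St.set_reg, St.set_mem, reduceCtorEq, if_true, if_false,
    true_and, and_true, hK, hl, hk', hm]
  push_cast
  refine ⟨⟨⟨by positivity, by linarith⟩, by positivity, by linarith⟩, fun h => ?_, fun h => ?_⟩
  · refine ⟨l + 1, by rw [pow_succ 2 (l + 1)], by push_cast; rfl, ?_, ?_⟩
    · omega
    · have : 2 ^ (l + 1) < 2 * k + 3 := by exact_mod_cast h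
      omega
  · have : ¬ 2 ^ (l + 1) < 2 * k + 3 := by exact_mod_cast h
    exact ⟨l, rfl, rfl, by omega, by omega⟩

theorem constants_spec {l : ℕ} (hL : L = l + 1) (hK : σ.reg .K = 2 ^ L) (hl : σ.reg .l = l) :
    Wp w M inp constants 40 (fun σ' => σ'.mem = σ.mem ∧ Scaled L σ' ∧
      σ'.reg .cnt = 10 * L + 17) σ := by
  refine (wp_of_vc ?_).mono (t' := 40) (by simp [constants, Com.size]) (fun σ' _ h => h)
  simp only [constants, Com.vc, Ex.ok_var, Ex.ok_lit, Ex.ok_add, Ex.ok_mul, Ex.eval_var,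
    Ex.eval_lit, Ex.eval_add, Ex.eval_mul, St.set_reg, St.set_mem, reduceCtorEq, if_true, if_false,
    true_and, hK, hl]
  have hS : (2 : ℤ) ^ L * 2 ^ L * 2 ^ L * 2 ^ L * 2 ^ L * (2 ^ L * 2 ^ L * 2 ^ L * 2 ^ L * 2 ^ L) *
      ((65536 : ℕ) : ℤ) = 2 ^ (10 * L + 16) := by
    push_cast; ring
  rw [hS]
  refine ⟨⟨by simp [hK], by simp, ?_⟩, by rw [hL]; push_cast; ring⟩
  simp only [St.set_reg, reduceCtorEq, if_true, if_false]
  push_cast; ring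

/-- The pattern follows the text in the input, so its character `x` has number `T.length + x`.
Progress is measured lexicographically by position, then by pattern character. -/
theorem mark_spec [DecidableEq α] (hM : 11 * 2 ^ L ≤ M) {T P : List α}
    (hP : P.length = 3) (hT : T.length ≤ 2 ^ L) (hw : (T.length + 3 : ℤ) < 2 ^ w) {k : ℕ}
    (hk : k < T.length) (hK : σ.reg .K = 2 ^ L) (hS : σ.reg .S = 2 ^ (10 * L + 16))
    (hi : σ.reg .i = k) {x : ℕ} (hx : x < 3) {e : Ex} (hok : e.Ok w M σ)
    (hev : e.eval σ = T.length + x)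
    (hJ : ∀ y < 3, ∀ q < 2 ^ L, σ.mem ((y : ℕ) * 2 ^ L + (q : ℕ)) =
      if q < k ∨ (q = k ∧ y < x) then 2 ^ (10 * L + 16) * indicator T P y q else 0) :
    Wp w M (T ++ P) (.ifc (.charEq Var.i e) (.store (.cell x Var.i) Var.S)) (e.size + 10)
      (fun σ' => (∀ v, σ'.reg v = σ.reg v) ∧ ∀ y < 3, ∀ q < 2 ^ L,
        σ'.mem ((y : ℕ) * 2 ^ L + (q : ℕ)) =
          if q < k ∨ (q = k ∧ y < x + 1) then 2 ^ (10 * L + 16) * indicator T P y q else 0)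
      σ := by
  have hTz : (T.length : ℤ) ≤ 2 ^ L := by exact_mod_cast hT
  have hkz : (k : ℤ) < T.length := by exact_mod_cast hk
  have hk0 : (0 : ℤ) ≤ k := Int.natCast_nonneg k
  have hcx := cell_mem hM (b := x) (by omega) hk0 (by linarith)
  have hxz : (x : ℤ) < 3 := by exact_mod_cast hx
  have hx0 : (0 : ℤ) ≤ x := Int.natCast_nonneg x
  have hchar : ((T ++ P)[k]? = (T ++ P)[T.length + x]?) ↔ T[k]? = P[x]? := by
    rw [List.getElem?_append_left hk, List.getElem?_append_right (Nat.le_add_right _ _),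
      Nat.add_sub_cancel_left]
  have hto : ((T.length : ℤ) + x).toNat = T.length + x := by
    rw [← Nat.cast_add, Int.toNat_natCast]
  have b1 : (k : ℤ) < 2 ^ w := by linarith
  have b2 : 0 ≤ (T.length : ℤ) + x := by linarith
  have b3 : (T.length : ℤ) + x < 2 ^ w := by linarith
  have b4 : (k : ℤ) < T.length + 3 := by linarith
  have b5 : (T.length : ℤ) + x < T.length + 3 := by linarith
  have hneg : T[k]? ≠ P[x]? → ∀ y : ℕ, y < 3 → ∀ q < 2 ^ L, σ.mem ((y : ℕ) * 2 ^ L + (q : ℕ)) =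
      if q < k ∨ (q = k ∧ y < x + 1) then 2 ^ (10 * L + 16) * indicator T P y q else 0 := by
    intro h y hy q hq
    rw [hJ y hy q hq]
    clear hJ
    by_cases hyx : y = x ∧ q = k
    · obtain ⟨rfl, rfl⟩ := hyx
      simp [indicator, h]
    · congr 1
      simp only [eq_iff_iff]
      omega
  have hpos : T[k]? = P[x]? → ∀ y : ℕ, y < 3 → ∀ q < 2 ^ L,
      (if (y : ℤ) * 2 ^ L + (q : ℕ) = x * 2 ^ L + k then 2 ^ (10 * L + 16)
        else σ.mem ((y : ℕ) * 2 ^ L + (q : ℕ))) =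
      if q < k ∨ (q = k ∧ y < x + 1) then 2 ^ (10 * L + 16) * indicator T P y q else 0 := by
    intro h y hy q hq
    rw [hJ y hy q hq]
    clear hJ hneg
    have hqz : (q : ℤ) < 2 ^ L := by exact_mod_cast hq
    have hq0 : (0 : ℤ) ≤ q := Int.natCast_nonneg q
    by_cases hyx : y = x
    · subst hyx
      by_cases hqk : q = k
      · subst hqk; simp [indicator, h]
      · simp [hqk]
    · rw [if_neg]
      · congr 1
        simp only [eq_iff_iff]
        omega
      · intro he
        rcases lt_or_gt_of_ne hyx with hlt | hlt
        · have : (y : ℤ) + 1 ≤ x := by exact_mod_cast hlt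
          nlinarith
        · have : (x : ℤ) + 1 ≤ y := by exact_mod_cast hlt
          nlinarith
  refine (wp_of_vc ?_).mono (t' := e.size + 10) ?_ (fun σ' _ h => h)
  · simp only [Com.vc, Cond.Ok, Cond.Holds, Ex.ok_var, Ex.ok_cell, Ex.eval_cell, Ex.eval_var,
      hK, hS, hi, hok, hev, true_and, hto, Int.toNat_natCast, hchar, hcx, and_self,
      List.length_append, hP, St.put_reg, implies_true, St.put_mem]
    push_cast
    exact ⟨⟨⟨⟨hk0, b1⟩, b2, b3⟩, b4, b5⟩, hpos, hneg⟩
  · simp only [Com.size, Cond.size, Cond.fst, Cond.snd, Ex.size_var, Ex.size_cell]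
    omega

theorem indicators_spec [DecidableEq α] (hM : 11 * 2 ^ L ≤ M) (hσ : Scaled L σ) {T P : List α}
    (hP : P.length = 3) (hn : σ.reg .n = T.length) (hT : T.length ≤ 2 ^ L)
    (hw : (T.length + 3 : ℤ) < 2 ^ w) (hmem : ∀ a, σ.mem a = 0) :
    Wp w M (T ++ P) indicators (T.length * 50 + 6) (fun σ' =>
      ∀ x < 3, ∀ q < 2 ^ L, σ'.mem ((x : ℕ) * 2 ^ L + (q : ℕ)) =
        2 ^ (10 * L + 16) * indicator T P x q) σ := by
  have hTz : (T.length : ℤ) ≤ 2 ^ L := by exact_mod_cast hT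
  have hK0 : (0 : ℤ) < 2 ^ L := by positivity
  refine wp_loop (t := 42) T.length (fun k σ' => ∀ x < 3, ∀ q < 2 ^ L,
      σ'.mem ((x : ℕ) * 2 ^ L + (q : ℕ)) =
        if q < k then 2 ^ (10 * L + 16) * indicator T P x q else 0) hn
    (by linarith) (by decide) rfl rfl ?_ ?_ ?_
  · intro x _ q _
    simp [hmem]
  · intro k hk σ' hfr hk' hI
    have hkz : (k : ℤ) < T.length := by exact_mod_cast hk
    have hk0 : (0 : ℤ) ≤ k := Int.natCast_nonneg k
    have hKr : σ'.reg .K = 2 ^ L := (hfr .K rfl (by decide)).trans hσ.K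
    have hSr : σ'.reg .S = 2 ^ (10 * L + 16) := (hfr .S rfl (by decide)).trans hσ.S
    have hnr : σ'.reg .n = T.length := (hfr .n rfl (by decide)).trans hn
    refine Wp.mono (t := 11 + (13 + 13)) ?_ (by omega) (fun _ _ h => h)
    refine Wp.seq ((mark_spec hM hP hT hw hk hKr hSr hk' (x := 0) (by norm_num) (e := Var.n) (by simp)
      (by simp [hnr]) ?_).mono
      le_rfl ?_)
    · intro y hy q hq
      simpa using hI y hy q hq
    rintro σ₁ - ⟨hr₁, hJ₁⟩
    refine Wp.seq ((mark_spec hM hP hT hw hk (by rw [hr₁, hKr]) (by rw [hr₁, hSr]) (by rw [hr₁, hk'])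
      (x := 1) (by norm_num) (e := Var.n + 1) (by simp) (by simp [hr₁, hnr]) hJ₁).mono le_rfl ?_)
    rintro σ₂ - ⟨hr₂, hJ₂⟩
    refine (mark_spec hM hP hT hw hk (by rw [hr₂, hr₁, hKr]) (by rw [hr₂, hr₁, hSr])
      (by rw [hr₂, hr₁, hk']) (x := 2) (by norm_num) (e := Var.n + 2) (by simp)
      (by simp [hr₂, hr₁, hnr]) hJ₂).mono le_rfl ?_
    rintro σ₃ - ⟨-, hJ₃⟩ x hx q hq
    rw [St.set_mem, hJ₃ x hx q hq]
    congr 1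
    simp only [eq_iff_iff]
    omega
  · intro σ' _ _ hI x hx q hq
    rw [hI x hx q hq]
    split_ifs with h
    · rfl
    · rw [indicator, if_neg, mul_zero]
      rw [List.getElem?_eq_none (by omega), List.getElem?_eq_getElem (by omega)]
      simp

end

end WordRAM

/-! ### The complete program and its asymptotic bounds. -/

namespace WordRAM

open FourierCount Com

theorem indicator_mem {α : Type*} [DecidableEq α] (T P : List α) (x i : ℕ) :
    0 ≤ indicator T P x i ∧ indicator T P x i ≤ 1 := by
  rw [indicator]; split_ifs <;> simp

theorem counting_time_le {n l b : ℕ} (h1 : 2 ^ (l + 1) ≤ 4 * n + 2) (h2 : l ≤ b + 1) :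
    40 + ((n * 50 + 6) + ((l * (2 ^ (l + 1) * 70 + 560 * (l + 1) + 1100) + 40) +
      ((l * (2 ^ (l + 1) * (231 * (l + 1) + 234) + 30) + 10) + 2))) ≤
    5900 * ((n + 1) * (b + 2) ^ 2) := by
  set m := n + 1 with hm
  set c := b + 2 with hc
  have hlc : l + 1 ≤ c := by omega
  have hK : 2 ^ (l + 1) ≤ 4 * m := by omega
  have hl2 : l + 1 ≤ 2 ^ (l + 1) := Nat.lt_two_pow_self.le
  have hc1 : 1 ≤ c := by omega
  have hcc : c ≤ c ^ 2 := Nat.le_self_pow (by norm_num) c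
  have hmc : m ≤ m * c ^ 2 := Nat.le_mul_of_pos_right _ (by positivity)
  have e1 : l * (2 ^ (l + 1) * 70 + 560 * (l + 1) + 1100) ≤ c * (4 * m * 70 + 560 * (4 * m) +
      1100 * m) := by
    refine Nat.mul_le_mul (by omega) ?_
    omega
  have e2 : l * (2 ^ (l + 1) * (231 * (l + 1) + 234) + 30) ≤
      c * (4 * m * (231 * c + 234 * c) + 30 * m) := by
    refine Nat.mul_le_mul (by omega) (Nat.add_le_add (Nat.mul_le_mul hK ?_) ?_)
    · omega
    · omega
  have e3 : m * c ≤ m * c ^ 2 := Nat.mul_le_mul_left _ hcc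
  have e4 : c * (4 * m * 70 + 560 * (4 * m) + 1100 * m) = 3620 * (m * c) := by ring
  have e5 : c * (4 * m * (231 * c + 234 * c) + 30 * m) = 1860 * (m * c ^ 2) + 30 * (m * c) := by
    ring
  omega

theorem counting_spec {α : Type*} [DecidableEq α] {w : ℕ} {T P : List α}
    (hP : P.length = 3) (hw : 100 * (Nat.log 2 T.length + 1) ≤ w) {σ : St}
    (hn : σ.reg .n = T.length) (hmem : ∀ a, σ.mem a = 0) :
    Wp w (11 * (4 * T.length + 2)) (T ++ P) counting
      (6000 * ((T.length + 1) * (Nat.log 2 T.length + 2) ^ 2))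
      (fun σ' => σ'.reg .n = (equidistantOccurrences T P).card) σ := by
  set n := T.length with hnT
  set b := Nat.log 2 n with hb
  have hnb : n < 2 ^ (b + 1) := Nat.lt_pow_succ_log_self (by norm_num) n
  have hnw : 4 * n + 3 < 2 ^ w := by
    calc 4 * n + 3 < 4 * 2 ^ (b + 1) := by omega
      _ = 2 ^ (b + 3) := by ring
      _ ≤ 2 ^ w := Nat.pow_le_pow_right (by norm_num) (by omega)
  have hnwz : (4 * n + 3 : ℤ) < 2 ^ w := by exact_mod_cast hnw
  have hX : n + 1 ≤ (n + 1) * (b + 2) ^ 2 := Nat.le_mul_of_pos_right _ (by positivity)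
  refine Wp.mono (t := (n * 24 + 10) + 5900 * ((n + 1) * (b + 2) ^ 2)) ?_ (by omega)
    (fun _ _ h => h)
  refine Wp.seq ((sizing_spec hn hnwz).mono le_rfl ?_)
  rintro σ₁ fr₁ ⟨m₁, l, hK, hl, h1, h2⟩
  -- For `l > 0` the bound `2 ^ l ≤ 2 * n + 1` gives `2 ^ (l - 1) ≤ n`; for `l = 0` the truncated
  -- exponent would be useless.
  have hlb : l ≤ b + 1 := by
    rcases Nat.eq_zero_or_pos l with rfl | hl0
    · omega
    · have hle : 2 ^ (l - 1) ≤ n := by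
        have : 2 ^ l = 2 * 2 ^ (l - 1) := by rw [← pow_succ']; congr 1; omega
        omega
      have := Nat.le_log_of_pow_le (b := 2) (by norm_num) hle
      omega
  have hpow : 2 ^ (l + 1) = 2 * 2 ^ l := pow_succ' 2 l
  refine Wp.mono (Wp.seq ((constants_spec rfl hK hl).mono le_rfl ?_))
    (counting_time_le (n := n) (l := l) (by omega) hlb) (fun _ _ h => h)
  rintro σ₂ fr₂ ⟨m₂, sc₂, hcnt⟩
  -- Since `l + 1 ≤ b + 2`, at most `24 * b + 93` bits are needed; this is where the constant 100
  -- comes from.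
  have hL : 24 * (l + 1) + 45 ≤ w := by omega
  have hM : 11 * 2 ^ (l + 1) ≤ 11 * (4 * n + 2) := by omega
  have hnK : n ≤ 2 ^ (l + 1) := by omega
  refine Wp.seq ((indicators_spec hM sc₂ hP (by rw [fr₂ _ rfl, fr₁ _ rfl, hn]) hnK (by
    rw [← hnT]; linarith [Int.natCast_nonneg n]) (by simp [m₁, m₂, hmem])).mono le_rfl ?_)
  rintro σ₃ fr₃ hind
  have sc₃ : Scaled (l + 1) σ₃ := sc₂.congr (fr₃ _ rfl) (fr₃ _ rfl) (fr₃ _ rfl)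
  have hl₃ : σ₃.reg .l = l := by rw [fr₃ _ rfl, fr₂ _ rfl, hl]
  refine Wp.seq ((table_spec hL hM sc₃ rfl hl₃ (by rw [fr₃ _ rfl, hcnt])).mono le_rfl ?_)
  rintro σ₄ fr₄ ⟨m₄, htab⟩
  have hK0 : (0 : ℤ) < 2 ^ (l + 1) := by positivity
  have hld : Loaded (l + 1) (indicator T P 0) (indicator T P 1) (indicator T P 2) σ₄ := by
    refine ⟨sc₃.congr (fr₄ _ rfl) (fr₄ _ rfl) (fr₄ _ rfl), fun r hr j hj => htab j ?_,
      fun q hq => ?_, fun q hq => ?_, fun q hq => ?_⟩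
    · exact hj.trans_le (Nat.pow_le_pow_right (by norm_num) (by omega))
    all_goals have hqz : (q : ℤ) < 2 ^ (l + 1) := by exact_mod_cast hq
    · rw [m₄ _ (Or.inl (by linarith))]
      simpa using hind 0 (by norm_num) q hq
    · rw [m₄ _ (Or.inl (by linarith))]
      simpa using hind 1 (by norm_num) q hq
    · rw [m₄ _ (Or.inl (by linarith))]
      simpa using hind 2 (by norm_num) q hq
  refine Wp.seq ((levels_spec hL hM hld rfl (by rw [fr₄ _ rfl, hl₃]) (indicator_mem T P 0)
    (indicator_mem T P 1) (indicator_mem T P 2)).mono le_rfl ?_)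
  rintro σ₅ - hans
  refine wp_of_vc ⟨trivial, ?_⟩
  change (σ₅.set .n (σ₅.reg .ans)).reg .n = _
  rw [St.set_reg, if_pos rfl, hans]
  exact (card_equidistantOccurrences T P hP hnK).symm

theorem counting_computes {α : Type*} [LinearOrder α] {w : ℕ} {T P : List α}
    (hP : P.length = 3) (hw : 100 * (Nat.log 2 T.length + 1) ≤ w) :
    Computes (counting.compile 0 ++ [.halt]) w T P
      (6000 * ((T.length + 1) * (Nat.log 2 T.length + 2) ^ 2)) (11 * (4 * T.length + 2))
      (equidistantOccurrences T P).card := by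
  have hnb : T.length < 2 ^ (Nat.log 2 T.length + 1) :=
    Nat.lt_pow_succ_log_self (by norm_num) T.length
  have hnw : 44 * T.length + 22 < 2 ^ w := by
    have hb1 : 1 ≤ 2 ^ (Nat.log 2 T.length) := Nat.one_le_two_pow
    calc 44 * T.length + 22 < 128 * 2 ^ (Nat.log 2 T.length + 1) := by omega
      _ = 2 ^ (Nat.log 2 T.length + 8) := by ring
      _ ≤ 2 ^ w := Nat.pow_le_pow_right (by norm_num) (by omega)
  -- The machine holds the result modulo `2 ^ w` only; the count is at most `n ^ 2`, hence equal to
  -- its residue.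
  have hcard : (equidistantOccurrences T P).card < 2 ^ w := by
    have h1 : (equidistantOccurrences T P).card ≤ T.length * T.length := by
      refine (Finset.card_filter_le _ _).trans ?_
      rw [Finset.card_product, Nat.card_Icc, Nat.card_Icc]
      refine Nat.mul_le_mul (by omega) ?_
      have := Nat.div_le_self (T.length - 1) (P.length - 1)
      omega
    calc _ ≤ T.length * T.length := h1
      _ < 2 ^ (Nat.log 2 T.length + 1) * 2 ^ (Nat.log 2 T.length + 1) :=
        Nat.mul_lt_mul'' hnb hnb
      _ = 2 ^ (Nat.log 2 T.length + 1 + (Nat.log 2 T.length + 1)) := (pow_add _ _ _).symm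
      _ ≤ 2 ^ w := Nat.pow_le_pow_right (by norm_num) (by omega)
  obtain ⟨σ', k, hk, he, hout⟩ := counting_spec hP hw
    (σ := ⟨fun v => if v = .n then T.length else 0, fun _ => 0⟩) (by simp) (by simp)
  have hcode : CodeAt (counting.compile 0 ++ [Instr.halt]) 0 (counting.compile 0) := by
    intro i hi
    rw [zero_add, List.getElem?_append_left hi]
  have hTw : T.length % 2 ^ w = T.length := Nat.mod_eq_of_lt (by omega)
  -- Register 0 is the variable `n`. Register 1, which holds the pattern length, is a temporary and
  -- represents nothing.
  have hrep : Rep w ⟨fun v => if v = .n then T.length else 0, fun _ => 0⟩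
      (init w T.length P.length).reg (init w T.length P.length).mem := by
    refine ⟨fun v => ?_, fun a => by simp [init]⟩
    simp only [init, hTw]
    cases v <;> simp [Var.idx]
    exact_mod_cast hTw.symm
  obtain ⟨reg', mem', hrun, hrep'⟩ := he.run_compile (by omega) 0 _ _ hcode hrep
  refine ⟨k, hk, _, hrun, ?_, ?_⟩
  · rw [zero_add, ← length_compile counting 0, List.getElem?_append_right le_rfl]
    simp
  · have := hrep'.1 .n
    rw [hout, ← Nat.cast_ofNat (R := ℤ) (n := 2), ← Nat.cast_pow, ← Int.natCast_mod,
      Nat.mod_eq_of_lt hcard] at this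
    exact_mod_cast this

theorem isBigO_time : (fun n : ℕ => ((6000 * ((n + 1) * (Nat.log 2 n + 2) ^ 2) : ℕ) : ℝ)) =O[atTop]
    (fun n : ℕ => (n : ℝ) * Real.log n ^ 2) := by
  refine IsBigO.of_bound (6000 * (2 * 16)) (eventually_atTop.2 ⟨3, fun n hn => ?_⟩)
  have hn3 : (3 : ℝ) ≤ n := by exact_mod_cast hn
  have hlog1 : 1 ≤ Real.log n := by
    rw [Real.le_log_iff_exp_le (by linarith)]
    linarith [Real.exp_one_lt_d9]
  have hlog2 : (Nat.log 2 n : ℝ) ≤ 2 * Real.log n := by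
    have h1 : ((2 : ℝ) ^ Nat.log 2 n) ≤ n := by
      exact_mod_cast Nat.pow_log_le_self 2 (by omega)
    have h2 := Real.log_le_log (by positivity) h1
    rw [Real.log_pow] at h2
    have h3 := Real.log_two_gt_d9
    nlinarith [Nat.cast_nonneg (α := ℝ) (Nat.log 2 n)]
  rw [Real.norm_of_nonneg (by positivity), Real.norm_of_nonneg (by positivity)]
  push_cast
  -- Uses `log n ≥ 1`, which holds from `n = 3` on, and `log 2 > 1 / 2`.
  have h4 : (Nat.log 2 n + 2 : ℝ) ^ 2 ≤ (4 * Real.log n) ^ 2 :=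
    pow_le_pow_left₀ (by positivity) (by linarith) 2
  calc (6000 : ℝ) * ((n + 1) * (Nat.log 2 n + 2) ^ 2)
      ≤ 6000 * ((2 * n) * (4 * Real.log n) ^ 2) := by gcongr; linarith
    _ = _ := by ring

theorem isBigO_space :
    (fun n : ℕ => ((11 * (4 * n + 2) : ℕ) : ℝ)) =O[atTop] (fun n : ℕ => (n : ℝ)) := by
  refine IsBigO.of_bound 66 (eventually_atTop.2 ⟨1, fun n hn => ?_⟩)
  have hn1 : (1 : ℝ) ≤ n := by exact_mod_cast hn
  rw [Real.norm_of_nonneg (by positivity), Real.norm_of_nonneg (by positivity)]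
  push_cast
  linarith

end WordRAM

theorem theorem10 :
    ∃ (prog : WordRAM.Program) (c : ℕ) (time space : ℕ → ℕ),
      1 ≤ c ∧
      (fun n => (time n : ℝ)) =O[atTop] (fun n : ℕ => (n : ℝ) * Real.log n ^ 2) ∧
      (fun n => (space n : ℝ)) =O[atTop] (fun n : ℕ => (n : ℝ)) ∧
      ∀ (α : Type*) [LinearOrder α] (T P : List α), P.length = 3 →
        ∀ w : ℕ, c * (Nat.log 2 T.length + 1) ≤ w →
          WordRAM.Computes prog w T P (time T.length) (space T.length)
            (equidistantOccurrences T P).card :=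
  ⟨_, 100, _, _, by norm_num, WordRAM.isBigO_time, WordRAM.isBigO_space,
    fun _ _ _ _ hP _ hw => WordRAM.counting_computes hP hw⟩
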